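/- Let $\alpha,\beta,\varepsilon$ be positive integers with $\alpha<\beta<\varepsilon$, let $p$ be a prime, and let $K$ be a (finite or infinite) field of characteristic $p$ with $$|K| > 1+2(p^\varepsilon+p^\beta)(p^\alpha+p^\beta+1)-p^\alpha(p^\alpha+1).$$ Let $E=K^2$ be the natural representation of $\mathrm{SL}_2(K)$. For a representation $V$ of a group $G$ over $K$ and $r\ge 0$, let $\mathrm{Sym}^r V$ be the space of coinvariants and $\mathrm{Sym}_r V$ the space of invariants of the symmetric group $S_r$ acting on $V^{\otimes r}$ by place permutations. For a partition $\lambda$ with $k$ parts, let $\nabla^\lambda V$ be the subrepresentation of $\mathrm{Sym}^{\lambda_1}V\otimes\cdots\otimes\mathrm{Sym}^{\lambda_k}V$ spanned by the elements $$\mathbf e(t)=\sum_{\sigma}\mathrm{sgn}(\sigma)\bigotimes_{i=1}^{k}\prod_{j=1}^{\lambda_i} t\bigl(\sigma^{-1}(i,j)\bigr),$$ where $t$ runs over all functions from the boxes of the Young diagram of $\lambda$ to $V$ and $\sigma$ runs over the permutations of the boxes that preserve each column. Let $\Delta^\lambda V=(\nabla^\lambda(V^*))^*$. Then the eight representations of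 $\mathrm{SL}_2(K)$ $$F^{(p^{a}+1,\,1^{p^{b}})}\,S^{\,p^\varepsilon+p^{b}}E,\qquad F\in\{\Delta,\nabla\},\quad S^{\,r}\in\{\mathrm{Sym}^{r},\mathrm{Sym}_{r}\},\quad (a,b)\in\{(\alpha,\beta),(\beta,\alpha)\},$$ are pairwise non-isomorphic. -/

import Mathlib

open scoped TensorProduct
open CategoryTheory

noncomputable section

namespace Plethysm

universe u v

variable {K : Type u} [Field K] {G : Type v} [Group G] {V : Type u} [AddCommGroup V] [Module K V]

/-! ### Tensor powers, upper and lower symmetric powers -/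

/-- The diagonal action of `G` on the tensor power of `V` with factors indexed by `ι`. -/
def tensorPowerRep (ι : Type) (ρ : Representation K G V) :
    Representation K G (⨂[K] _ : ι, V) where
  toFun g := PiTensorProduct.map fun _ => ρ g
  map_one' := by
    rw [map_one]; exact PiTensorProduct.map_one
  map_mul' g h := by
    rw [map_mul]; exact PiTensorProduct.map_mul (fun _ => ρ g) (fun _ => ρ h)

/-- The place permutation `w ↦ w · σ`, which sends `⊗ᵢ vᵢ` to `⊗ᵢ v_{σ⁻¹ i}`. -/
def placePerm (K : Type u) [Field K] (V : Type u) [AddCommGroup V] [Module K V] {ι : Type}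
    (σ : Equiv.Perm ι) : (⨂[K] _ : ι, V) →ₗ[K] (⨂[K] _ : ι, V) :=
  (PiTensorProduct.reindex K (fun _ : ι => V) σ).toLinearMap

theorem placePerm_tprod {ι : Type} (σ : Equiv.Perm ι) (v : ι → V) :
    placePerm K V σ (PiTensorProduct.tprod K v) = PiTensorProduct.tprod K fun i => v (σ⁻¹ i) :=
  PiTensorProduct.reindex_tprod σ v

theorem placePerm_tensorPowerRep {ι : Type} (ρ : Representation K G V) (g : G)
    (σ : Equiv.Perm ι) (w : ⨂[K] _ : ι, V) :
    placePerm K V σ (tensorPowerRep ι ρ g w) = tensorPowerRep ι ρ g (placePerm K V σ w) :=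
  (PiTensorProduct.map_reindex (fun _ : ι => ρ g) σ w).symm

/-- The span of all `w · σ - w`. -/
def symRelations (K : Type u) [Field K] (ι : Type) (V : Type u) [AddCommGroup V] [Module K V] :
    Submodule K (⨂[K] _ : ι, V) :=
  Submodule.span K {x | ∃ (w : ⨂[K] _ : ι, V) (σ : Equiv.Perm ι), x = placePerm K V σ w - w}

/-- The upper symmetric power (coinvariants of place permutation), with factors indexed by `ι`.
(Mathlib's `SymmetricPower` forces `K` and `ι` to live in the same universe.) -/
def SymUpper (K : Type u) [Field K] (ι : Type) (V : Type u) [AddCommGroup V] [Module K V] :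
    Type u :=
  (⨂[K] _ : ι, V) ⧸ symRelations K ι V

instance (ι : Type) : AddCommGroup (SymUpper K ι V) :=
  inferInstanceAs (AddCommGroup ((⨂[K] _ : ι, V) ⧸ symRelations K ι V))

instance (ι : Type) : Module K (SymUpper K ι V) :=
  inferInstanceAs (Module K ((⨂[K] _ : ι, V) ⧸ symRelations K ι V))

/-- The quotient map from the tensor power to the upper symmetric power. -/
def symMk (K : Type u) [Field K] (ι : Type) (V : Type u) [AddCommGroup V] [Module K V] :
    (⨂[K] _ : ι, V) →ₗ[K] SymUpper K ι V :=
  (symRelations K ι V).mkQ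

/-- The product `∏ᵢ vᵢ` in the upper symmetric power. -/
def symProd {ι : Type} (v : ι → V) : SymUpper K ι V :=
  symMk K ι V (PiTensorProduct.tprod K v)

theorem symRelations_le_comap (ι : Type) (ρ : Representation K G V) (g : G) :
    symRelations K ι V ≤ (symRelations K ι V).comap (tensorPowerRep ι ρ g) := by
  refine Submodule.span_le.2 ?_
  rintro _ ⟨w, σ, rfl⟩
  refine Submodule.subset_span ⟨tensorPowerRep ι ρ g w, σ, ?_⟩
  rw [map_sub, placePerm_tensorPowerRep]

/-- The action of `G` on the upper symmetric power. -/
def symUpperRep (ι : Type) (ρ : Representation K G V) : Representation K G (SymUpper K ι V) :=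
  (tensorPowerRep ι ρ).quotient (symRelations K ι V) (symRelations_le_comap ι ρ)

theorem symUpperRep_symProd {ι : Type} (ρ : Representation K G V) (g : G) (v : ι → V) :
    symUpperRep ι ρ g (symProd v) = symProd (K := K) fun i => ρ g (v i) := by
  have h : ∀ w, symUpperRep ι ρ g (symMk K ι V w) = symMk K ι V (tensorPowerRep ι ρ g w) :=
    fun _ => rfl
  exact (h _).trans (congrArg (symMk K ι V) (PiTensorProduct.map_tprod _ _))

/-- The lower symmetric power: the tensors fixed by every place permutation. -/
def SymLower (K : Type u) [Field K] (ι : Type) (V : Type u) [AddCommGroup V] [Module K V] :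
    Submodule K (⨂[K] _ : ι, V) where
  carrier := {w | ∀ σ : Equiv.Perm ι, placePerm K V σ w = w}
  add_mem' ha hb σ := by rw [map_add, ha σ, hb σ]
  zero_mem' σ := map_zero _
  smul_mem' c x hx σ := by rw [map_smul, hx σ]

theorem symLower_le_comap (ι : Type) (ρ : Representation K G V) (g : G) :
    SymLower K ι V ≤ (SymLower K ι V).comap (tensorPowerRep ι ρ g) := by
  intro w hw σ
  rw [placePerm_tensorPowerRep, hw σ]

/-- The action of `G` on the lower symmetric power. -/
def symLowerRep (ι : Type) (ρ : Representation K G V) : Representation K G (SymLower K ι V) :=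
  (tensorPowerRep ι ρ).subrepresentation (SymLower K ι V) (symLower_le_comap ι ρ)

/-! ### Schur functors and their duals

Boxes of a Young diagram `μ` are pairs `(row, column)`, both counted from `0`.  Tableaux have
entries in `V` itself; `schur_eq_span_basis` shows that it makes no difference to restrict the
entries to a fixed basis of `V`. -/

/-- The boxes of a Young diagram. -/
abbrev Box (μ : YoungDiagram) : Type := {c : ℕ × ℕ // c ∈ μ.cells}

/-- The box in row `i` and column `j`. -/
def box (μ : YoungDiagram) (i : Fin (μ.colLen 0)) (j : Fin (μ.rowLen i)) : Box μ :=
  ⟨(i, j), YoungDiagram.mem_iff_lt_rowLen.2 j.2⟩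

/-- `CPP(μ)`: the permutations of the boxes that preserve every column. -/
def columnPerms (μ : YoungDiagram) : Finset (Equiv.Perm (Box μ)) :=
  Finset.univ.filter fun σ => ∀ c, (σ c).1.2 = c.1.2

/-- `Sym^μ V`, the tensor product over the rows `i` of the upper symmetric powers
`Sym^{μᵢ} V`. -/
def SymDiagram (K : Type u) [Field K] (μ : YoungDiagram) (V : Type u) [AddCommGroup V]
    [Module K V] : Type u :=
  ⨂[K] i : Fin (μ.colLen 0), SymUpper K (Fin (μ.rowLen i)) V

instance (μ : YoungDiagram) : AddCommGroup (SymDiagram K μ V) :=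
  inferInstanceAs (AddCommGroup (⨂[K] i : Fin (μ.colLen 0), SymUpper K (Fin (μ.rowLen i)) V))

instance (μ : YoungDiagram) : Module K (SymDiagram K μ V) :=
  inferInstanceAs (Module K (⨂[K] i : Fin (μ.colLen 0), SymUpper K (Fin (μ.rowLen i)) V))

/-- The pure tensor `⊗ᵢ xᵢ` in `Sym^μ V`, as a multilinear map. -/
def symDiagramTprod (K : Type u) [Field K] (μ : YoungDiagram) (V : Type u) [AddCommGroup V]
    [Module K V] : MultilinearMap K (fun i : Fin (μ.colLen 0) => SymUpper K (Fin (μ.rowLen i)) V)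
      (SymDiagram K μ V) :=
  PiTensorProduct.tprod K

/-- The action of `G` on `Sym^μ V`. -/
def symDiagramRep (μ : YoungDiagram) (ρ : Representation K G V) :
    Representation K G (SymDiagram K μ V) where
  toFun g := PiTensorProduct.map fun i => symUpperRep (Fin (μ.rowLen i)) ρ g
  map_one' := by
    simp only [map_one]; exact PiTensorProduct.map_one
  map_mul' g h := by
    simp only [map_mul]
    exact PiTensorProduct.map_mul
      (fun i : Fin (μ.colLen 0) => symUpperRep (Fin (μ.rowLen i)) ρ g)
      (fun i : Fin (μ.colLen 0) => symUpperRep (Fin (μ.rowLen i)) ρ h)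

/-- The element of `Sym^μ V` attached to a tableau: the tensor product over the rows of the
product of the entries in each row. -/
def rowTensor (K : Type u) [Field K] {V : Type u} [AddCommGroup V] [Module K V]
    {μ : YoungDiagram} (t : Box μ → V) : SymDiagram K μ V :=
  symDiagramTprod K μ V fun i => symProd (K := K) fun j => t (box μ i j)

/-- The polytabloid `e(t) = ∑ sgn(σ) s(t · σ)`, summed over the column preserving permutations `σ`,
where `(t · σ)(c) = t(σ⁻¹ c)`. -/
def polytabloid (K : Type u) [Field K] {V : Type u} [AddCommGroup V] [Module K V]
    {μ : YoungDiagram} (t : Box μ → V) : SymDiagram K μ V :=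
  ∑ σ ∈ columnPerms μ, ((Equiv.Perm.sign σ : ℤ) : K) • rowTensor K fun c => t (σ⁻¹ c)

/-- `∇^μ V`, the subspace of `Sym^μ V` spanned by the polytabloids. -/
def Schur (K : Type u) [Field K] (μ : YoungDiagram) (V : Type u) [AddCommGroup V] [Module K V] :
    Submodule K (SymDiagram K μ V) :=
  Submodule.span K (Set.range fun t : Box μ → V => polytabloid K t)

theorem symDiagramRep_rowTensor {μ : YoungDiagram} (ρ : Representation K G V) (g : G)
    (t : Box μ → V) :
    symDiagramRep μ ρ g (rowTensor K t) = rowTensor K fun c => ρ g (t c) := by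
  refine (PiTensorProduct.map_tprod _ _).trans ?_
  simp only [symUpperRep_symProd]
  rfl

theorem symDiagramRep_polytabloid {μ : YoungDiagram} (ρ : Representation K G V) (g : G)
    (t : Box μ → V) :
    symDiagramRep μ ρ g (polytabloid K t) = polytabloid K fun c => ρ g (t c) := by
  simp only [polytabloid, map_sum, map_smul, symDiagramRep_rowTensor]

theorem schur_le_comap (μ : YoungDiagram) (ρ : Representation K G V) (g : G) :
    Schur K μ V ≤ (Schur K μ V).comap (symDiagramRep μ ρ g) := by
  refine Submodule.span_le.2 ?_
  rintro _ ⟨t, rfl⟩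
  refine Submodule.subset_span ⟨fun c => ρ g (t c), ?_⟩
  exact (symDiagramRep_polytabloid ρ g t).symm

/-- The action of `G` on `∇^μ V`. -/
def schurRep (μ : YoungDiagram) (ρ : Representation K G V) : Representation K G (Schur K μ V) :=
  (symDiagramRep μ ρ).subrepresentation (Schur K μ V) (schur_le_comap μ ρ)

/-- The action of `G` on `Δ^μ V = (∇^μ (V*))*`. -/
def weylRep (μ : YoungDiagram) (ρ : Representation K G V) :
    Representation K G (Module.Dual K (Schur K μ (Module.Dual K V))) :=
  (schurRep μ ρ.dual).dual

theorem exists_box {μ : YoungDiagram} (c : Box μ) : ∃ i j, c = box μ i j := by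
  obtain ⟨⟨i, j⟩, h⟩ := c
  exact ⟨⟨i, YoungDiagram.mem_iff_lt_colLen.1 (μ.up_left_mem le_rfl (Nat.zero_le j) h)⟩,
    ⟨j, YoungDiagram.mem_iff_lt_rowLen.1 h⟩, rfl⟩

theorem rowTensor_update {μ : YoungDiagram} [DecidableEq (Box μ)] (t : Box μ → V)
    (i : Fin (μ.colLen 0)) (j : Fin (μ.rowLen i)) (x : V) :
    rowTensor K (Function.update t (box μ i j) x) =
      symDiagramTprod K μ V (Function.update (fun i => symProd (K := K) fun j => t (box μ i j)) i
        (symProd (K := K) (Function.update (fun j => t (box μ i j)) j x))) := by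
  unfold rowTensor
  congr 1
  funext i'
  by_cases hi : i' = i
  · subst hi
    rw [Function.update_self]
    congr 1
    funext j'
    by_cases hj : j' = j
    · subst hj; simp
    · rw [Function.update_of_ne hj, Function.update_of_ne]
      intro h
      exact hj (Fin.ext (congrArg (fun c : Box μ => c.1.2) h))
  · rw [Function.update_of_ne hi]
    congr 1
    funext j'
    rw [Function.update_of_ne]
    intro h
    exact hi (Fin.ext (congrArg (fun c : Box μ => c.1.1) h))

/-- The tensor attached to a tableau as a multilinear function of its entries. -/
def rowTensorMultilinear (K : Type u) [Field K] (V : Type u) [AddCommGroup V] [Module K V]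
    (μ : YoungDiagram) : MultilinearMap K (fun _ : Box μ => V) (SymDiagram K μ V) where
  toFun t := rowTensor K t
  map_update_add' := by
    intro inst t c x y
    obtain ⟨i, j, rfl⟩ := exists_box c
    simp only [rowTensor_update, symProd, MultilinearMap.map_update_add, map_add]
  map_update_smul' := by
    intro inst t c a x
    obtain ⟨i, j, rfl⟩ := exists_box c
    simp only [rowTensor_update, symProd, MultilinearMap.map_update_smul, map_smul]

/-- The polytabloid as a multilinear function of the entries of the tableau. -/
def polytabloidMultilinear (K : Type u) [Field K] (V : Type u) [AddCommGroup V] [Module K V]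
    (μ : YoungDiagram) : MultilinearMap K (fun _ : Box μ => V) (SymDiagram K μ V) :=
  ∑ σ ∈ columnPerms μ,
    ((Equiv.Perm.sign σ : ℤ) : K) • (rowTensorMultilinear K V μ).domDomCongr σ⁻¹

theorem polytabloidMultilinear_apply {μ : YoungDiagram} (t : Box μ → V) :
    polytabloidMultilinear K V μ t = polytabloid K t := by
  simp only [polytabloidMultilinear, polytabloid, sum_apply]
  rfl

/-- `∇^μ V` is spanned by the polytabloids with entries from any given basis of `V`. -/
theorem schur_eq_span_basis (μ : YoungDiagram) {B : Type*} (v : Module.Basis B K V) :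
    Schur K μ V = Submodule.span K (Set.range fun t : Box μ → B => polytabloid K (v ∘ t)) := by
  have h : ∀ t : Box μ → V, PiTensorProduct.lift (polytabloidMultilinear K V μ)
      (PiTensorProduct.tprod K t) = polytabloid K t := fun t => by
    rw [PiTensorProduct.lift.tprod, polytabloidMultilinear_apply]
  have h1 := congrArg (Submodule.map (PiTensorProduct.lift (polytabloidMultilinear K V μ)))
    (PiTensorProduct.span_tprod_eq_top (R := K) (s := fun _ : Box μ => V))
  have h2 := congrArg (Submodule.map (PiTensorProduct.lift (polytabloidMultilinear K V μ)))
    (Basis.piTensorProduct (fun _ : Box μ => v)).span_eq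
  rw [Submodule.map_span, ← Set.range_comp] at h1 h2
  have e1 : (fun t : Box μ → V => polytabloid K t) =
      PiTensorProduct.lift (polytabloidMultilinear K V μ) ∘ PiTensorProduct.tprod K :=
    funext fun t => (h t).symm
  have e2 : (fun t : Box μ → B => polytabloid K (v ∘ t)) =
      PiTensorProduct.lift (polytabloidMultilinear K V μ) ∘
        Basis.piTensorProduct (fun _ : Box μ => v) := by
    funext t
    rw [Function.comp_apply, Basis.piTensorProduct_apply, h]
    rfl
  rw [Schur, e1, e2, h1, h2]

/-! ### The modules in the theorem -/

/-- The natural two-dimensional representation `E` of `SL₂(K)`, acting on column vectors. -/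
def naturalRep (K : Type u) [Field K] :
    Representation K (Matrix.SpecialLinearGroup (Fin 2) K) (Fin 2 → K) where
  toFun g := Matrix.toLin' g.1
  map_one' := Matrix.toLin'_one
  map_mul' g h := Matrix.toLin'_mul g.1 h.1

/-- The Young diagram of the hook partition `(a + 1, 1, …, 1)` with `b` trailing ones. -/
def hook (a b : ℕ) : YoungDiagram :=
  YoungDiagram.ofRowLens ((a + 1) :: List.replicate b 1) (by
    refine List.Pairwise.sortedGE (List.pairwise_cons.2 ⟨?_, ?_⟩)
    · intro x hx
      rw [List.eq_of_mem_replicate hx]; omega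
    · exact List.pairwise_replicate.2 (Or.inr le_rfl))

theorem rowLens_hook (a b : ℕ) : (hook a b).rowLens = (a + 1) :: List.replicate b 1 :=
  YoungDiagram.rowLens_ofRowLens_eq_self (by
    intro x hx
    rcases List.mem_cons.1 hx with rfl | hx
    · omega
    · rw [List.eq_of_mem_replicate hx]; omega)

/-- The two kinds of symmetric power. -/
inductive SymKind
  | upper
  | lower

/-- The two kinds of Schur functor: `∇` and its dual `Δ`. -/
inductive SchurKind
  | nabla
  | delta

/-- `Sym^r A` or `Sym_r A`. -/
def SymKind.apply (S : SymKind) (r : ℕ) (A : Rep.{u} K G) : Rep.{u} K G :=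
  match S with
  | .upper => Rep.of (symUpperRep (Fin r) A.ρ)
  | .lower => Rep.of (symLowerRep (Fin r) A.ρ)

/-- `∇^μ A` or `Δ^μ A`. -/
def SchurKind.apply (F : SchurKind) (μ : YoungDiagram) (A : Rep.{u} K G) : Rep.{u} K G :=
  match F with
  | .nabla => Rep.of (schurRep μ A.ρ)
  | .delta => Rep.of (weylRep μ A.ρ)

/-- The `SL₂(K)`-module `F^{(p^α + 1, 1^{p^β})} S^{p^ε + p^β} E`, where `F` is `∇` or `Δ` and `S` is
`Sym^` or `Sym_`. -/
def hookModule (K : Type u) [Field K] (p ε : ℕ) (F : SchurKind) (S : SymKind) (α β : ℕ) :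
    Rep.{u} K (Matrix.SpecialLinearGroup (Fin 2) K) :=
  F.apply (hook (p ^ α) (p ^ β)) (S.apply (p ^ ε + p ^ β) (Rep.of (naturalRep K)))

/-- The eight modules obtained from `Δ^{(p^α + 1, 1^{p^β})} Sym^{p^ε + p^β} E` by choosing `Δ` or `∇`,
choosing `Sym^` or `Sym_`, and swapping `α` and `β` or not. -/
def eightModules (K : Type u) [Field K] (p α β ε : ℕ) (c : SchurKind × SymKind × Bool) :
    Rep.{u} K (Matrix.SpecialLinearGroup (Fin 2) K) :=
  match c with
  | (F, S, false) => hookModule K p ε F S α β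
  | (F, S, true) => hookModule K p ε F S β α

end Plethysm

end

/-! Write q = p^ε, and for a hook (M+1, 1^N) with {M, N} = {p^α, p^β} put m = q + N. Dualizing
exchanges `Sym^m E` and `Sym_m E` (`IsUpperModel.dual`, `IsLowerModel.dual`), so each of the eight
modules is ∇X or (∇X)*, where X has the structure constants of `Sym^m E` or of `Sym_m E`: Δ Sym^ is
the dual of a ∇ of lower type, and Δ Sym_ the dual of a ∇ of upper type. For each ∇X the weight w =
q(p^α + p^β + 1) + p^(α+β), symmetric in α and β, is the highest one, and its weight space is the
line spanned by the tableau with column 0, …, N and arm 0. The lower unitriangular matrices act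
polynomially in t. The set of degrees d whose coefficient operator does not kill the vectors of
weight w is an isomorphism invariant, `MovesHighest`.

To compute it, evaluate row i at a linear form into a commutative ring. A hook polytabloid becomes a
determinant times a product over the arm (`hookEval_hookElt`), and generic forms lose nothing. For X
of upper type, (1+t)^(q+n) = (1+t)^n (1+t^q) makes the determinant a polynomial in t^q
(`det_rowPoly_lowerCoeff`). The arm is the M-th power of a_0 + a_N t^N + a_q t^q + a_(q+N) t^(q+N),
and M is a power of p. The following separations result. Degree 1 moves the highest weight in all
Sym_ modules and in no Sym^ module. Δ Sym^ is moved in degree N and only in multiples of N, which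
separates the two swapped versions. ∇ Sym^ is moved in neither of the degrees p^α, p^β. For p odd,
the two modules ∇ Sym^ differ in degree q(p^β - 1): this is reached by the determinant when N = p^β,
and falls in a gap between the terms when N = p^α. The Sym_ pairs reduce to the same statements by
dualizing.

For p = 2 that gap can miss the degree, and the weight w - 4 is used instead. In characteristic 2
the form x_1^2 + x_0 x_2 is fixed by the upper unitriangular matrices, so multiplying it into the
highest weight vector gives an invariant. Take d = 2·2^α - 2. When N = 2^α, this vector is killed by
the operators of degrees 1 and d (`IsUpperModel.hasInvariant`). When N = 2^β, the weight space is
spanned by five tableaux and the same conditions force all five coefficients to vanish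
(`IsUpperModel.not_hasInvariant`).

The field may be finite, so coefficients in t and weight spaces are extracted by Lagrange
interpolation at a finite set of units (`sum_extract_smul_eval`). The bound on |K| supplies enough
nodes (`exists_hookNodes`). -/

open scoped TensorProduct
open CategoryTheory

noncomputable section

namespace Plethysm

universe u v w

/-! ### Evaluating `Sym^μ V` at one linear form per row -/

section Evaluation

variable {K : Type u} [Field K] {V : Type u} [AddCommGroup V] [Module K V]
  {A : Type w} [CommRing A] [Algebra K A]

/-- The multiplicative extension of a linear map `f : V → A` to the upper symmetric power. -/
def symEval (ι : Type) [Fintype ι] (f : V →ₗ[K] A) : SymUpper K ι V →ₗ[K] A :=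
  (symRelations K ι V).liftQ
    (PiTensorProduct.lift ((MultilinearMap.mkPiAlgebra K ι A).compLinearMap fun _ => f)) (by
      refine Submodule.span_le.2 ?_
      rintro _ ⟨w, σ, rfl⟩
      rw [SetLike.mem_coe, LinearMap.mem_ker, map_sub, sub_eq_zero]
      have h : (PiTensorProduct.lift
          ((MultilinearMap.mkPiAlgebra K ι A).compLinearMap fun _ => f)) ∘ₗ placePerm K V σ =
          PiTensorProduct.lift ((MultilinearMap.mkPiAlgebra K ι A).compLinearMap fun _ => f) := by
        refine PiTensorProduct.ext ?_
        ext v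
        simp only [LinearMap.compMultilinearMap_apply, LinearMap.comp_apply, placePerm_tprod,
          PiTensorProduct.lift.tprod, MultilinearMap.compLinearMap_apply,
          MultilinearMap.mkPiAlgebra_apply]
        exact Equiv.prod_comp σ⁻¹ fun i => f (v i)
      exact LinearMap.congr_fun h w)

theorem symEval_symProd {ι : Type} [Fintype ι] (f : V →ₗ[K] A) (v : ι → V) :
    symEval ι f (symProd v) = ∏ i, f (v i) := by
  change PiTensorProduct.lift ((MultilinearMap.mkPiAlgebra K ι A).compLinearMap fun _ => f)
    (PiTensorProduct.tprod K v) = _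
  simp

theorem symProd_comp_perm {ι : Type} (σ : Equiv.Perm ι) (v : ι → V) :
    symProd (K := K) (fun i => v (σ i)) = symProd v := by
  have h : PiTensorProduct.tprod K (fun i => v (σ i)) =
      placePerm K V σ⁻¹ (PiTensorProduct.tprod K v) := by
    rw [placePerm_tprod, inv_inv]
  refine (Submodule.Quotient.eq (symRelations K ι V)).2 ?_
  rw [h]
  exact Submodule.subset_span ⟨_, σ⁻¹, rfl⟩

/-- The evaluation of `Sym^μ V` at linear maps `Z i : V → A`, one for each row `i`. -/
def diagramEval (μ : YoungDiagram) (Z : ℕ → V →ₗ[K] A) : SymDiagram K μ V →ₗ[K] A :=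
  PiTensorProduct.lift ((MultilinearMap.mkPiAlgebra K (Fin (μ.colLen 0)) A).compLinearMap
    fun i => symEval (Fin (μ.rowLen i)) (Z i))

theorem box_bijective (μ : YoungDiagram) :
    Function.Bijective fun c : Σ i : Fin (μ.colLen 0), Fin (μ.rowLen i) => box μ c.1 c.2 := by
  refine ⟨?_, fun c => ?_⟩
  · rintro ⟨i, j⟩ ⟨i', j'⟩ h
    have h1 : i = i' := Fin.ext (congrArg (fun c : Box μ => c.1.1) h)
    subst h1
    have h2 : j = j' := Fin.ext (congrArg (fun c : Box μ => c.1.2) h)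
    subst h2
    rfl
  · obtain ⟨i, j, rfl⟩ := exists_box c
    exact ⟨⟨i, j⟩, rfl⟩

theorem prod_box {μ : YoungDiagram} {R : Type*} [CommMonoid R] (f : Box μ → R) :
    ∏ i : Fin (μ.colLen 0), ∏ j : Fin (μ.rowLen i), f (box μ i j) = ∏ c, f c := by
  rw [← Fintype.prod_sigma' (fun (i : Fin (μ.colLen 0)) (j : Fin (μ.rowLen i)) => f (box μ i j))]
  exact (box_bijective μ).prod_comp f

theorem diagramEval_rowTensor {μ : YoungDiagram} (Z : ℕ → V →ₗ[K] A) (t : Box μ → V) :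
    diagramEval μ Z (rowTensor K t) = ∏ c : Box μ, Z c.1.1 (t c) := by
  have h : diagramEval μ Z (rowTensor K t) =
      ∏ i : Fin (μ.colLen 0), symEval (Fin (μ.rowLen i)) (Z i) (symProd fun j => t (box μ i j)) :=
    PiTensorProduct.lift.tprod _
  rw [h, ← prod_box]
  exact Finset.prod_congr rfl fun i _ => symEval_symProd _ _

theorem diagramEval_polytabloid {μ : YoungDiagram} (Z : ℕ → V →ₗ[K] A) (t : Box μ → V) :
    diagramEval μ Z (polytabloid K t) =
      ∑ σ ∈ columnPerms μ, ((Equiv.Perm.sign σ : ℤ) : A) * ∏ c : Box μ, Z c.1.1 (t (σ⁻¹ c)) := by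
  rw [polytabloid, map_sum]
  refine Finset.sum_congr rfl fun σ _ => ?_
  rw [map_smul, diagramEval_rowTensor, Algebra.smul_def, map_intCast]

theorem exists_perm_of_card_fiber_eq {ι : Type} [Fintype ι] {B : Type*} [DecidableEq B]
    {f f' : ι → B} (h : ∀ x, (Finset.univ.filter fun j => f j = x).card =
      (Finset.univ.filter fun j => f' j = x).card) :
    ∃ σ : Equiv.Perm ι, ∀ j, f' (σ j) = f j := by
  have e := fun x => (show Nonempty ({j // f j = x} ≃ {j // f' j = x}) from
    Fintype.card_eq.1 (by rw [Fintype.card_subtype, Fintype.card_subtype, h])).some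
  exact ⟨(Equiv.sigmaFiberEquiv f).symm.trans
    ((Equiv.sigmaCongrRight e).trans (Equiv.sigmaFiberEquiv f')), fun j => (e (f j) ⟨j, rfl⟩).2⟩

theorem symProd_congr {ι : Type} [Fintype ι] {B : Type*} [DecidableEq B] (b : B → V)
    {f f' : ι → B} (h : ∀ x, (Finset.univ.filter fun j => f j = x).card =
      (Finset.univ.filter fun j => f' j = x).card) :
    symProd (K := K) (b ∘ f) = symProd (b ∘ f') := by
  obtain ⟨σ, hσ⟩ := exists_perm_of_card_fiber_eq h
  refine Eq.trans ?_ (symProd_comp_perm σ (b ∘ f'))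
  simp only [Function.comp_def, hσ]

/-- Two tableaux whose rows agree up to permutation have the same row tensor. -/
theorem rowTensor_congr {μ : YoungDiagram} {B : Type*} [DecidableEq B] (b : B → V) {t t' : Box μ → B}
    (h : ∀ i : ℕ, ∀ x : B, (Finset.univ.filter fun c : Box μ => c.1.1 = i ∧ t c = x).card =
      (Finset.univ.filter fun c : Box μ => c.1.1 = i ∧ t' c = x).card) :
    rowTensor K (b ∘ t) = rowTensor K (b ∘ t') := by
  unfold rowTensor
  congr 1
  funext i
  have h1 : ∀ t : Box μ → B, ∀ x, (Finset.univ.filter fun c : Box μ => c.1.1 = i ∧ t c = x).card =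
      (Finset.univ.filter fun j : Fin (μ.rowLen i) => t (box μ i j) = x).card := by
    intro t x
    symm
    refine Finset.card_bij (fun j _ => box μ i j) ?_ ?_ ?_
    · intro j hj
      exact Finset.mem_filter.2 ⟨Finset.mem_univ _, rfl, (Finset.mem_filter.1 hj).2⟩
    · intro j _ j' _ hh
      exact Fin.ext (congrArg (fun c : Box μ => c.1.2) hh)
    · intro c hc
      obtain ⟨i', j, rfl⟩ := exists_box c
      have hc' := (Finset.mem_filter.1 hc).2
      have hi : i' = i := Fin.ext hc'.1
      subst hi
      exact ⟨j, by simpa using hc'.2, rfl⟩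
  exact symProd_congr b (f := fun j => t (box μ i j)) (f' := fun j => t' (box μ i j))
    fun x => by rw [← h1, ← h1, h]

/-- A linear map is injective if it sends a spanning family to a family of the same shape in a
linearly independent set. -/
theorem injective_of_span_of_linearIndependent {W W' : Type*} [AddCommGroup W] [Module K W]
    [AddCommGroup W'] [Module K W'] (f : W →ₗ[K] W') {I J : Type*} (x : I → W)
    (hx : Submodule.span K (Set.range x) = ⊤) (y : J → W') (hy : LinearIndependent K y)
    (g : I → J) (hf : ∀ i, f (x i) = y (g i)) (hg : ∀ i i', g i = g i' → x i = x i') :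
    Function.Injective f := by
  classical
  let s : Set.range g → I := fun j => j.2.choose
  have hs : ∀ j : Set.range g, g (s j) = j := fun j => j.2.choose_spec
  have hsp : Submodule.span K (Set.range fun j => x (s j)) = ⊤ := by
    rw [← hx]
    congr 1
    ext w
    constructor
    · rintro ⟨j, rfl⟩; exact ⟨_, rfl⟩
    · rintro ⟨i, rfl⟩
      exact ⟨⟨g i, i, rfl⟩, hg _ _ (hs _)⟩
  have hli : LinearIndependent K (f ∘ fun j => x (s j)) := by
    have : (f ∘ fun j => x (s j)) = y ∘ (Subtype.val : Set.range g → J) := by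
      funext j
      simp only [Function.comp_apply, hf, hs]
    rw [this]
    exact hy.comp _ Subtype.val_injective
  rw [← LinearMap.ker_eq_bot, eq_bot_iff]
  intro w hw
  have hw' : w ∈ Submodule.span K (Set.range fun j => x (s j)) := hsp ▸ Submodule.mem_top
  obtain ⟨c, rfl⟩ := (Finsupp.mem_span_range_iff_exists_finsupp).1 hw'
  have h0 : c.sum (fun j a => a • (f ∘ fun j => x (s j)) j) = 0 := by
    have := LinearMap.mem_ker.1 hw
    rw [map_finsuppSum] at this
    simpa only [map_smul, Function.comp_apply] using this
  have := linearIndependent_iff.1 hli c h0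
  simp [this]

theorem span_range_symProd (ι : Type) [Finite ι] {B : Type*} (b : Module.Basis B K V) :
    Submodule.span K (Set.range fun f : ι → B => symProd (K := K) (b ∘ f)) = ⊤ := by
  have h := congrArg (Submodule.map (symMk K ι V))
    (Basis.piTensorProduct (fun _ : ι => b)).span_eq
  rw [Submodule.map_span, ← Set.range_comp, Submodule.map_top,
    show (symMk K ι V).range = ⊤ from Submodule.range_mkQ _] at h
  rw [← h]
  congr 2
  funext f
  simp only [Function.comp_apply, Basis.piTensorProduct_apply]
  rfl

theorem span_range_rowTensor (μ : YoungDiagram) {B : Type*} (b : Module.Basis B K V) :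
    Submodule.span K (Set.range fun t : Box μ → B => rowTensor K (b ∘ t)) = ⊤ := by
  -- A basis of each symmetric power is chosen among products of basis vectors, so that the
  -- resulting basis of the tensor product consists of row tensors.
  let β := fun (i : Fin (μ.colLen 0)) =>
    Module.Basis.ofSpan (span_range_symProd (Fin (μ.rowLen i)) b).ge
  have hβ : ∀ (i : Fin (μ.colLen 0)) k, ∃ f : Fin (μ.rowLen i) → B, symProd (K := K) (b ∘ f) = β i k := fun (i : Fin (μ.colLen 0)) k =>
    Module.Basis.ofSpan_subset (span_range_symProd (Fin (μ.rowLen i)) b).ge ⟨k, rfl⟩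
  choose f hf using hβ
  refine eq_top_iff.2 ((Basis.piTensorProduct β).span_eq.ge.trans (Submodule.span_mono ?_))
  rintro _ ⟨k, rfl⟩
  let t : Box μ → B := fun c =>
    f ⟨c.1.1, YoungDiagram.mem_iff_lt_colLen.1 (μ.up_left_mem le_rfl (Nat.zero_le _) c.2)⟩ (k _)
      ⟨c.1.2, YoungDiagram.mem_iff_lt_rowLen.1 c.2⟩
  refine ⟨t, ?_⟩
  rw [Basis.piTensorProduct_apply]
  change PiTensorProduct.tprod K (fun i : Fin (μ.colLen 0) => symProd (K := K) (b ∘ f i (k i))) = _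
  simp only [hf]

/-- The generic linear map in row `i`. -/
def genericRow {B : Type*} (b : Module.Basis B K V) (i : ℕ) :
    V →ₗ[K] MvPolynomial (ℕ × B) K :=
  b.constr K fun x => MvPolynomial.X (i, x)

theorem genericRow_basis {B : Type*} (b : Module.Basis B K V) (i : ℕ) (x : B) :
    genericRow b i (b x) = MvPolynomial.X (i, x) :=
  b.constr_basis K _ x

/-- A row tensor of basis vectors goes to a monomial whose exponents count the occurrences of each
basis vector in each row. These counts determine the row tensor, and distinct monomials are
independent. -/
theorem diagramEval_generic_injective (μ : YoungDiagram) {B : Type*} (b : Module.Basis B K V) :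
    Function.Injective (diagramEval μ (genericRow b)) := by
  classical
  let g : (Box μ → B) → ((ℕ × B) →₀ ℕ) := fun t => ∑ c, Finsupp.single (c.1.1, t c) 1
  have hg : ∀ t i x, g t (i, x) =
      (Finset.univ.filter fun c : Box μ => c.1.1 = i ∧ t c = x).card := by
    intro t i x
    simp only [g, Finsupp.finsetSum_apply, Finsupp.single_apply, Prod.mk.injEq,
      Finset.sum_boole, Nat.cast_id]
  refine injective_of_span_of_linearIndependent _ _ (span_range_rowTensor μ b)
    (MvPolynomial.basisMonomials (ℕ × B) K) (MvPolynomial.basisMonomials (ℕ × B) K).linearIndependent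
    g ?_ ?_
  · intro t
    rw [diagramEval_rowTensor, MvPolynomial.coe_basisMonomials]
    simp only [Function.comp_apply, genericRow_basis, g]
    rw [MvPolynomial.monomial_sum_one]
    rfl
  · intro t t' h
    exact rowTensor_congr b fun i x => by rw [← hg, ← hg, h]

end Evaluation

/-! ### Hook shapes: a determinant times an arm -/

section Hook

variable {K : Type u} [Field K] {G : Type v} [Group G] {V : Type u} [AddCommGroup V] [Module K V]
  {A : Type w} [CommRing A] [Algebra K A]

theorem mem_hook {M N i j : ℕ} : (i, j) ∈ hook M N ↔ (j = 0 ∧ i ≤ N) ∨ (i = 0 ∧ j ≤ M) := by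
  rw [hook, YoungDiagram.mem_ofRowLens]
  cases i with
  | zero => simp; omega
  | succ i => simp; omega

/-- The tableau of hook shape with first column `x` and remaining first row `y`. -/
def hookTableau {M N : ℕ} {X : Type*} (x y : ℕ → X) : Box (hook M N) → X :=
  fun c => if c.1.2 = 0 then x c.1.1 else y (c.1.2 - 1)

theorem exists_hookTableau {M N : ℕ} {X : Type*} (t : Box (hook M N) → X) :
    ∃ x y : ℕ → X, t = hookTableau x y := by
  let c0 : Box (hook M N) := ⟨(0, 0), mem_hook.2 (Or.inl ⟨rfl, Nat.zero_le _⟩)⟩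
  refine ⟨fun i => if h : i ≤ N then t ⟨(i, 0), mem_hook.2 (Or.inl ⟨rfl, h⟩)⟩ else t c0,
    fun j => if h : j + 1 ≤ M then t ⟨(0, j + 1), mem_hook.2 (Or.inr ⟨rfl, h⟩)⟩ else t c0,
    ?_⟩
  funext c
  obtain ⟨⟨i, j⟩, hc⟩ := c
  have h := mem_hook.1 hc
  unfold hookTableau
  by_cases hj : j = 0
  · subst hj
    have hi : i ≤ N := by omega
    simp [hi]
  · obtain ⟨j, rfl⟩ := Nat.exists_eq_succ_of_ne_zero hj
    obtain ⟨rfl, hM⟩ : i = 0 ∧ j + 1 ≤ M := by omega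
    simp [hM]

/-- The boxes of a hook, split into the first column and the rest of the first row. -/
def hookBoxEquiv (M N : ℕ) : Fin (N + 1) ⊕ Fin M ≃ Box (hook M N) where
  toFun := Sum.elim (fun i => ⟨(i, 0), mem_hook.2 (Or.inl ⟨rfl, by omega⟩)⟩)
    (fun j => ⟨(0, j + 1), mem_hook.2 (Or.inr ⟨rfl, by omega⟩)⟩)
  invFun c := if h : c.1.2 = 0 then
      Sum.inl ⟨c.1.1, by have := mem_hook.1 (show (c.1.1, c.1.2) ∈ hook M N from c.2); omega⟩
    else Sum.inr ⟨c.1.2 - 1, by have := mem_hook.1 (show (c.1.1, c.1.2) ∈ hook M N from c.2); omega⟩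
  left_inv := by rintro (i | j) <;> simp
  right_inv := by
    rintro ⟨⟨i, j⟩, hc⟩
    have h := mem_hook.1 hc
    by_cases hj : j = 0
    · subst hj; simp
    · have hi : i = 0 := by omega
      subst hi
      have : j - 1 + 1 = j := by omega
      simp [hj, this]

/-- All columns of a hook but the first have a single box, so only the first column can be permuted.
-/
theorem sum_columnPerms_hook {M N : ℕ} {R : Type*} [AddCommMonoid R]
    (f : Equiv.Perm (Box (hook M N)) → R) :
    ∑ σ ∈ columnPerms (hook M N), f σ =
      ∑ τ : Equiv.Perm (Fin (N + 1)),
        f ((hookBoxEquiv M N).permCongr (Equiv.sumCongr τ (Equiv.refl (Fin M)))) := by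
  symm
  refine Finset.sum_bij (fun τ _ => _) ?_ ?_ ?_ (fun _ _ => rfl)
  · intro τ _
    refine Finset.mem_filter.2 ⟨Finset.mem_univ _, fun c => ?_⟩
    obtain ⟨a, rfl⟩ := (hookBoxEquiv M N).surjective c
    rcases a with i | j <;> simp [hookBoxEquiv]
  · intro τ _ τ' _ h
    have h' := (hookBoxEquiv M N).permCongr.injective h
    ext i
    have := congrArg (fun e : Equiv.Perm (Fin (N + 1) ⊕ Fin M) => e (Sum.inl i)) h'
    simpa using congrArg Fin.val (Sum.inl_injective this)
  · intro σ hσ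
    have hσ' := (Finset.mem_filter.1 hσ).2
    let s : Equiv.Perm (Fin (N + 1) ⊕ Fin M) := (hookBoxEquiv M N).permCongr.symm σ
    have hs : ∀ a, hookBoxEquiv M N (s a) = σ (hookBoxEquiv M N a) := by
      intro a; simp [s]
    have hr : ∀ j, s (Sum.inr j) = Sum.inr j := by
      intro j
      have h1 := hσ' (hookBoxEquiv M N (Sum.inr j))
      rw [← hs] at h1
      rcases hsj : s (Sum.inr j) with i | j'
      · rw [hsj] at h1; simp [hookBoxEquiv] at h1
      · rw [hsj] at h1
        simp only [hookBoxEquiv, Equiv.coe_fn_mk, Sum.elim_inr, Nat.add_right_cancel_iff] at h1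
        rw [Fin.ext h1]
    have hl : ∀ i, ∃ i', s (Sum.inl i) = Sum.inl i' := by
      intro i
      rcases hsi : s (Sum.inl i) with i' | j'
      · exact ⟨i', rfl⟩
      -- A column box cannot move into the arm, because each arm box is already its own image.
      · rw [← hr j'] at hsi
        exact absurd (s.injective hsi) (by simp)
    choose τ hτ using hl
    have hinj : Function.Injective τ := by
      intro i i' h
      have : s (Sum.inl i) = s (Sum.inl i') := by rw [hτ, hτ, h]
      exact Sum.inl_injective (s.injective this)
    refine ⟨Equiv.ofBijective τ (Finite.injective_iff_bijective.1 hinj), Finset.mem_univ _, ?_⟩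
    refine (Equiv.eq_symm_apply _).1 (Equiv.ext fun a => ?_)
    change _ = s a
    rcases a with i | j
    · rw [hτ]; rfl
    · rw [hr]; rfl

/-- The spanning elements of `∇^{(M+1,1^N)} V`. -/
def hookElt (K : Type u) [Field K] {V : Type u} [AddCommGroup V] [Module K V] (M N : ℕ)
    (x y : ℕ → V) : Schur K (hook M N) V :=
  ⟨polytabloid K (hookTableau x y), Submodule.subset_span ⟨_, rfl⟩⟩

/-- Evaluation of `∇^{(M+1,1^N)} V` at linear maps `Z i : V → A`. -/
def hookEval (M N : ℕ) (Z : ℕ → V →ₗ[K] A) : Schur K (hook M N) V →ₗ[K] A :=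
  (diagramEval (hook M N) Z).comp (Schur K (hook M N) V).subtype

/-- The signed sum over the first column is the Leibniz formula, and the arm, lying in row 0,
factors out. All later computations in the hook modules rest on this. -/
theorem hookEval_hookElt (M N : ℕ) (Z : ℕ → V →ₗ[K] A) (x y : ℕ → V) :
    hookEval M N Z (hookElt K M N x y) =
      (Matrix.of fun i k : Fin (N + 1) => Z i (x k)).det * ∏ j ∈ Finset.range M, Z 0 (y j) := by
  have h : hookEval M N Z (hookElt K M N x y) =
      diagramEval (hook M N) Z (polytabloid K (hookTableau x y)) := rfl
  rw [h, diagramEval_polytabloid, sum_columnPerms_hook, Matrix.det_apply', Finset.sum_mul]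
  refine Finset.sum_congr rfl fun τ _ => ?_
  rw [Equiv.Perm.sign_permCongr, Equiv.Perm.sign_sumCongr, ← (hookBoxEquiv M N).prod_comp,
    Fintype.prod_sum_type, mul_assoc]
  have h1 : ∀ a, ((hookBoxEquiv M N).permCongr (Equiv.sumCongr τ (Equiv.refl (Fin M))))⁻¹
      (hookBoxEquiv M N a) = hookBoxEquiv M N (Equiv.sumCongr τ⁻¹ (Equiv.refl (Fin M)) a) := by
    intro a
    rw [Equiv.Perm.inv_eq_iff_eq]
    rcases a with i | j <;> simp
  simp only [h1]
  have h2 : ∏ i : Fin (N + 1), Z i (x (τ⁻¹ i : Fin (N + 1))) = ∏ i : Fin (N + 1), Z (τ i) (x i) := by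
    rw [← Equiv.prod_comp τ]
    simp
  rw [← Fin.prod_univ_eq_prod_range (fun j => Z 0 (y j)) M]
  simp only [Equiv.Perm.sign_refl, mul_one, Matrix.of_apply, ← h2]
  rfl

theorem span_hookElt (M N : ℕ) {m : ℕ} (b : Module.Basis (Fin (m + 1)) K V) :
    Submodule.span K {w | ∃ c r : ℕ → Fin (m + 1), w = hookElt K M N (b ∘ c) (b ∘ r)} = ⊤ := by
  refine Submodule.map_injective_of_injective (Schur K (hook M N) V).injective_subtype ?_
  rw [Submodule.map_subtype_top, Submodule.map_span]
  refine Eq.trans (congrArg _ ?_) (schur_eq_span_basis (hook M N) b).symm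
  ext w
  constructor
  · rintro ⟨_, ⟨c, r, rfl⟩, rfl⟩
    refine ⟨hookTableau c r, ?_⟩
    change polytabloid K _ = polytabloid K _
    congr 1
    funext a
    unfold hookTableau
    simp only [Function.comp_apply]
    split_ifs <;> rfl
  · rintro ⟨t, rfl⟩
    obtain ⟨c, r, rfl⟩ := exists_hookTableau t
    refine ⟨_, ⟨c, r, rfl⟩, ?_⟩
    change polytabloid K _ = polytabloid K _
    congr 1
    funext a
    unfold hookTableau
    simp only [Function.comp_apply]
    split_ifs <;> rfl

theorem schurRep_hookElt (M N : ℕ) (ρ : Representation K G V) (g : G) (x y : ℕ → V) :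
    schurRep (hook M N) ρ g (hookElt K M N x y) =
      hookElt K M N (fun i => ρ g (x i)) (fun j => ρ g (y j)) := by
  refine Subtype.ext ((symDiagramRep_polytabloid ρ g _).trans ?_)
  change _ = polytabloid K _
  congr 1
  funext c
  unfold hookTableau
  split_ifs <;> rfl

theorem hookEval_generic_injective (M N : ℕ) {B : Type*} (b : Module.Basis B K V) :
    Function.Injective (hookEval M N (genericRow b)) := by
  intro x y h
  exact Subtype.ext (diagramEval_generic_injective _ b h)

theorem finite_schur (μ : YoungDiagram) [FiniteDimensional K V] :
    FiniteDimensional K (Schur K μ V) := by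
  let b := Module.finBasis K V
  rw [schur_eq_span_basis μ b]
  exact FiniteDimensional.span_of_finite K (Set.finite_range _)

end Hook

/-! ### Weight bases with binomial structure constants, and their duals -/

section Models

open Matrix (SpecialLinearGroup)

variable {K : Type u} [Field K] {V : Type u} [AddCommGroup V] [Module K V]

/-- The lower unitriangular matrix with entry `t`. -/
def lowerUni (t : K) : SpecialLinearGroup (Fin 2) K := ⟨!![1, 0; t, 1], by simp⟩

/-- The upper unitriangular matrix with entry `t`. -/
def upperUni (t : K) : SpecialLinearGroup (Fin 2) K := ⟨!![1, t; 0, 1], by simp⟩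

/-- The diagonal matrix with entries `s` and `s⁻¹`. -/
def torus (s : Kˣ) : SpecialLinearGroup (Fin 2) K :=
  ⟨!![(s : K), 0; 0, ((s⁻¹ : Kˣ) : K)], by simp⟩

theorem lowerUni_inv (t : K) : (lowerUni t)⁻¹ = lowerUni (-t) := by
  refine inv_eq_iff_mul_eq_one.2 (Subtype.ext ?_)
  change !![1, 0; t, 1] * !![1, 0; -t, 1] = (1 : Matrix (Fin 2) (Fin 2) K)
  simp [Matrix.one_fin_two]

theorem upperUni_inv (t : K) : (upperUni t)⁻¹ = upperUni (-t) := by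
  refine inv_eq_iff_mul_eq_one.2 (Subtype.ext ?_)
  change !![1, t; 0, 1] * !![1, -t; 0, 1] = (1 : Matrix (Fin 2) (Fin 2) K)
  simp [Matrix.one_fin_two]

theorem torus_inv (s : Kˣ) : (torus s)⁻¹ = torus s⁻¹ := by
  refine inv_eq_iff_mul_eq_one.2 (Subtype.ext ?_)
  change !![(s : K), 0; 0, ((s⁻¹ : Kˣ) : K)] * !![((s⁻¹ : Kˣ) : K), 0; 0, (((s⁻¹)⁻¹ : Kˣ) : K)] = (1 : Matrix (Fin 2) (Fin 2) K)
  simp [Matrix.one_fin_two]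

/-- A basis of weight vectors on which the unitriangular matrices act by binomial-type
coefficients `L` and `U`. -/
structure IsModel {m : ℕ} (ρ : Representation K (SpecialLinearGroup (Fin 2) K) V)
    (b : Module.Basis (Fin (m + 1)) K V) (L U : ℕ → ℕ → ℕ) : Prop where
  torus : ∀ (s : Kˣ) (i : Fin (m + 1)), ρ (torus s) (b i) = ((s ^ ((m : ℤ) - 2 * i) : Kˣ) : K) • b i
  lower : ∀ (t : K) (i : Fin (m + 1)),
    ρ (lowerUni t) (b i) = ∑ j : Fin (m + 1), ((L i j : K) * t ^ (j - i : ℕ)) • b j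
  upper : ∀ (t : K) (i : Fin (m + 1)),
    ρ (upperUni t) (b i) = ∑ j : Fin (m + 1), ((U i j : K) * t ^ (i - j : ℕ)) • b j

/-- The coefficients of the dual of a model. -/
theorem IsModel.dual {m : ℕ} {ρ : Representation K (SpecialLinearGroup (Fin 2) K) V}
    {b : Module.Basis (Fin (m + 1)) K V} {L U : ℕ → ℕ → ℕ} (h : IsModel ρ b L U)
    (hL : ∀ i j, i ≤ m → j < i → L i j = 0) (hU : ∀ i j, j ≤ m → i < j → U i j = 0) :
    ∃ b' : Module.Basis (Fin (m + 1)) K (Module.Dual K V),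
      IsModel ρ.dual b' (fun i j => L (m - j) (m - i)) (fun i j => U (m - j) (m - i)) := by
  -- Reversing the dual basis makes the weights decrease again; the alternating signs absorb the
  -- change from t to -t caused by the inverse in the dual action.
  let b' : Module.Basis (Fin (m + 1)) K (Module.Dual K V) :=
    (b.dualBasis.reindex Fin.revPerm).unitsSMul fun l => (-1 : Kˣ) ^ (l : ℕ)
  have hb' : ∀ l i : Fin (m + 1), b' l (b i) = (-1) ^ (l : ℕ) * if i = Fin.rev l then 1 else 0 := by
    intro l i
    simp only [b', Module.Basis.unitsSMul_apply, Module.Basis.reindex_apply, Units.smul_def,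
      LinearMap.smul_apply, smul_eq_mul, Fin.revPerm_symm, Fin.revPerm_apply,
      Module.Basis.dualBasis_apply_self]
    push_cast
    rfl
  have hrev : ∀ i : Fin (m + 1), ((Fin.rev i : Fin (m + 1)) : ℕ) = m - i := by
    intro i; rw [Fin.val_rev]; omega
  refine ⟨b', ?_, ?_, ?_⟩
  · intro s l
    refine b.ext fun i => ?_
    rw [Representation.dual_apply, Module.Dual.transpose_apply, LinearMap.comp_apply, torus_inv,
      h.torus, map_smul, LinearMap.smul_apply, hb']
    split_ifs with hi
    · subst hi
      rw [hrev]
      congr 1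
      rw [inv_zpow', Nat.cast_sub (by omega)]
      congr 2
      ring
    · simp
  · intro t l
    refine b.ext fun i => ?_
    rw [Representation.dual_apply, Module.Dual.transpose_apply, LinearMap.comp_apply, lowerUni_inv,
      h.lower, map_sum, LinearMap.sum_apply]
    simp only [map_smul, LinearMap.smul_apply, hb', smul_eq_mul]
    rw [Finset.sum_eq_single (Fin.rev l) (by intro j _ hj; simp [hj]) (by simp),
      Finset.sum_eq_single (Fin.rev i) (by
        intro j _ hj
        have : i ≠ Fin.rev j := fun h => hj (by rw [h, Fin.rev_rev])
        simp [this]) (by simp)]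
    simp only [Fin.rev_rev, if_true, hrev]
    by_cases hli : (l : ℕ) ≤ m - i
    · have e1 : m - (m - (i : ℕ)) = i := by omega
      have e2 : m - (l : ℕ) - i = m - i - l := by omega
      have e3 : (-1 : K) ^ (m - (i : ℕ)) = (-1) ^ (m - (i : ℕ) - l) * (-1) ^ (l : ℕ) := by
        rw [← pow_add]; congr 1; omega
      rw [e1, e2, e3, neg_pow]
      ring
    -- Here the natural subtraction in the exponent truncates, but the coefficients on both sides
    -- vanish.
    · rw [hL i (m - l) (by omega) (by omega)]
      have : L (m - (m - i)) (m - l) = 0 := hL _ _ (by omega) (by omega)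
      rw [this]
      simp
  · intro t l
    refine b.ext fun i => ?_
    rw [Representation.dual_apply, Module.Dual.transpose_apply, LinearMap.comp_apply, upperUni_inv,
      h.upper, map_sum, LinearMap.sum_apply]
    simp only [map_smul, LinearMap.smul_apply, hb', smul_eq_mul]
    rw [Finset.sum_eq_single (Fin.rev l) (by intro j _ hj; simp [hj]) (by simp),
      Finset.sum_eq_single (Fin.rev i) (by
        intro j _ hj
        have : i ≠ Fin.rev j := fun h => hj (by rw [h, Fin.rev_rev])
        simp [this]) (by simp)]
    simp only [Fin.rev_rev, if_true, hrev]
    by_cases hli : m - (i : ℕ) ≤ l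
    · have e1 : m - (m - (i : ℕ)) = i := by omega
      have e2 : (i : ℕ) - (m - l) = l - (m - i) := by omega
      have e3 : (-1 : K) ^ (l : ℕ) = (-1) ^ ((l : ℕ) - (m - i)) * (-1) ^ (m - (i : ℕ)) := by
        rw [← pow_add]; congr 1; omega
      have e4 : (-1 : K) ^ ((l : ℕ) - (m - i)) * (-1) ^ ((l : ℕ) - (m - i)) = 1 := by
        rw [← mul_pow]; simp
      rw [e1, e2, e3, neg_pow]
      linear_combination ((U i (m - l) : K) * t ^ ((l : ℕ) - (m - i)) * (-1) ^ (m - (i : ℕ))) * e4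
    · rw [hU i (m - l) (by omega) (by omega)]
      have : U (m - (m - i)) (m - l) = 0 := hU _ _ (by omega) (by omega)
      rw [this]
      simp

theorem IsModel.congr {m : ℕ} {ρ : Representation K (SpecialLinearGroup (Fin 2) K) V}
    {b : Module.Basis (Fin (m + 1)) K V} {L U L' U' : ℕ → ℕ → ℕ} (h : IsModel ρ b L U)
    (hL : ∀ i j, i ≤ m → j ≤ m → L i j = L' i j) (hU : ∀ i j, i ≤ m → j ≤ m → U i j = U' i j) :
    IsModel ρ b L' U' where
  torus := h.torus
  lower t i := by
    rw [h.lower]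
    exact Finset.sum_congr rfl fun j _ => by rw [hL i j (by omega) (by omega)]
  upper t i := by
    rw [h.upper]
    exact Finset.sum_congr rfl fun j _ => by rw [hU i j (by omega) (by omega)]

/-- The structure constants of the upper symmetric power of the natural representation. -/
def IsUpperModel {m : ℕ} (ρ : Representation K (SpecialLinearGroup (Fin 2) K) V)
    (b : Module.Basis (Fin (m + 1)) K V) : Prop :=
  IsModel ρ b (fun i j => (m - i).choose (m - j)) (fun i j => i.choose j)

/-- The structure constants of the lower symmetric power of the natural representation. -/
def IsLowerModel {m : ℕ} (ρ : Representation K (SpecialLinearGroup (Fin 2) K) V)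
    (b : Module.Basis (Fin (m + 1)) K V) : Prop :=
  IsModel ρ b (fun i j => j.choose i) (fun i j => (m - j).choose (m - i))

theorem IsUpperModel.dual {m : ℕ} {ρ : Representation K (SpecialLinearGroup (Fin 2) K) V}
    {b : Module.Basis (Fin (m + 1)) K V} (h : IsUpperModel ρ b) :
    ∃ b' : Module.Basis (Fin (m + 1)) K (Module.Dual K V), IsLowerModel ρ.dual b' := by
  obtain ⟨b', hb'⟩ := IsModel.dual h
    (fun i j hi hj => Nat.choose_eq_zero_of_lt (by omega))
    (fun i j hi hj => Nat.choose_eq_zero_of_lt (by omega))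
  refine ⟨b', hb'.congr (fun i j hi hj => ?_) (fun i j hi hj => rfl)⟩
  congr 1 <;> omega

theorem IsLowerModel.dual {m : ℕ} {ρ : Representation K (SpecialLinearGroup (Fin 2) K) V}
    {b : Module.Basis (Fin (m + 1)) K V} (h : IsLowerModel ρ b) :
    ∃ b' : Module.Basis (Fin (m + 1)) K (Module.Dual K V), IsUpperModel ρ.dual b' := by
  obtain ⟨b', hb'⟩ := IsModel.dual h
    (fun i j hi hj => Nat.choose_eq_zero_of_lt (by omega))
    (fun i j hi hj => Nat.choose_eq_zero_of_lt (by omega))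
  refine ⟨b', hb'.congr (fun i j hi hj => rfl) (fun i j hi hj => ?_)⟩
  congr 1 <;> omega

open Polynomial in
theorem coeff_one_add_C_mul_X_pow {R : Type*} [CommRing R] (t : R) (n k : ℕ) :
    ((1 + C t * X) ^ n : R[X]).coeff k = n.choose k * t ^ k := by
  have : ((1 + C t * X) ^ n : R[X]) = ((1 + X) ^ n : R[X]).comp (C t * X) := by simp
  rw [this, comp_C_mul_X_coeff, coeff_one_add_X_pow]

-- This is the action of `lowerUni t` on `Sym^m E`: `X ^ i` stands for the monomial with i factors
-- from the second basis vector, and the first basis vector, written 1, goes to 1 + tX.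
open Polynomial in
theorem X_pow_mul_one_add_pow {R : Type*} [CommRing R] (t : R) {m i : ℕ} (hi : i ≤ m) :
    (X ^ i * (1 + C t * X) ^ (m - i) : R[X]) =
      ∑ j : Fin (m + 1), (((m - i).choose (m - j) : R) * t ^ (j - i : ℕ)) • X ^ (j : ℕ) := by
  ext k
  simp only [finsetSum_coeff, coeff_smul, coeff_X_pow, smul_eq_mul, mul_ite, mul_one, mul_zero]
  rw [Fin.sum_univ_eq_sum_range
    (fun j => if k = j then (((m - i).choose (m - j) : R) * t ^ (j - i : ℕ)) else 0),
    Finset.sum_ite_eq, coeff_X_pow_mul', coeff_one_add_C_mul_X_pow]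
  by_cases hik : i ≤ k
  · by_cases hkm : k ≤ m
    · rw [if_pos hik, if_pos (by simp; omega), ← Nat.choose_symm (by omega : m - k ≤ m - i)]
      congr 3; omega
    · rw [if_pos hik, if_neg (by simp; omega), Nat.choose_eq_zero_of_lt (by omega)]
      simp
  · rw [if_neg hik]
    split_ifs with h
    · rw [Nat.choose_eq_zero_of_lt (by simp at h; omega)]; simp
    · rfl

open Polynomial in
theorem X_add_C_pow_eq_sum {R : Type*} [CommRing R] (t : R) {m i : ℕ} (hi : i ≤ m) :
    ((X + C t) ^ i : R[X]) =
      ∑ j : Fin (m + 1), ((i.choose j : R) * t ^ (i - j : ℕ)) • X ^ (j : ℕ) := by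
  ext k
  simp only [finsetSum_coeff, coeff_smul, coeff_X_pow, smul_eq_mul, mul_ite, mul_one, mul_zero]
  rw [Fin.sum_univ_eq_sum_range
    (fun j => if k = j then ((i.choose j : R) * t ^ (i - j : ℕ)) else 0),
    Finset.sum_ite_eq, coeff_X_add_C_pow]
  split_ifs with h
  · ring
  · rw [Nat.choose_eq_zero_of_lt (by simp at h; omega)]; simp

end Models

/-! ### `Sym^m E` and `Sym_m E` in coordinates -/

section SymmetricPowers

open Matrix (SpecialLinearGroup)
open Polynomial

variable {K : Type u} [Field K]

theorem naturalRep_lowerUni (t : K) (v : Fin 2 → K) :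
    naturalRep K (lowerUni t) v = ![v 0, t * v 0 + v 1] := by
  change Matrix.toLin' !![1, 0; t, 1] v = _
  ext i
  fin_cases i <;> simp [Matrix.toLin'_apply, Matrix.mulVec, dotProduct, Fin.sum_univ_two]

theorem naturalRep_upperUni (t : K) (v : Fin 2 → K) :
    naturalRep K (upperUni t) v = ![v 0 + t * v 1, v 1] := by
  change Matrix.toLin' !![1, t; 0, 1] v = _
  ext i
  fin_cases i <;> simp [Matrix.toLin'_apply, Matrix.mulVec, dotProduct, Fin.sum_univ_two]

theorem naturalRep_torus (s : Kˣ) (v : Fin 2 → K) :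
    naturalRep K (torus s) v = ![s * v 0, ((s⁻¹ : Kˣ) : K) * v 1] := by
  change Matrix.toLin' !![(s : K), 0; 0, ((s⁻¹ : Kˣ) : K)] v = _
  ext i
  fin_cases i <;> simp [Matrix.toLin'_apply, Matrix.mulVec, dotProduct, Fin.sum_univ_two]

/-- The vector `(a, b)` as the linear polynomial `a + b X`. -/
def toLinPoly (K : Type u) [Field K] : (Fin 2 → K) →ₗ[K] K[X] :=
  LinearMap.smulRight (LinearMap.proj 0) 1 + LinearMap.smulRight (LinearMap.proj 1) X

theorem toLinPoly_apply (v : Fin 2 → K) : toLinPoly K v = C (v 0) + C (v 1) * X := by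
  simp [toLinPoly, smul_eq_C_mul]

/-- The indicator of the first `i` places. -/
def firstPlaces (m i : ℕ) : Fin m → Fin 2 := fun k => if (k : ℕ) < i then 1 else 0

/-- The number of places with value `1`. -/
def numOnes {m : ℕ} (f : Fin m → Fin 2) : ℕ := (Finset.univ.filter fun k => f k = 1).card

theorem numOnes_le {m : ℕ} (f : Fin m → Fin 2) : numOnes f ≤ m :=
  (Finset.card_filter_le _ _).trans (by simp)

theorem numOnes_firstPlaces {m i : ℕ} (hi : i ≤ m) : numOnes (firstPlaces m i) = i := by
  have h : ∀ k : Fin m, firstPlaces m i k = 1 ↔ (k : ℕ) < i := by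
    intro k; unfold firstPlaces; split_ifs with h <;> simp [h]
  simp only [numOnes, h]
  simp [Fin.card_filter_val_lt, hi]

theorem numOnes_comp_perm {m : ℕ} (f : Fin m → Fin 2) (σ : Equiv.Perm (Fin m)) :
    numOnes (f ∘ σ) = numOnes f := by
  unfold numOnes
  rw [← Fintype.card_subtype, ← Fintype.card_subtype]
  exact Fintype.card_congr (σ.subtypeEquiv fun _ => Iff.rfl)

theorem card_filter_eq_zero {m : ℕ} (f : Fin m → Fin 2) :
    (Finset.univ.filter fun k => f k = 0).card = m - numOnes f := by
  have := Finset.card_filter_add_card_filter_not (s := (Finset.univ : Finset (Fin m)))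
    (p := fun k => f k = 1)
  have h0 : ∀ k, (¬ f k = 1) ↔ f k = 0 := fun k => by omega
  simp only [h0, Finset.card_univ, Fintype.card_fin] at this
  unfold numOnes
  omega

theorem card_fiber_of_numOnes_eq {m : ℕ} {f f' : Fin m → Fin 2} (h : numOnes f = numOnes f')
    (x : Fin 2) : (Finset.univ.filter fun k => f k = x).card =
      (Finset.univ.filter fun k => f' k = x).card := by
  fin_cases x
  · exact (card_filter_eq_zero f).trans ((congrArg _ h).trans (card_filter_eq_zero f').symm)
  · exact h

theorem prod_numOnes {R : Type*} [CommMonoid R] {m : ℕ} (f : Fin m → Fin 2) (F : Fin 2 → R) :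
    ∏ k, F (f k) = F 1 ^ numOnes f * F 0 ^ (m - numOnes f) := by
  have h : ∀ k, F (f k) = if f k = 1 then F 1 else F 0 := by
    intro k
    split_ifs with h
    · rw [h]
    · rw [show f k = 0 by omega]
  simp only [h]
  rw [Finset.prod_ite, Finset.prod_const, Finset.prod_const, ← card_filter_eq_zero]
  have h0 : ∀ k, (¬ f k = 1) ↔ f k = 0 := fun k => by omega
  simp only [h0]
  rfl

theorem prod_firstPlaces {R : Type*} [CommMonoid R] {m i : ℕ} (hi : i ≤ m) (F : Fin 2 → R) :
    ∏ k, F (firstPlaces m i k) = F 1 ^ i * F 0 ^ (m - i) := by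
  rw [prod_numOnes, numOnes_firstPlaces hi]

/-- The upper symmetric power of the natural representation. -/
theorem exists_isUpperModel_symUpper (K : Type u) [Field K] (m : ℕ) :
    ∃ b : Module.Basis (Fin (m + 1)) K (SymUpper K (Fin m) (Fin 2 → K)),
      IsUpperModel (symUpperRep (Fin m) (naturalRep K)) b := by
  let e := Pi.basisFun K (Fin 2)
  let Φ := symEval (Fin m) (toLinPoly K)
  let x : Fin (m + 1) → SymUpper K (Fin m) (Fin 2 → K) :=
    fun i => symProd (K := K) (e ∘ firstPlaces m i)
  have hx : ∀ f : Fin m → Fin 2, symProd (K := K) (e ∘ f) =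
      x ⟨numOnes f, Nat.lt_succ_of_le (numOnes_le f)⟩ := fun f =>
    symProd_congr e (card_fiber_of_numOnes_eq (numOnes_firstPlaces (numOnes_le f)).symm)
  have hΦg : ∀ (g : SpecialLinearGroup (Fin 2) K) (i : Fin (m + 1)),
      Φ (symUpperRep (Fin m) (naturalRep K) g (x i)) =
        toLinPoly K (naturalRep K g (e 1)) ^ (i : ℕ) *
          toLinPoly K (naturalRep K g (e 0)) ^ (m - i) := by
    intro g i
    simp only [Φ, x]
    rw [symUpperRep_symProd, symEval_symProd]
    exact prod_firstPlaces (Nat.le_of_lt_succ i.2) fun a => toLinPoly K (naturalRep K g (e a))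
  have hΦ : ∀ i, Φ (x i) = X ^ (i : ℕ) := by
    intro i
    have := hΦg 1 i
    rw [map_one, map_one] at this
    simpa [toLinPoly_apply, e] using this
  have hli : LinearIndependent K fun i : Fin (m + 1) => (X ^ (i : ℕ) : K[X]) := by
    have := (Polynomial.basisMonomials K).linearIndependent.comp
      (fun i : Fin (m + 1) => (i : ℕ)) Fin.val_injective
    simpa [Function.comp_def, ← X_pow_eq_monomial] using this
  have hinj : Function.Injective Φ :=
    injective_of_span_of_linearIndependent Φ _ (span_range_symProd (Fin m) e) _ hli
      (fun f => ⟨numOnes f, Nat.lt_succ_of_le (numOnes_le f)⟩)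
      (fun f => by rw [hx, hΦ]) (fun f f' h => by rw [hx, hx, h])
  let b : Module.Basis (Fin (m + 1)) K (SymUpper K (Fin m) (Fin 2 → K)) :=
    Module.Basis.mk (v := x) (LinearIndependent.of_comp Φ (by
      simpa only [Function.comp_def, hΦ] using hli)) (by
      rw [← span_range_symProd (Fin m) e]
      refine Submodule.span_mono ?_
      rintro _ ⟨f, rfl⟩
      exact ⟨_, (hx f).symm⟩)
  have hb : ∀ i, b i = x i := fun i => Module.Basis.mk_apply _ _ i
  refine ⟨b, ?_, ?_, ?_⟩
  · intro s i
    refine hinj ?_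
    rw [hb, hΦg, map_smul, hΦ, naturalRep_torus, naturalRep_torus, toLinPoly_apply,
      toLinPoly_apply, smul_eq_C_mul]
    have : ((s ^ ((m : ℤ) - 2 * i) : Kˣ) : K) = ((s⁻¹ : Kˣ) : K) ^ (i : ℕ) * (s : K) ^ (m - i : ℕ) := by
      rw [← Units.val_pow_eq_pow_val, ← Units.val_pow_eq_pow_val, ← Units.val_mul]
      congr 1
      rw [← zpow_natCast, ← zpow_natCast, inv_zpow', ← zpow_add, Nat.cast_sub (by omega)]
      congr 1; ring
    rw [this]
    simp only [e, C_mul, C_pow]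
    simp
    ring
  · intro t i
    refine hinj ?_
    rw [hb, hΦg, map_sum, naturalRep_lowerUni, naturalRep_lowerUni, toLinPoly_apply,
      toLinPoly_apply]
    simp only [map_smul, hb, hΦ]
    rw [← X_pow_mul_one_add_pow t (Nat.le_of_lt_succ i.2)]
    simp [e]
  · intro t i
    refine hinj ?_
    rw [hb, hΦg, map_sum, naturalRep_upperUni, naturalRep_upperUni, toLinPoly_apply,
      toLinPoly_apply]
    simp only [map_smul, hb, hΦ]
    rw [← X_add_C_pow_eq_sum t (Nat.le_of_lt_succ i.2)]
    simp [e, add_comm]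

/-- Expand the product over the places, marking each value 1 of `f'` by a factor X. This gives the
coordinates of a group element acting on symmetric tensors. -/
theorem sum_prod_eq_coeff {m : ℕ} (a : Fin 2 → Fin 2 → K) (i : ℕ) (f : Fin m → Fin 2) :
    ∑ f' : Fin m → Fin 2, (∏ k, a (f k) (f' k)) * (if numOnes f' = i then 1 else 0) =
      ((C (a 1 0) + C (a 1 1) * X) ^ numOnes f *
        (C (a 0 0) + C (a 0 1) * X) ^ (m - numOnes f)).coeff i := by
  rw [← prod_numOnes f fun x => C (a x 0) + C (a x 1) * X]
  have h : ∀ k, C (a (f k) 0) + C (a (f k) 1) * X =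
      ∑ x : Fin 2, C (a (f k) x) * (X : K[X]) ^ (x : ℕ) := by
    intro k; simp [Fin.sum_univ_two]
  simp only [h]
  rw [Fintype.prod_sum, finsetSum_coeff]
  refine Finset.sum_congr rfl fun f' _ => ?_
  rw [Finset.prod_mul_distrib, ← map_prod,
    prod_numOnes f' fun x : Fin 2 => (X : K[X]) ^ (x : ℕ), coeff_C_mul]
  simp [coeff_X_pow, eq_comm]

/-- The coordinates of a tensor in the standard basis of the tensor power of `K²`. -/
def stdCoord (K : Type u) [Field K] (m : ℕ) :
    Module.Basis (Fin m → Fin 2) K (⨂[K] _ : Fin m, Fin 2 → K) :=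
  Basis.piTensorProduct fun _ => Pi.basisFun K (Fin 2)

theorem stdCoord_placePerm {m : ℕ} (σ : Equiv.Perm (Fin m)) (w : ⨂[K] _ : Fin m, Fin 2 → K)
    (f : Fin m → Fin 2) :
    (stdCoord K m).repr (placePerm K _ σ w) f = (stdCoord K m).repr w (f ∘ σ) := by
  have h : (stdCoord K m).coord f ∘ₗ placePerm K _ σ = (stdCoord K m).coord (f ∘ σ) := by
    refine PiTensorProduct.ext (MultilinearMap.ext fun v => ?_)
    simp only [LinearMap.compMultilinearMap_apply, LinearMap.comp_apply, placePerm_tprod,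
      Module.Basis.coord_apply, stdCoord, Basis.piTensorProduct_repr_tprod_apply]
    rw [← Equiv.prod_comp σ]
    simp
  exact LinearMap.congr_fun h w

theorem stdCoord_tensorPowerRep {m : ℕ} (g : SpecialLinearGroup (Fin 2) K)
    (w : ⨂[K] _ : Fin m, Fin 2 → K) (f : Fin m → Fin 2) :
    (stdCoord K m).repr (tensorPowerRep (Fin m) (naturalRep K) g w) f =
      ∑ f' : Fin m → Fin 2, (∏ k, naturalRep K g (Pi.single (f' k) 1) (f k)) *
        (stdCoord K m).repr w f' := by
  have h : (stdCoord K m).coord f ∘ₗ tensorPowerRep (Fin m) (naturalRep K) g =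
      ∑ f' : Fin m → Fin 2, (∏ k, naturalRep K g (Pi.single (f' k) 1) (f k)) •
        (stdCoord K m).coord f' := by
    refine (stdCoord K m).ext fun f0 => ?_
    rw [LinearMap.sum_apply, LinearMap.comp_apply]
    simp only [LinearMap.smul_apply, Module.Basis.coord_apply, Module.Basis.repr_self,
      Finsupp.single_apply, smul_eq_mul, mul_ite, mul_one, mul_zero, Finset.sum_ite_eq,
      Finset.mem_univ, if_true]
    rw [stdCoord, Basis.piTensorProduct_apply]
    refine (congrArg (fun z => (stdCoord K m).repr z f) (PiTensorProduct.map_tprod _ _)).trans ?_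
    rw [stdCoord, Basis.piTensorProduct_repr_tprod_apply]
    simp
  refine (LinearMap.congr_fun h w).trans ?_
  simp only [LinearMap.sum_apply, LinearMap.smul_apply, smul_eq_mul, Module.Basis.coord_apply]

theorem stdCoord_symLower {m : ℕ} (w : SymLower K (Fin m) (Fin 2 → K)) {f f' : Fin m → Fin 2}
    (h : numOnes f = numOnes f') :
    (stdCoord K m).repr (w : ⨂[K] _ : Fin m, Fin 2 → K) f = (stdCoord K m).repr w f' := by
  obtain ⟨σ, hσ⟩ := exists_perm_of_card_fiber_eq (card_fiber_of_numOnes_eq h)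
  rw [← show f' ∘ σ = f from funext hσ, ← stdCoord_placePerm, w.2 σ]

theorem symLowerRep_coe {G : Type v} [Group G] {V : Type u} [AddCommGroup V] [Module K V]
    (ι : Type) (ρ : Representation K G V) (g : G) (w : SymLower K ι V) :
    ((symLowerRep ι ρ g w : SymLower K ι V) : ⨂[K] _ : ι, V) = tensorPowerRep ι ρ g w :=
  rfl

/-- The lower symmetric power of the natural representation. -/
theorem exists_isLowerModel_symLower (K : Type u) [Field K] (m : ℕ) :
    ∃ b : Module.Basis (Fin (m + 1)) K (SymLower K (Fin m) (Fin 2 → K)),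
      IsLowerModel (symLowerRep (Fin m) (naturalRep K)) b := by
  -- A symmetric tensor is determined by one coordinate for each number of ones, and these m + 1
  -- coordinates are arbitrary.
  let Θ : SymLower K (Fin m) (Fin 2 → K) →ₗ[K] (Fin (m + 1) → K) :=
    LinearMap.pi fun i => (stdCoord K m).coord (firstPlaces m i) ∘ₗ Submodule.subtype _
  have hΘ : ∀ w f, Θ w ⟨numOnes f, Nat.lt_succ_of_le (numOnes_le f)⟩ =
      (stdCoord K m).repr (w : ⨂[K] _ : Fin m, Fin 2 → K) f := fun w f =>
    stdCoord_symLower w (numOnes_firstPlaces (numOnes_le f))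
  have hΘ' : ∀ w (j : Fin (m + 1)), Θ w j =
      (stdCoord K m).repr (w : ⨂[K] _ : Fin m, Fin 2 → K) (firstPlaces m j) := fun w j => rfl
  have hinj : Function.Injective Θ := by
    intro w w' h
    refine Subtype.ext ((stdCoord K m).ext_elem fun f => ?_)
    rw [← hΘ, ← hΘ, h]
  have hsurj : Function.Surjective Θ := by
    intro a
    let w : ⨂[K] _ : Fin m, Fin 2 → K := (stdCoord K m).equivFun.symm
      fun f => a ⟨numOnes f, Nat.lt_succ_of_le (numOnes_le f)⟩
    have hw : ∀ f, (stdCoord K m).repr w f = a ⟨numOnes f, Nat.lt_succ_of_le (numOnes_le f)⟩ := by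
      intro f
      rw [← Module.Basis.equivFun_apply, LinearEquiv.apply_symm_apply]
    have hws : w ∈ SymLower K (Fin m) (Fin 2 → K) := by
      intro σ
      refine (stdCoord K m).ext_elem fun f => ?_
      rw [stdCoord_placePerm, hw, hw]
      congr 1
      exact Fin.ext (numOnes_comp_perm f σ)
    refine ⟨⟨w, hws⟩, funext fun i => (hw _).trans (congrArg a (Fin.ext ?_))⟩
    exact numOnes_firstPlaces (Nat.le_of_lt_succ i.2)
  let b : Module.Basis (Fin (m + 1)) K (SymLower K (Fin m) (Fin 2 → K)) :=
    Module.Basis.ofEquivFun (LinearEquiv.ofBijective Θ ⟨hinj, hsurj⟩)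
  have hb : ∀ i, Θ (b i) = Pi.single i 1 := by
    intro i
    have : (LinearEquiv.ofBijective Θ ⟨hinj, hsurj⟩) (b i) = Pi.single i 1 := by
      simp [b, Module.Basis.coe_ofEquivFun]
    exact this
  have hact : ∀ (g : SpecialLinearGroup (Fin 2) K) (i j : Fin (m + 1)),
      Θ (symLowerRep (Fin m) (naturalRep K) g (b i)) j =
        ((C (naturalRep K g (Pi.single 0 1) 1) + C (naturalRep K g (Pi.single 1 1) 1) * X) ^ (j : ℕ) *
        (C (naturalRep K g (Pi.single 0 1) 0) +
          C (naturalRep K g (Pi.single 1 1) 0) * X) ^ (m - j : ℕ)).coeff i := by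
    intro g i j
    rw [hΘ', symLowerRep_coe, stdCoord_tensorPowerRep]
    have := sum_prod_eq_coeff (fun x y => naturalRep K g (Pi.single y 1) x) i (firstPlaces m j)
    rw [numOnes_firstPlaces (Nat.le_of_lt_succ j.2)] at this
    rw [← this]
    refine Finset.sum_congr rfl fun f' _ => ?_
    rw [← hΘ, hb, Pi.single_apply]
    simp [Fin.ext_iff]
  have hsum : ∀ (c : Fin (m + 1) → K) (l : Fin (m + 1)), Θ (∑ j, c j • b j) l = c l := by
    intro c l
    simp only [map_sum, map_smul, hb, Finset.sum_apply, Pi.smul_apply, Pi.single_apply]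
    simp
  refine ⟨b, ?_, ?_, ?_⟩
  · intro s i
    refine hinj (funext fun j => ?_)
    rw [hact, map_smul, hb]
    simp only [naturalRep_torus]
    have hs : ((s ^ ((m : ℤ) - 2 * i) : Kˣ) : K) =
        ((s⁻¹ : Kˣ) : K) ^ (i : ℕ) * (s : K) ^ (m - i : ℕ) := by
      rw [← Units.val_pow_eq_pow_val, ← Units.val_pow_eq_pow_val, ← Units.val_mul]
      congr 1
      rw [← zpow_natCast, ← zpow_natCast, inv_zpow', ← zpow_add, Nat.cast_sub (by omega)]
      congr 1; ring
    rw [hs]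
    simp only [Pi.single_eq_same, ne_eq, one_ne_zero, not_false_eq_true, Pi.single_eq_of_ne,
      zero_ne_one, Matrix.cons_val_zero, Matrix.cons_val_one, mul_one, mul_zero, map_zero,
      zero_add, zero_mul, add_zero, Pi.smul_apply, smul_eq_mul, Pi.single_apply]
    rw [mul_pow, ← C_pow, ← C_pow, mul_assoc, coeff_C_mul, coeff_mul_C, coeff_X_pow]
    by_cases hij : j = i
    · subst hij; simp
    · rw [if_neg hij, if_neg (fun h => hij (Fin.ext h.symm))]; simp
  · intro t i
    refine hinj (funext fun j => ?_)
    rw [hact, hsum]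
    simp only [naturalRep_lowerUni]
    simp only [Pi.single_eq_same, ne_eq, one_ne_zero, not_false_eq_true, Pi.single_eq_of_ne,
      zero_ne_one, Matrix.cons_val_zero, Matrix.cons_val_one, mul_one, mul_zero, map_zero, map_one,
      zero_add, zero_mul, add_zero, one_pow, one_mul]
    rw [add_comm, coeff_X_add_C_pow, mul_comm]
  · intro t i
    refine hinj (funext fun j => ?_)
    rw [hact, hsum]
    simp only [naturalRep_upperUni]
    simp only [Pi.single_eq_same, ne_eq, one_ne_zero, not_false_eq_true, Pi.single_eq_of_ne,
      zero_ne_one, Matrix.cons_val_zero, Matrix.cons_val_one, mul_one, mul_zero, map_zero, map_one,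
      zero_add, add_zero, one_mul]
    rw [X_pow_mul_one_add_pow t (Nat.le_of_lt_succ j.2)]
    simp only [finsetSum_coeff, coeff_smul, coeff_X_pow, smul_eq_mul, mul_ite, mul_one, mul_zero]
    rw [Fin.sum_univ_eq_sum_range
      (fun l => if (i : ℕ) = l then (((m - j).choose (m - l) : K) * t ^ (l - j : ℕ)) else 0),
      Finset.sum_ite_eq, if_pos (by simp; omega)]

end SymmetricPowers

/-! ### Interpolated operators and invariants of the highest weight -/

section Operators

open Matrix (SpecialLinearGroup)
open Polynomial

variable {K : Type u} [Field K]

open scoped Classical in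
/-- The weight at the node `s` in the functional that extracts the coefficient of degree `d` from the
values at the nodes `S`. -/
def extract (S : Finset Kˣ) (d : ℕ) (s : Kˣ) : K :=
  (Lagrange.basis S (fun s : Kˣ => (s : K)) s).coeff d

-- Lagrange interpolation at `S` reproduces `X ^ i` as long as i is below the number of nodes;
-- compare coefficients of degree d.
open scoped Classical in
theorem sum_extract_mul_pow (S : Finset Kˣ) (d : ℕ) {i : ℕ} (hi : i < S.card) :
    ∑ s ∈ S, extract S d s * (s : K) ^ i = if i = d then 1 else 0 := by
  have h := Lagrange.eq_interpolate (s := S) (v := fun s : Kˣ => (s : K)) (f := X ^ i)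
    (fun _ _ _ _ h => Units.ext h) (by rw [degree_X_pow]; exact_mod_cast hi)
  have := congrArg (fun P => coeff P d) h
  simp only [Lagrange.interpolate_apply, finsetSum_coeff, coeff_C_mul, coeff_X_pow, eval_pow,
    eval_X] at this
  rw [eq_comm, ← if_congr (eq_comm (a := d) (b := i)) rfl rfl, this]
  exact Finset.sum_congr rfl fun s _ => mul_comm _ _

/-- A coefficient of a polynomial of degree below |S| is a fixed combination of its values at `S`.
This is what turns single powers of t into operators built from finitely many group elements. -/
theorem sum_extract_smul_eval {A : Type w} [CommRing A] [Algebra K A] (S : Finset Kˣ) (d : ℕ)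
    {P : A[X]} (hP : P.natDegree < S.card) :
    ∑ s ∈ S, extract S d s • P.eval (algebraMap K A s) = P.coeff d := by
  have h : ∀ s : Kˣ, P.eval (algebraMap K A s) =
      ∑ i ∈ Finset.range S.card, ((s : K) ^ i) • P.coeff i := by
    intro s
    rw [eval_eq_sum_range' hP]
    exact Finset.sum_congr rfl fun i _ => by rw [Algebra.smul_def, map_pow, mul_comm]
  simp only [h, Finset.smul_sum, smul_smul]
  rw [Finset.sum_comm]
  simp only [← Finset.sum_smul]
  rw [Finset.sum_congr rfl fun i hi => by rw [sum_extract_mul_pow S d (Finset.mem_range.1 hi)]]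
  simp only [ite_smul, one_smul, zero_smul, Finset.sum_ite_eq', Finset.mem_range]
  split_ifs with hd
  · rfl
  · exact (coeff_eq_zero_of_natDegree_lt (by omega)).symm

variable {V : Type*} [AddCommGroup V] [Module K V] {V' : Type*} [AddCommGroup V'] [Module K V']

/-- The coefficient of `t ^ d` in the action of the lower unitriangular matrices. -/
def unipOp (S : Finset Kˣ) (d : ℕ) (ρ : Representation K (SpecialLinearGroup (Fin 2) K) V) :
    V →ₗ[K] V :=
  ∑ t ∈ S, extract S d t • ρ (lowerUni (t : K))

/-- The projection to the weight space of weight `w - 2 * j`. -/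
def weightOp (S : Finset Kˣ) (w j : ℕ) (ρ : Representation K (SpecialLinearGroup (Fin 2) K) V) :
    V →ₗ[K] V :=
  ∑ s ∈ S, (extract S (2 * j) s * (s : K) ^ w) • ρ (torus s⁻¹)

theorem unipOp_apply (S : Finset Kˣ) (d : ℕ)
    (ρ : Representation K (SpecialLinearGroup (Fin 2) K) V) (x : V) :
    unipOp S d ρ x = ∑ t ∈ S, extract S d t • ρ (lowerUni (t : K)) x := by
  simp [unipOp, LinearMap.sum_apply]

theorem weightOp_apply (S : Finset Kˣ) (w j : ℕ)
    (ρ : Representation K (SpecialLinearGroup (Fin 2) K) V) (x : V) :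
    weightOp S w j ρ x = ∑ s ∈ S, (extract S (2 * j) s * (s : K) ^ w) • ρ (torus s⁻¹) x := by
  simp [weightOp, LinearMap.sum_apply]

/-- Some vector of weight `w` is not killed by the operator of degree `d`. -/
def MovesHighest (S : Finset Kˣ) (w d : ℕ)
    (ρ : Representation K (SpecialLinearGroup (Fin 2) K) V) : Prop :=
  ∃ x, unipOp S d ρ (weightOp S w 0 ρ x) ≠ 0

/-- Isomorphism of representations. -/
def IsoRep (ρ : Representation K (SpecialLinearGroup (Fin 2) K) V)
    (ρ' : Representation K (SpecialLinearGroup (Fin 2) K) V') : Prop :=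
  ∃ φ : V ≃ₗ[K] V', ∀ g x, φ (ρ g x) = ρ' g (φ x)

theorem map_unipOp {ρ : Representation K (SpecialLinearGroup (Fin 2) K) V}
    {ρ' : Representation K (SpecialLinearGroup (Fin 2) K) V'} {φ : V ≃ₗ[K] V'}
    (hφ : ∀ g x, φ (ρ g x) = ρ' g (φ x))
    (S : Finset Kˣ) (d : ℕ) (x : V) : φ (unipOp S d ρ x) = unipOp S d ρ' (φ x) := by
  simp only [unipOp_apply, map_sum, map_smul, hφ]

theorem map_weightOp {ρ : Representation K (SpecialLinearGroup (Fin 2) K) V}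
    {ρ' : Representation K (SpecialLinearGroup (Fin 2) K) V'} {φ : V ≃ₗ[K] V'}
    (hφ : ∀ g x, φ (ρ g x) = ρ' g (φ x))
    (S : Finset Kˣ) (w j : ℕ) (x : V) : φ (weightOp S w j ρ x) = weightOp S w j ρ' (φ x) := by
  simp only [weightOp_apply, map_sum, map_smul, hφ]

theorem IsoRep.symm {ρ : Representation K (SpecialLinearGroup (Fin 2) K) V}
    {ρ' : Representation K (SpecialLinearGroup (Fin 2) K) V'} (h : IsoRep ρ ρ') :
    IsoRep ρ' ρ := by
  obtain ⟨φ, hφ⟩ := h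
  exact ⟨φ.symm, fun g x => by rw [LinearEquiv.symm_apply_eq, hφ, LinearEquiv.apply_symm_apply]⟩

theorem IsoRep.trans {V'' : Type*} [AddCommGroup V''] [Module K V'']
    {ρ : Representation K (SpecialLinearGroup (Fin 2) K) V}
    {ρ' : Representation K (SpecialLinearGroup (Fin 2) K) V'}
    {ρ'' : Representation K (SpecialLinearGroup (Fin 2) K) V''} (h : IsoRep ρ ρ')
    (h' : IsoRep ρ' ρ'') : IsoRep ρ ρ'' := by
  obtain ⟨φ, hφ⟩ := h
  obtain ⟨ψ, hψ⟩ := h'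
  exact ⟨φ.trans ψ, fun g x => by simp [hφ, hψ]⟩

theorem IsoRep.dual {ρ : Representation K (SpecialLinearGroup (Fin 2) K) V}
    {ρ' : Representation K (SpecialLinearGroup (Fin 2) K) V'} (h : IsoRep ρ ρ') :
    IsoRep ρ.dual ρ'.dual := by
  obtain ⟨φ, hφ⟩ := h.symm
  refine ⟨φ.dualMap, fun g ξ => LinearMap.ext fun x => ?_⟩
  simp [Representation.dual_apply, Module.Dual.transpose_apply, hφ]

/-- A finite dimensional representation is isomorphic to its double dual. -/
theorem isoRep_dual_dual [FiniteDimensional K V]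
    (ρ : Representation K (SpecialLinearGroup (Fin 2) K) V) : IsoRep ρ ρ.dual.dual := by
  refine ⟨Module.evalEquiv K V, fun g x => LinearMap.ext fun ξ => ?_⟩
  simp [Representation.dual_apply, Module.Dual.transpose_apply]

theorem IsoRep.movesHighest_iff {ρ : Representation K (SpecialLinearGroup (Fin 2) K) V}
    {ρ' : Representation K (SpecialLinearGroup (Fin 2) K) V'} (h : IsoRep ρ ρ')
    (S : Finset Kˣ) (w d : ℕ) : MovesHighest S w d ρ ↔ MovesHighest S w d ρ' := by
  obtain ⟨φ, hφ⟩ := h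
  constructor
  · rintro ⟨x, hx⟩
    refine ⟨φ x, ?_⟩
    rwa [← map_weightOp hφ, ← map_unipOp hφ, Ne, LinearEquiv.map_eq_zero_iff]
  · rintro ⟨x, hx⟩
    refine ⟨φ.symm x, fun h0 => hx ?_⟩
    rw [← φ.apply_symm_apply x, ← map_weightOp hφ, ← map_unipOp hφ, h0, map_zero]

/-- `v` spans the space of highest weight vectors, and `ℓ` is the dual functional. -/
structure IsHighest (S : Finset Kˣ) (w : ℕ)
    (ρ : Representation K (SpecialLinearGroup (Fin 2) K) V) (v : V) (ℓ : V →ₗ[K] K) : Prop where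
  apply_self : ℓ v = 1
  weightOp_eq : ∀ x, weightOp S w 0 ρ x = ℓ x • v

theorem IsHighest.movesHighest_iff {S : Finset Kˣ} {w : ℕ}
    {ρ : Representation K (SpecialLinearGroup (Fin 2) K) V} {v : V} {ℓ : V →ₗ[K] K}
    (h : IsHighest S w ρ v ℓ) (d : ℕ) : MovesHighest S w d ρ ↔ unipOp S d ρ v ≠ 0 := by
  constructor
  · rintro ⟨x, hx⟩ h0
    exact hx (by rw [h.weightOp_eq, map_smul, h0, smul_zero])
  · intro h0
    exact ⟨v, by rwa [h.weightOp_eq, h.apply_self, one_smul]⟩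

/-- The matrix that swaps the two coordinates up to a sign. -/
def weyl (K : Type u) [Field K] : SpecialLinearGroup (Fin 2) K := ⟨!![0, 1; -1, 0], by simp⟩

theorem torus_weyl (s : Kˣ) : torus s * weyl K = weyl K * torus s⁻¹ := by
  refine Subtype.ext ?_
  change !![(s : K), 0; 0, ((s⁻¹ : Kˣ) : K)] * !![0, 1; -1, 0] =
    !![0, 1; -1, 0] * !![((s⁻¹ : Kˣ) : K), 0; 0, (((s⁻¹)⁻¹ : Kˣ) : K)]
  simp

theorem lowerUni_weyl (t : K) : lowerUni (-t) * weyl K = weyl K * upperUni t := by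
  refine Subtype.ext ?_
  change !![1, 0; -t, 1] * !![0, 1; -1, 0] = !![0, 1; -1, 0] * !![1, t; 0, 1]
  simp

/-- `weyl K` inverts the torus and carries `upperUni t` to `lowerUni (-t)`, the inverse that occurs
in the dual action. Precomposed with `weyl K`, a functional projected to weight w is therefore a
multiple of `ℓ`, and the test moves to upper unitriangular matrices on the original module. -/
theorem IsHighest.movesHighest_dual_iff {S : Finset Kˣ} {w : ℕ}
    {ρ : Representation K (SpecialLinearGroup (Fin 2) K) V} {v : V} {ℓ : V →ₗ[K] K}
    (h : IsHighest S w ρ v ℓ) (d : ℕ) : MovesHighest S w d ρ.dual ↔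
      ∃ x, ∑ t ∈ S, extract S d t * ℓ (ρ (upperUni (t : K)) x) ≠ 0 := by
  have key : ∀ (ξ : Module.Dual K V) (x : V),
      unipOp S d ρ.dual (weightOp S w 0 ρ.dual ξ) (ρ (weyl K) x) =
        (∑ t ∈ S, extract S d t * ℓ (ρ (upperUni (t : K)) x)) * ξ (ρ (weyl K) v) := by
    intro ξ x
    have h1 : ∀ y, weightOp S w 0 ρ.dual ξ (ρ (weyl K) y) = ℓ y * ξ (ρ (weyl K) v) := by
      intro y
      have h2 := congrArg (fun z => ξ (ρ (weyl K) z)) (h.weightOp_eq y)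
      simp only [weightOp_apply, map_sum, map_smul, smul_eq_mul] at h2
      rw [weightOp_apply, LinearMap.sum_apply, ← h2]
      refine Finset.sum_congr rfl fun s _ => ?_
      rw [LinearMap.smul_apply, smul_eq_mul]
      congr 1
      rw [Representation.dual_apply, Module.Dual.transpose_apply, LinearMap.comp_apply,
        torus_inv, inv_inv, ← Module.End.mul_apply, ← map_mul, torus_weyl, map_mul,
        Module.End.mul_apply]
    rw [unipOp_apply, LinearMap.sum_apply, Finset.sum_mul]
    refine Finset.sum_congr rfl fun t _ => ?_
    rw [LinearMap.smul_apply, smul_eq_mul, mul_assoc, ← h1]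
    congr 1
    rw [Representation.dual_apply, Module.Dual.transpose_apply, LinearMap.comp_apply,
      lowerUni_inv, ← Module.End.mul_apply, ← map_mul, lowerUni_weyl, map_mul, Module.End.mul_apply]
  have hw : ∀ g (x : V), ρ g (ρ g⁻¹ x) = x := by
    intro g x
    rw [← Module.End.mul_apply, ← map_mul, mul_inv_cancel, map_one, Module.End.one_apply]
  constructor
  · rintro ⟨ξ, hξ⟩
    by_contra hcon
    push Not at hcon
    refine hξ (LinearMap.ext fun y => ?_)
    rw [← hw (weyl K) y, key, hcon, zero_mul, LinearMap.zero_apply]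
  · rintro ⟨x, hx⟩
    -- This functional takes the value 1 on the image of `v` under `weyl K`, so the second factor in
    -- `key` drops out.
    refine ⟨ℓ ∘ₗ ρ (weyl K)⁻¹, fun h0 => hx ?_⟩
    have := LinearMap.congr_fun h0 (ρ (weyl K) x)
    rw [key] at this
    have h3 : ρ (weyl K)⁻¹ (ρ (weyl K) v) = v := by
      simp
    simpa [h3, h.apply_self] using this

end Operators

/-! ### Hook tableaux moved along polynomial curves in `SL₂(K)` -/

section HookCalculus

open Matrix (SpecialLinearGroup)
open Polynomial

variable {K : Type u} [Field K] {V : Type u} [AddCommGroup V] [Module K V]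
  {A : Type w} [CommRing A] [Algebra K A] {m : ℕ} (b : Module.Basis (Fin (m + 1)) K V)

theorem hookElt_ext {M N : ℕ} (b : Module.Basis (Fin (m + 1)) K V) {w w' : Schur K (hook M N) V}
    (h : hookEval M N (genericRow b) w = hookEval M N (genericRow b) w') : w = w' :=
  hookEval_generic_injective M N b h

theorem hookElt_smul (b : Module.Basis (Fin (m + 1)) K V) (M N : ℕ)
    (α β : ℕ → K) (x y : ℕ → V) :
    hookElt K M N (fun k => α k • x k) (fun j => β j • y j) =
      ((∏ k ∈ Finset.range (N + 1), α k) * ∏ j ∈ Finset.range M, β j) • hookElt K M N x y := by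
  refine hookElt_ext b ?_
  rw [map_smul, hookEval_hookElt, hookEval_hookElt]
  have h : (Matrix.of fun i k : Fin (N + 1) => genericRow b i (α k • x k)) =
      Matrix.of fun i k : Fin (N + 1) => algebraMap K (MvPolynomial (ℕ × Fin (m + 1)) K) (α k) *
        (Matrix.of fun i k : Fin (N + 1) => genericRow b i (x k)) i k := by
    ext1 i k
    simp only [Matrix.of_apply, map_smul, Algebra.smul_def]
  rw [h, Matrix.det_mul_row, Fin.prod_univ_eq_prod_range
    (fun k => algebraMap K (MvPolynomial (ℕ × Fin (m + 1)) K) (α k))]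
  simp only [map_smul, Algebra.smul_def, Finset.prod_mul_distrib, map_mul, map_prod]
  ring

theorem hookElt_congr {M N : ℕ} {x x' y y' : ℕ → V} (hx : ∀ k ≤ N, x k = x' k)
    (hy : ∀ j < M, y j = y' j) : hookElt K M N x y = hookElt K M N x' y' := by
  refine Subtype.ext ?_
  change polytabloid K _ = polytabloid K _
  congr 1
  funext c
  obtain ⟨⟨i, j⟩, hc⟩ := c
  have h := mem_hook.1 hc
  unfold hookTableau
  split_ifs with hj
  · exact hx _ (by simp only at hj ⊢; omega)
  · exact hy _ (by simp only at hj ⊢; omega)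

theorem hookElt_eq_zero (b : Module.Basis (Fin (m + 1)) K V) {M N : ℕ} {x y : ℕ → V} {k k' : ℕ} (hk : k ≤ N) (hk' : k' ≤ N)
    (hne : k ≠ k') (h : x k = x k') : hookElt K M N x y = 0 := by
  refine hookElt_ext b ?_
  rw [hookEval_hookElt, map_zero]
  rw [Matrix.det_zero_of_column_eq (i := ⟨k, Nat.lt_succ_of_le hk⟩) (j := ⟨k', Nat.lt_succ_of_le hk'⟩)
    (by simpa using hne) (fun i => by simp [h]), zero_mul]

theorem hookElt_perm (b : Module.Basis (Fin (m + 1)) K V) {M N : ℕ} {x x' y : ℕ → V} (τ : Equiv.Perm (Fin (N + 1)))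
    (hx : ∀ k : Fin (N + 1), x' k = x (τ k)) :
    hookElt K M N x' y = ((Equiv.Perm.sign τ : ℤ) : K) • hookElt K M N x y := by
  refine hookElt_ext b ?_
  rw [map_smul, hookEval_hookElt, hookEval_hookElt]
  have h : (Matrix.of fun i k : Fin (N + 1) => genericRow b i (x' k)) =
      (Matrix.of fun i k : Fin (N + 1) => genericRow b i (x k)).submatrix id τ := by
    ext1 i k
    simp [hx]
  rw [h, Matrix.det_permute', Algebra.smul_def, map_intCast, mul_assoc]

/-- The spanning element attached to a tableau of hook shape with entries in `ℕ`. -/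
def tab (M N : ℕ) (c r : ℕ → ℕ) : Schur K (hook M N) V :=
  hookElt K M N (fun k => b (Fin.ofNat (m + 1) (c k))) (fun j => b (Fin.ofNat (m + 1) (r j)))

theorem span_tab (M N : ℕ) :
    Submodule.span K {w | ∃ c r : ℕ → ℕ, (∀ k, c k ≤ m) ∧ (∀ j, r j ≤ m) ∧ w = tab b M N c r} = ⊤ := by
  refine eq_top_iff.2 ((span_hookElt M N b).ge.trans (Submodule.span_mono ?_))
  rintro _ ⟨c, r, rfl⟩
  refine ⟨fun k => c k, fun j => r j, fun k => Nat.le_of_lt_succ (c k).2,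
    fun j => Nat.le_of_lt_succ (r j).2, ?_⟩
  simp [tab, Function.comp_def]

/-- The linear map with prescribed values on the basis. -/
def lin (a : ℕ → A) : V →ₗ[K] A := b.constr K fun i => a i

theorem lin_basis (a : ℕ → A) (i : Fin (m + 1)) : lin b a (b i) = a i :=
  b.constr_basis K _ i

theorem lin_ofNat (a : ℕ → A) {i : ℕ} (hi : i ≤ m) : lin b a (b (Fin.ofNat (m + 1) i)) = a i := by
  rw [lin_basis, Fin.val_ofNat, Nat.mod_eq_of_lt (Nat.lt_succ_of_le hi)]

theorem hookEval_tab {M N : ℕ} (a : ℕ → ℕ → A) {c r : ℕ → ℕ} (hc : ∀ k ≤ N, c k ≤ m)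
    (hr : ∀ j < M, r j ≤ m) : hookEval M N (fun i => lin b (a i)) (tab b M N c r) =
      (Matrix.of fun i k : Fin (N + 1) => a i (c k)).det * ∏ j ∈ Finset.range M, a 0 (r j) := by
  rw [tab, hookEval_hookElt]
  congr 1
  · congr 1
    ext i k
    exact lin_ofNat b _ (hc k (by omega))
  · exact Finset.prod_congr rfl fun j hj => lin_ofNat b _ (hr j (Finset.mem_range.1 hj))

/-- A curve in `SL₂(K)` that acts polynomially on the basis `b`, with coefficients `Q`. -/
structure IsCurve (ρ : Representation K (SpecialLinearGroup (Fin 2) K) V)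
    (g : K → SpecialLinearGroup (Fin 2) K) (Q : ℕ → ℕ → K[X]) : Prop where
  apply : ∀ (t : K) (i : Fin (m + 1)), ρ (g t) (b i) = ∑ j : Fin (m + 1), ((Q i j).eval t) • b j
  natDegree_le : ∀ i j, i ≤ m → j ≤ m → (Q i j).natDegree ≤ m

/-- The value of the linear map `a` on the image of a basis vector under a curve. -/
def rowPoly (m : ℕ) (Q : ℕ → ℕ → K[X]) (a : ℕ → A) (i : ℕ) : A[X] :=
  ∑ j ∈ Finset.range (m + 1), C (a j) * (Q i j).map (algebraMap K A)

/-- The value of a hook evaluation on the image of a tableau under a curve. -/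
def tabPoly (m M N : ℕ) (Q : ℕ → ℕ → K[X]) (a : ℕ → ℕ → A) (c r : ℕ → ℕ) : A[X] :=
  (Matrix.of fun i k : Fin (N + 1) => rowPoly m Q (a i) (c k)).det *
    ∏ j ∈ Finset.range M, rowPoly m Q (a 0) (r j)

theorem natDegree_det_le {R : Type*} [CommRing R] {n e : ℕ} (B : Matrix (Fin n) (Fin n) R[X])
    (h : ∀ i j, (B i j).natDegree ≤ e) : B.det.natDegree ≤ n * e := by
  rw [Matrix.det_apply]
  refine natDegree_sum_le_of_forall_le _ _ fun σ _ => ?_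
  refine (natDegree_smul_le _ _).trans ((natDegree_prod_le _ _).trans ?_)
  refine (Finset.sum_le_sum fun i _ => h (σ i) i).trans ?_
  simp

variable {b} {ρ : Representation K (SpecialLinearGroup (Fin 2) K) V}
  {g : K → SpecialLinearGroup (Fin 2) K} {Q : ℕ → ℕ → K[X]}

theorem natDegree_rowPoly_le (hQ : IsCurve b ρ g Q) (a : ℕ → A) {i : ℕ} (hi : i ≤ m) :
    (rowPoly m Q a i).natDegree ≤ m := by
  refine natDegree_sum_le_of_forall_le _ _ fun j hj => ?_
  refine (natDegree_C_mul_le _ _).trans (natDegree_map_le.trans (hQ.natDegree_le i j hi ?_))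
  have := Finset.mem_range.1 hj
  omega

theorem natDegree_tabPoly_le {M N : ℕ} (hQ : IsCurve b ρ g Q) (a : ℕ → ℕ → A) {c r : ℕ → ℕ}
    (hc : ∀ k ≤ N, c k ≤ m) (hr : ∀ j < M, r j ≤ m) :
    (tabPoly m M N Q a c r).natDegree ≤ m * (M + N + 1) := by
  refine natDegree_mul_le.trans ?_
  have h1 := natDegree_det_le (Matrix.of fun i k : Fin (N + 1) => rowPoly m Q (a i) (c k))
    (fun i k => natDegree_rowPoly_le hQ (a i) (hc k (by omega)))
  have h2 : (∏ j ∈ Finset.range M, rowPoly m Q (a 0) (r j)).natDegree ≤ M * m := by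
    refine (natDegree_prod_le _ _).trans ((Finset.sum_le_sum fun j hj =>
      natDegree_rowPoly_le hQ (a 0) (hr j (Finset.mem_range.1 hj))).trans ?_)
    simp
  calc _ ≤ (N + 1) * m + M * m := Nat.add_le_add h1 h2
    _ = _ := by ring

theorem lin_curve (hQ : IsCurve b ρ g Q) (a : ℕ → A) (t : K) {i : ℕ} (hi : i ≤ m) :
    lin b a (ρ (g t) (b (Fin.ofNat (m + 1) i))) = (rowPoly m Q a i).eval (algebraMap K A t) := by
  rw [hQ.apply, map_sum, rowPoly, eval_finsetSum, Fin.val_ofNat,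
    Nat.mod_eq_of_lt (Nat.lt_succ_of_le hi), ← Fin.sum_univ_eq_sum_range
      (fun j => eval (algebraMap K A t) (C (a j) * (Q i j).map (algebraMap K A)))]
  refine Finset.sum_congr rfl fun j _ => ?_
  rw [map_smul, lin_basis, eval_mul, eval_C, eval_map_algebraMap, aeval_algebraMap_apply_eq_algebraMap_eval,
    Algebra.smul_def, mul_comm]

theorem hookEval_curve {M N : ℕ} (hQ : IsCurve b ρ g Q) (a : ℕ → ℕ → A) {c r : ℕ → ℕ}
    (hc : ∀ k ≤ N, c k ≤ m) (hr : ∀ j < M, r j ≤ m) (t : K) :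
    hookEval M N (fun i => lin b (a i)) (schurRep (hook M N) ρ (g t) (tab b M N c r)) =
      (tabPoly m M N Q a c r).eval (algebraMap K A t) := by
  rw [tab, schurRep_hookElt, hookEval_hookElt, tabPoly, eval_mul, eval_prod]
  congr 1
  · rw [← coe_evalRingHom, RingHom.map_det]
    congr 1
    ext i k
    exact lin_curve hQ _ t (hc k (by omega))
  · exact Finset.prod_congr rfl fun j hj => lin_curve hQ _ t (hr j (Finset.mem_range.1 hj))

theorem sum_extract_hookEval_curve {M N : ℕ} (hQ : IsCurve b ρ g Q) {S : Finset Kˣ}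
    (hS : m * (M + N + 1) < S.card) (d : ℕ) (a : ℕ → ℕ → A) {c r : ℕ → ℕ}
    (hc : ∀ k ≤ N, c k ≤ m) (hr : ∀ j < M, r j ≤ m) :
    ∑ t ∈ S, extract S d t • hookEval M N (fun i => lin b (a i))
      (schurRep (hook M N) ρ (g t) (tab b M N c r)) = (tabPoly m M N Q a c r).coeff d := by
  simp only [hookEval_curve hQ a hc hr]
  exact sum_extract_smul_eval S d ((natDegree_tabPoly_le hQ a hc hr).trans_lt hS)

theorem IsModel.lowerCurve {L U : ℕ → ℕ → ℕ} (h : IsModel ρ b L U) :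
    IsCurve b ρ lowerUni (fun i j => C (L i j : K) * X ^ (j - i)) where
  apply t i := by simp [h.lower]
  natDegree_le i j _ hj := (natDegree_C_mul_X_pow_le _ _).trans (by omega)

theorem IsModel.upperCurve {L U : ℕ → ℕ → ℕ} (h : IsModel ρ b L U) :
    IsCurve b ρ upperUni (fun i j => C (U i j : K) * X ^ (i - j)) where
  apply t i := by simp [h.upper]
  natDegree_le i j hi _ := (natDegree_C_mul_X_pow_le _ _).trans (by omega)

theorem hookEval_unipOp {M N : ℕ} {L U : ℕ → ℕ → ℕ} (h : IsModel ρ b L U) {S : Finset Kˣ}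
    (hS : m * (M + N + 1) < S.card) (d : ℕ) (a : ℕ → ℕ → A) {c r : ℕ → ℕ}
    (hc : ∀ k ≤ N, c k ≤ m) (hr : ∀ j < M, r j ≤ m) :
    hookEval M N (fun i => lin b (a i)) (unipOp S d (schurRep (hook M N) ρ) (tab b M N c r)) =
      (tabPoly m M N (fun i j => C (L i j : K) * X ^ (j - i)) a c r).coeff d := by
  rw [← sum_extract_hookEval_curve h.lowerCurve hS d a hc hr, unipOp_apply, map_sum]
  simp only [map_smul]

end HookCalculus

/-! ### Weights of tableaux and the highest weight line -/

section Weights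

open Matrix (SpecialLinearGroup)
open Polynomial

/-- With n the size of s, as many elements of s lie at or above n as are missing below n, and
exchanging one for the other changes the sum by at least 1. -/
theorem sum_range_add_card_sdiff_le (s : Finset ℕ) :
    ∑ i ∈ Finset.range s.card, i + (s \ Finset.range s.card).card ≤ ∑ i ∈ s, i := by
  set n := s.card with hn
  have h1 := Finset.sum_inter_add_sum_sdiff s (Finset.range n) (fun i => i)
  have h2 := Finset.sum_inter_add_sum_sdiff (Finset.range n) s (fun i => i)
  have h3 : (Finset.range n \ s).card = (s \ Finset.range n).card :=
    Finset.card_sdiff_comm (by rw [Finset.card_range])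
  have h4 : (s \ Finset.range n).card * n ≤ ∑ i ∈ s \ Finset.range n, i := by
    refine Finset.card_nsmul_le_sum _ _ _ fun i hi => ?_
    simpa using (Finset.mem_sdiff.1 hi).2
  have h5 : ∑ i ∈ Finset.range n \ s, (i + 1) ≤ (Finset.range n \ s).card * n := by
    refine Finset.sum_le_card_nsmul _ _ _ fun i hi => ?_
    exact Finset.mem_range.1 (Finset.mem_sdiff.1 hi).1
  rw [Finset.sum_add_distrib, Finset.sum_const, smul_eq_mul, mul_one, h3] at h5
  rw [Finset.inter_comm] at h2
  omega

theorem entries_le_of_sum_le {N : ℕ} {c : ℕ → ℕ} (hc : Set.InjOn c (Finset.range (N + 1))) :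
    N * (N + 1) ≤ 2 * ∑ k ∈ Finset.range (N + 1), c k ∧
      (2 * ∑ k ∈ Finset.range (N + 1), c k = N * (N + 1) → ∀ k ≤ N, c k ≤ N) := by
  have hcard : ((Finset.range (N + 1)).image c).card = N + 1 := by
    rw [Finset.card_image_of_injOn hc, Finset.card_range]
  have h := sum_range_add_card_sdiff_le ((Finset.range (N + 1)).image c)
  rw [hcard, Finset.sum_image hc] at h
  have hG := Finset.sum_range_id_mul_two (N + 1)
  rw [Nat.add_sub_cancel] at hG
  have hG' : N * (N + 1) = (N + 1) * N := mul_comm _ _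
  refine ⟨by omega, fun heq k hk => ?_⟩
  have h0 : ((Finset.range (N + 1)).image c \ Finset.range (N + 1)).card = 0 := by omega
  rw [Finset.card_eq_zero, Finset.sdiff_eq_empty_iff_subset] at h0
  have := h0 (Finset.mem_image_of_mem c (Finset.mem_range.2 (Nat.lt_succ_of_le hk)))
  exact Nat.le_of_lt_succ (Finset.mem_range.1 this)

variable {K : Type u} [Field K] {V : Type u} [AddCommGroup V] [Module K V] {m : ℕ}
  {b : Module.Basis (Fin (m + 1)) K V} {ρ : Representation K (SpecialLinearGroup (Fin 2) K) V}

theorem prod_units_zpow {ι : Type*} (s : Kˣ) (F : Finset ι) (f : ι → ℤ) :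
    ∏ i ∈ F, ((s ^ f i : Kˣ) : K) = ((s ^ (∑ i ∈ F, f i) : Kˣ) : K) := by
  classical
  induction F using Finset.induction_on with
  | empty => simp
  | insert a F ha ih =>
    rw [Finset.prod_insert ha, Finset.sum_insert ha, ih, zpow_add, Units.val_mul]

theorem torus_tab {M N : ℕ} {L U : ℕ → ℕ → ℕ} (h : IsModel ρ b L U) (s : Kˣ) {c r : ℕ → ℕ}
    (hc : ∀ k, c k ≤ m) (hr : ∀ j, r j ≤ m) :
    schurRep (hook M N) ρ (torus s) (tab b M N c r) =
      ((s ^ ((m : ℤ) * (M + N + 1) -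
        2 * (∑ k ∈ Finset.range (N + 1), c k + ∑ j ∈ Finset.range M, r j : ℕ)) : Kˣ) : K) •
        tab b M N c r := by
  have hv : ∀ i, i ≤ m → ρ (torus s) (b (Fin.ofNat (m + 1) i)) =
      ((s ^ ((m : ℤ) - 2 * i) : Kˣ) : K) • b (Fin.ofNat (m + 1) i) := by
    intro i hi
    rw [h.torus, Fin.val_ofNat, Nat.mod_eq_of_lt (Nat.lt_succ_of_le hi)]
  rw [tab, schurRep_hookElt]
  simp only [hv _ (hc _), hv _ (hr _)]
  rw [hookElt_smul b, prod_units_zpow, prod_units_zpow, ← Units.val_mul, ← zpow_add]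
  have he : ∑ k ∈ Finset.range (N + 1), ((m : ℤ) - 2 * c k) +
      ∑ j ∈ Finset.range M, ((m : ℤ) - 2 * r j) = (m : ℤ) * (M + N + 1) -
        2 * (∑ k ∈ Finset.range (N + 1), c k + ∑ j ∈ Finset.range M, r j : ℕ) := by
    simp only [Finset.sum_sub_distrib, Finset.sum_const, Finset.card_range, nsmul_eq_mul,
      ← Finset.mul_sum]
    push_cast
    ring
  rw [he]

/-- If T is the sum of all entries, the factor s^w and the inverse torus element combine to s^(2T -
N(N+1)). This exponent lies between 0 and 2m(M+N+1) - N(N+1), which is why that many nodes are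
needed. -/
theorem weightOp_tab {M N : ℕ} {L U : ℕ → ℕ → ℕ} (h : IsModel ρ b L U) {S : Finset Kˣ} {w : ℕ}
    (hw : w + N * (N + 1) = m * (M + N + 1))
    (hS : 2 * (m * (M + N + 1)) < S.card + N * (N + 1)) (j : ℕ) {c r : ℕ → ℕ}
    (hc : ∀ k, c k ≤ m) (hr : ∀ j, r j ≤ m) (hinj : Set.InjOn c (Finset.range (N + 1))) :
    weightOp S w j (schurRep (hook M N) ρ) (tab b M N c r) =
      if 2 * (∑ k ∈ Finset.range (N + 1), c k + ∑ j ∈ Finset.range M, r j) = N * (N + 1) + 2 * j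
      then tab b M N c r else 0 := by
  set T := ∑ k ∈ Finset.range (N + 1), c k + ∑ j ∈ Finset.range M, r j with hT
  have hT1 : N * (N + 1) ≤ 2 * T := by
    have := (entries_le_of_sum_le hinj).1
    omega
  have hT2 : T ≤ m * (M + N + 1) := by
    have h1 := Finset.sum_le_sum (s := Finset.range (N + 1)) fun k _ => hc k
    have h2 := Finset.sum_le_sum (s := Finset.range M) fun k _ => hr k
    simp only [Finset.sum_const, Finset.card_range, smul_eq_mul] at h1 h2
    have : m * (M + N + 1) = (N + 1) * m + M * m := by ring
    omega
  have hE := sum_extract_mul_pow S (2 * j) (i := 2 * T - N * (N + 1)) (by omega)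
  have hterm : ∀ s : Kˣ, (extract S (2 * j) s * (s : K) ^ w) •
      schurRep (hook M N) ρ (torus s⁻¹) (tab b M N c r) =
      (extract S (2 * j) s * (s : K) ^ (2 * T - N * (N + 1))) • tab b M N c r := by
    intro s
    rw [torus_tab h _ hc hr, smul_smul, mul_assoc]
    congr 2
    rw [← Units.val_pow_eq_pow_val, ← Units.val_pow_eq_pow_val, ← Units.val_mul, inv_zpow',
      ← zpow_natCast, ← zpow_natCast, ← zpow_add]
    congr 2
    rw [← hT]
    have hw' : (w : ℤ) + N * (N + 1) = m * (M + N + 1) := by exact_mod_cast hw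
    rw [Nat.cast_sub hT1]
    push_cast
    linarith
  rw [weightOp_apply]
  simp only [hterm]
  rw [← Finset.sum_smul, hE]
  by_cases h0 : 2 * T = N * (N + 1) + 2 * j
  · rw [if_pos h0, if_pos (by omega), one_smul]
  · rw [if_neg h0, if_neg (by omega), zero_smul]

/-- The coordinate functionals with values in `A`. -/
def kron (A : Type*) [CommRing A] (i j : ℕ) : A := if i = j then 1 else 0

theorem tab_eq_zero (b : Module.Basis (Fin (m + 1)) K V) {M N : ℕ} {c r : ℕ → ℕ}
    (hinj : ¬ Set.InjOn c (Finset.range (N + 1))) : tab b M N c r = 0 := by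
  simp only [Set.InjOn, not_forall] at hinj
  obtain ⟨k, hk, k', hk', h, hne⟩ := hinj
  have hk : k < N + 1 := by simpa using hk
  have hk' : k' < N + 1 := by simpa using hk'
  exact hookElt_eq_zero b (Nat.le_of_lt_succ hk) (Nat.le_of_lt_succ hk') hne (by rw [h])

theorem hookEval_kron_tab_self {M N : ℕ} (hN : N ≤ m) :
    hookEval M N (fun i => lin b (kron K i)) (tab b M N id 0) = 1 := by
  rw [hookEval_tab b (kron K) (c := id) (r := 0) (fun k hk => hk.trans hN)
    (fun _ _ => Nat.zero_le _)]
  have : (Matrix.of fun i k : Fin (N + 1) => kron K i (id k)) = 1 := by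
    ext i k
    simp [kron, Matrix.one_apply, Fin.ext_iff]
  rw [this]
  simp [kron]

/-- Distinct column entries have the minimal total only if they permute 0, …, N and the arm is zero.
Such a tableau is ± the standard one; every other tableau is killed both by the projection and by
the coordinate functional. -/
theorem isHighest_hook {M N : ℕ} {L U : ℕ → ℕ → ℕ} (h : IsModel ρ b L U) {S : Finset Kˣ} {w : ℕ}
    (hN : N ≤ m) (hw : w + N * (N + 1) = m * (M + N + 1))
    (hS : 2 * (m * (M + N + 1)) < S.card + N * (N + 1)) :
    IsHighest S w (schurRep (hook M N) ρ) (tab b M N id 0)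
      (hookEval M N fun i => lin b (kron K i)) := by
  refine ⟨hookEval_kron_tab_self hN, fun x => ?_⟩
  have hext : weightOp S w 0 (schurRep (hook M N) ρ) =
      (hookEval M N fun i => lin b (kron K i)).smulRight (tab b M N id 0) := by
    refine LinearMap.ext_on (span_tab b M N) ?_
    rintro _ ⟨c, r, hc, hr, rfl⟩
    rw [LinearMap.smulRight_apply]
    by_cases hinj : Set.InjOn c (Finset.range (N + 1))
    swap
    · simp [tab_eq_zero b hinj]
    obtain ⟨h1, h2⟩ := entries_le_of_sum_le hinj
    rw [weightOp_tab h hw hS 0 hc hr hinj]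
    by_cases hall : (∀ k ≤ N, c k ≤ N) ∧ ∀ j < M, r j = 0
    · obtain ⟨hcN, hr0⟩ := hall
      let τ0 : Fin (N + 1) → Fin (N + 1) := fun k => ⟨c k, Nat.lt_succ_of_le (hcN k (by omega))⟩
      have hτ0 : Function.Injective τ0 := fun k k' hk => Fin.ext
        (hinj (Finset.mem_coe.2 (Finset.mem_range.2 k.2))
          (Finset.mem_coe.2 (Finset.mem_range.2 k'.2)) (congrArg Fin.val hk))
      let τ := Equiv.ofBijective τ0 (Finite.injective_iff_bijective.1 hτ0)
      have htab : tab b M N c r = ((Equiv.Perm.sign τ : ℤ) : K) • tab b M N id 0 := by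
        rw [tab, tab, ← hookElt_perm b τ (x' := fun k => b (Fin.ofNat (m + 1) (c k)))
          (fun k => rfl)]
        exact hookElt_congr (fun _ _ => rfl) (fun j hj => by rw [hr0 j hj]; rfl)
      have hsum : ∑ k ∈ Finset.range (N + 1), c k = ∑ k ∈ Finset.range (N + 1), k := by
        rw [← Fin.sum_univ_eq_sum_range c, ← Fin.sum_univ_eq_sum_range fun k => k]
        exact Equiv.sum_comp τ fun k : Fin (N + 1) => (k : ℕ)
      have hsum' : ∑ j ∈ Finset.range M, r j = 0 :=
        Finset.sum_eq_zero fun j hj => hr0 j (Finset.mem_range.1 hj)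
      have hG := Finset.sum_range_id_mul_two (N + 1)
      rw [Nat.add_sub_cancel] at hG
      have hG' : N * (N + 1) = (N + 1) * N := mul_comm _ _
      rw [if_pos (by omega), htab, map_smul, hookEval_kron_tab_self hN]
      simp
    · rw [if_neg]
      · rw [hookEval_tab b _ (fun k _ => hc k) (fun j _ => hr j)]
        rw [not_and_or] at hall
        push Not at hall
        rcases hall with ⟨k, hk, hck⟩ | ⟨j, hj, hrj⟩
        · rw [Matrix.det_eq_zero_of_column_eq_zero ⟨k, Nat.lt_succ_of_le hk⟩, zero_mul, zero_smul]
          intro i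
          simp only [Matrix.of_apply, kron]
          rw [if_neg (by omega)]
        · rw [Finset.prod_eq_zero (Finset.mem_range.2 hj), mul_zero, zero_smul]
          rw [kron, if_neg (Ne.symm hrj)]
      · intro heq
        refine hall ⟨h2 (by omega), fun j hj => ?_⟩
        have := Finset.single_le_sum (f := r) (fun _ _ => Nat.zero_le _) (Finset.mem_range.2 hj)
        omega
  rw [hext, LinearMap.smulRight_apply]

end Weights

/-! ### Frobenius folding of the determinant and of the arm -/

section KeyIdentity

open Matrix (SpecialLinearGroup)
open Polynomial

/-- Compare coefficients in (1+X)^(p^e) (1+X)^n, the first factor being 1 + X^(p^e). -/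
theorem choose_char_pow_add (R : Type*) [CommRing R] (p e : ℕ) [Fact p.Prime] [CharP R p]
    (n r : ℕ) : (((p ^ e + n).choose r : ℕ) : R) =
      (n.choose r : R) + if p ^ e ≤ r then (n.choose (r - p ^ e) : R) else 0 := by
  have h : (1 + X : R[X]) ^ (p ^ e + n) = (1 + X) ^ n + X ^ p ^ e * (1 + X) ^ n := by
    rw [pow_add, add_pow_char_pow, one_pow, add_mul, one_mul]
  have h2 := congrArg (fun P => coeff P r) h
  simpa only [coeff_add, coeff_X_pow_mul', coeff_one_add_X_pow] using h2

theorem det_eq_one_of_unitriangular {R : Type*} [CommRing R] {n : ℕ} (B : Matrix (Fin n) (Fin n) R)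
    (h0 : ∀ i j, i < j → B i j = 0) (h1 : ∀ i, B i i = 1) : B.det = 1 := by
  rw [Matrix.det_of_isLowerTriangular (M := B) fun i j hij => h0 i j hij]
  simp [h1]

variable {K : Type u} [Field K] {A : Type w} [CommRing A] [Algebra K A]

/-- The coefficients of the lower unitriangular matrices on an upper model. -/
def lowerCoeff (K : Type u) [Field K] (m i j : ℕ) : K[X] :=
  C (((m - i).choose (m - j) : ℕ) : K) * X ^ (j - i)

theorem rowPoly_lowerCoeff (m : ℕ) (a : ℕ → A) (k : ℕ) :
    rowPoly m (lowerCoeff K m) a k =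
      ∑ j ∈ Finset.range (m + 1), C (a j * ((m - k).choose (m - j) : ℕ)) * X ^ (j - k) := by
  refine Finset.sum_congr rfl fun j _ => ?_
  simp only [lowerCoeff, Polynomial.map_mul, Polynomial.map_pow, map_X, map_natCast, Polynomial.map_natCast,
    C_mul]
  ring

/-- Of the two binomials into which each coefficient splits, one survives only for j ≥ p^e and the
other only for j ≤ N. Hence the entries at l and l + p^e carry the same binomial coefficient and can
be paired. -/
theorem rowPoly_lowerCoeff_pow_add (p e : ℕ) [Fact p.Prime] [CharP K p] {N : ℕ} (hN : N < p ^ e)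
    (a : ℕ → A) {k : ℕ} (hk : k ≤ N) :
    rowPoly (p ^ e + N) (lowerCoeff K (p ^ e + N)) a k =
      ∑ l ∈ Finset.range (N + 1), (C (a l) + C (a (l + p ^ e)) * X ^ p ^ e) *
        (C (((N - k).choose (N - l) : ℕ) : A) * X ^ (l - k)) := by
  nontriviality A
  have : CharP A p := charP_of_injective_algebraMap (algebraMap K A).injective p
  set q := p ^ e with hq
  rw [rowPoly_lowerCoeff]
  have h1 : ∀ j ∈ Finset.range (q + N + 1),
      C (a j * ((q + N - k).choose (q + N - j) : ℕ)) * X ^ (j - k) =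
      C (a j * ((N - k).choose (q + N - j) : ℕ)) * X ^ (j - k) +
      if j ≤ N then C (a j * ((N - k).choose (N - j) : ℕ)) * X ^ (j - k) else 0 := by
    intro j hj
    rw [Nat.add_sub_assoc hk, hq, choose_char_pow_add A p e, ← hq]
    by_cases h : j ≤ N
    · rw [if_pos h, if_pos (by omega), show q + N - j - q = N - j by omega, mul_add, C_add, add_mul]
    · rw [if_neg h, if_neg (by omega), add_zero, add_zero]
  rw [Finset.sum_congr rfl h1, Finset.sum_add_distrib, add_assoc q N 1, Finset.sum_range_add]
  rw [Finset.sum_eq_zero, zero_add]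
  swap
  · intro j hj
    rw [Nat.choose_eq_zero_of_lt (by have := Finset.mem_range.1 hj; omega)]
    simp
  rw [← add_comm (N + 1) q, Finset.sum_range_add _ (N + 1) q]
  rw [Finset.sum_eq_zero (s := Finset.range q), add_zero, ← Finset.sum_add_distrib]
  swap
  · intro j hj
    rw [if_neg (by omega)]
  refine Finset.sum_congr rfl fun l hl => ?_
  have hl := Finset.mem_range.1 hl
  rw [if_pos (by omega), show q + N - (q + l) = N - l by omega, add_comm q l]
  by_cases h : k ≤ l
  · rw [show l + q - k = q + (l - k) by omega, pow_add]
    simp only [C_mul]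
    ring
  · rw [Nat.choose_eq_zero_of_lt (by omega)]
    simp

/-- The determinant of the rows `a`, folded along the translation by `q`. -/
def foldDet (N q : ℕ) (a : ℕ → ℕ → A) : A[X] :=
  (Matrix.of fun i l : Fin (N + 1) => C (a i l) + X * C (a i (l + q))).det

theorem natDegree_foldDet_le (N q : ℕ) (a : ℕ → ℕ → A) : (foldDet N q a).natDegree ≤ N + 1 := by
  have h : (Matrix.of fun i l : Fin (N + 1) => C (a i l) + X * C (a i (l + q))) =
      (X : A[X]) • (Matrix.of fun i l : Fin (N + 1) => a i (l + q)).map C +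
        (Matrix.of fun i l : Fin (N + 1) => a i l).map C := by
    ext1 i l
    simp [add_comm]
  rw [foldDet, h]
  exact (natDegree_det_X_add_C_le _ _).trans (by simp)

/-- The matrix is the folded one, whose entries are linear in t^(p^e), times a unitriangular matrix
of binomials. All dependence on smaller powers of t sits in the second factor, whose determinant is
1. -/
theorem det_rowPoly_lowerCoeff (p e : ℕ) [Fact p.Prime] [CharP K p] {N : ℕ} (hN : N < p ^ e)
    (a : ℕ → ℕ → A) :
    (Matrix.of fun i k : Fin (N + 1) =>
      rowPoly (p ^ e + N) (lowerCoeff K (p ^ e + N)) (a i) (k : ℕ)).det =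
      expand A (p ^ e) (foldDet N (p ^ e) a) := by
  have h : (Matrix.of fun i k : Fin (N + 1) =>
      rowPoly (p ^ e + N) (lowerCoeff K (p ^ e + N)) (a i) (k : ℕ)) =
      (Matrix.of fun i l : Fin (N + 1) => C (a i l) + C (a i (l + p ^ e)) * X ^ p ^ e) *
      (Matrix.of fun l k : Fin (N + 1) =>
        (C (((N - k).choose (N - l) : ℕ) : A) * X ^ ((l : ℕ) - k))) := by
    ext1 i k
    rw [Matrix.mul_apply, Matrix.of_apply, rowPoly_lowerCoeff_pow_add p e hN _ (by omega),
      ← Fin.sum_univ_eq_sum_range fun l => (C (a i l) + C (a i (l + p ^ e)) * X ^ p ^ e) *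
        (C (((N - k).choose (N - l) : ℕ) : A) * X ^ (l - k))]
    rfl
  rw [h, Matrix.det_mul, det_eq_one_of_unitriangular (Matrix.of fun l k : Fin (N + 1) =>
        (C (((N - k).choose (N - l) : ℕ) : A) * X ^ ((l : ℕ) - k))), mul_one, foldDet,
    AlgHom.map_det]
  · congr 1
    ext1 i l
    simp only [Matrix.of_apply, AlgHom.mapMatrix_apply, Matrix.map_apply, map_add, map_mul,
      expand_C, expand_X]
    ring
  · intro l k hlk
    have : (l : ℕ) < k := hlk
    rw [Matrix.of_apply, Nat.choose_eq_zero_of_lt (by omega)]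
    simp
  · intro l
    simp

theorem tabPoly_lowerCoeff_id (p e : ℕ) [Fact p.Prime] [CharP K p] {N : ℕ} (hN : N < p ^ e)
    (M : ℕ) (a : ℕ → ℕ → A) (r : ℕ → ℕ) :
    tabPoly (p ^ e + N) M N (lowerCoeff K (p ^ e + N)) a id r =
      expand A (p ^ e) (foldDet N (p ^ e) a) *
        ∏ j ∈ Finset.range M, rowPoly (p ^ e + N) (lowerCoeff K (p ^ e + N)) (a 0) (r j) := by
  rw [← det_rowPoly_lowerCoeff (K := K) p e hN]
  rfl

/-- The prime p divides the inner binomial coefficients of p^f, so only l = 0 and l = p^f survive in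
the folded sum. -/
theorem rowPoly_lowerCoeff_zero (p e f : ℕ) [Fact p.Prime] [CharP K p] (hf : f < e) (a : ℕ → A) :
    rowPoly (p ^ e + p ^ f) (lowerCoeff K (p ^ e + p ^ f)) a 0 =
      C (a 0) + C (a (p ^ f)) * X ^ p ^ f + C (a (p ^ e)) * X ^ p ^ e +
        C (a (p ^ e + p ^ f)) * X ^ (p ^ e + p ^ f) := by
  nontriviality A
  have : CharP A p := charP_of_injective_algebraMap (algebraMap K A).injective p
  have hp := (Fact.out : p.Prime)
  have h0 : 0 < p ^ f := pow_pos hp.pos f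
  rw [rowPoly_lowerCoeff_pow_add p e (Nat.pow_lt_pow_right hp.one_lt hf) a (Nat.zero_le _)]
  have h1 : ∀ l ∈ Finset.range (p ^ f + 1), l ≠ 0 ∧ l ≠ p ^ f →
      (C (a l) + C (a (l + p ^ e)) * X ^ p ^ e) *
        (C (((p ^ f - 0).choose (p ^ f - l) : ℕ) : A) * X ^ (l - 0)) = 0 := by
    intro l hl h
    have hl := Finset.mem_range.1 hl
    have : (((p ^ f - 0).choose (p ^ f - l) : ℕ) : A) = 0 := by
      rw [CharP.cast_eq_zero_iff A p]
      exact hp.dvd_choose_pow (by omega) (by omega)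
    rw [this]
    simp
  rw [Finset.sum_eq_add_of_mem 0 (p ^ f) (by simp) (by simp) h0.ne h1]
  simp only [Nat.sub_zero, Nat.choose_self, Nat.sub_self, Nat.choose_zero_right, pow_zero,
    Nat.cast_one, C_1, mul_one, one_mul, zero_add, add_comm (p ^ f) (p ^ e), pow_add]
  ring

theorem rowPoly_lowerCoeff_zero_pow (p e f g : ℕ) [Fact p.Prime] [CharP K p] (hf : f < e)
    (a : ℕ → A) :
    rowPoly (p ^ e + p ^ f) (lowerCoeff K (p ^ e + p ^ f)) a 0 ^ p ^ g =
      C (a 0 ^ p ^ g) + C (a (p ^ f) ^ p ^ g) * X ^ (p ^ f * p ^ g) +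
        C (a (p ^ e) ^ p ^ g) * X ^ (p ^ e * p ^ g) +
        C (a (p ^ e + p ^ f) ^ p ^ g) * X ^ ((p ^ e + p ^ f) * p ^ g) := by
  nontriviality A
  have : CharP A p := charP_of_injective_algebraMap (algebraMap K A).injective p
  rw [rowPoly_lowerCoeff_zero p e f hf, add_pow_char_pow, add_pow_char_pow, add_pow_char_pow]
  simp only [mul_pow, C_pow, pow_mul]

/-- The determinant has only powers of t^(p^e), and the nonconstant terms of the arm start at degree
p^f p^g or at degrees that are at least p^e. No product reaches a positive degree below both bounds.
-/
theorem coeff_tabPoly_lowerCoeff_eq_zero (p e f g : ℕ) [Fact p.Prime] [CharP K p] (hf : f < e)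
    (a : ℕ → ℕ → A) {d : ℕ} (h0 : 0 < d) (hd : d < p ^ e) (hd' : d < p ^ f * p ^ g) :
    (tabPoly (p ^ e + p ^ f) (p ^ g) (p ^ f) (lowerCoeff K (p ^ e + p ^ f)) a id 0).coeff d = 0 := by
  have hp := (Fact.out : p.Prime)
  have hg : 0 < p ^ g := pow_pos hp.pos g
  have hle : p ^ e ≤ p ^ e * p ^ g := Nat.le_mul_of_pos_right _ hg
  have hle' : p ^ e ≤ (p ^ e + p ^ f) * p ^ g :=
    hle.trans (Nat.mul_le_mul_right _ (Nat.le_add_right _ _))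
  rw [tabPoly_lowerCoeff_id p e (Nat.pow_lt_pow_right hp.one_lt hf)]
  simp only [Pi.zero_apply, Finset.prod_const, Finset.card_range]
  rw [rowPoly_lowerCoeff_zero_pow p e f g hf]
  have hnd : ¬ p ^ e ∣ d := fun h => absurd (Nat.le_of_dvd h0 h) (by omega)
  simp only [mul_add, ← mul_assoc, coeff_add, coeff_mul_X_pow', coeff_mul_C]
  rw [coeff_expand (pow_pos hp.pos e), if_neg hnd, if_neg (by omega), if_neg (by omega),
    if_neg (by omega)]
  simp

/-- The determinant has degree at most p^e (p^f + 1). With the first two terms of the arm it stays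
at or below the lower bound on d, and the other two terms start only at p^e p^g. -/
theorem coeff_tabPoly_lowerCoeff_eq_zero_of_lt (p e f g : ℕ) [Fact p.Prime] [CharP K p]
    (hf : f < e) (a : ℕ → ℕ → A) {d : ℕ} (hd : p ^ e * (p ^ f + 1) + p ^ f * p ^ g < d)
    (hd' : d < p ^ e * p ^ g) :
    (tabPoly (p ^ e + p ^ f) (p ^ g) (p ^ f) (lowerCoeff K (p ^ e + p ^ f)) a id 0).coeff d = 0 := by
  have hp := (Fact.out : p.Prime)
  rw [tabPoly_lowerCoeff_id p e (Nat.pow_lt_pow_right hp.one_lt hf)]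
  simp only [Pi.zero_apply, Finset.prod_const, Finset.card_range]
  rw [rowPoly_lowerCoeff_zero_pow p e f g hf]
  have hdeg : (expand A (p ^ e) (foldDet (p ^ f) (p ^ e) a)).natDegree ≤ p ^ e * (p ^ f + 1) := by
    rw [natDegree_expand, mul_comm]
    exact Nat.mul_le_mul_left _ (natDegree_foldDet_le _ _ a)
  have hle' : p ^ e * p ^ g ≤ (p ^ e + p ^ f) * p ^ g :=
    Nat.mul_le_mul_right _ (Nat.le_add_right _ _)
  simp only [mul_add, ← mul_assoc, coeff_add, coeff_mul_X_pow', coeff_mul_C]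
  rw [coeff_eq_zero_of_natDegree_lt (n := d) (by omega), if_neg (by omega : ¬ p ^ e * p ^ g ≤ d),
    if_neg (by omega : ¬ (p ^ e + p ^ f) * p ^ g ≤ d), if_pos (by omega),
    coeff_eq_zero_of_natDegree_lt (n := d - p ^ f * p ^ g) (by omega)]
  simp

end KeyIdentity

/-! ### Degrees in which the highest weight is moved -/

section Moves

open Matrix (SpecialLinearGroup)
open Polynomial

variable {K : Type u} [Field K] {V : Type u} [AddCommGroup V] [Module K V] {m : ℕ}

theorem genericRow_eq_lin (b : Module.Basis (Fin (m + 1)) K V) (i : ℕ) :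
    genericRow b i = lin b fun j => MvPolynomial.X (i, Fin.ofNat (m + 1) j) := by
  refine b.ext fun j => ?_
  rw [genericRow_basis, lin_basis, Fin.ofNat_val_eq_self]

theorem hookEval_lin_ext {M N : ℕ} (b : Module.Basis (Fin (m + 1)) K V)
    {x y : Schur K (hook M N) V}
    (h : ∀ a : ℕ → ℕ → MvPolynomial (ℕ × Fin (m + 1)) K,
      hookEval M N (fun i => lin b (a i)) x = hookEval M N (fun i => lin b (a i)) y) : x = y := by
  refine hookElt_ext b ?_
  simpa only [← genericRow_eq_lin] using h fun i j => MvPolynomial.X (i, Fin.ofNat (m + 1) j)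

theorem rowPoly_kron {A : Type*} [CommRing A] [Algebra K A] (Q : ℕ → ℕ → K[X]) {z : ℕ} (hz : z ≤ m)
    (i : ℕ) : rowPoly m Q (kron A z) i = (Q i z).map (algebraMap K A) := by
  rw [rowPoly, Finset.sum_eq_single z]
  · simp [kron]
  · intro j _ hj
    rw [kron, if_neg (Ne.symm hj), C_0, zero_mul]
  · intro h
    exact absurd (Finset.mem_range.2 (Nat.lt_succ_of_le hz)) h

theorem rowPoly_kron_self (Q : ℕ → ℕ → K[X]) {z : ℕ} (hz : z ≤ m)
    (i : ℕ) : rowPoly m Q (kron K z) i = Q i z := by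
  rw [rowPoly_kron Q hz, Algebra.algebraMap_self, Polynomial.map_id]

/-- There are enough nodes to separate the weights of a hook. -/
structure HookNodes (S : Finset Kˣ) (w m M N : ℕ) : Prop where
  le : N ≤ m
  weight : w + N * (N + 1) = m * (M + N + 1)
  card_lt : m * (M + N + 1) < S.card
  card_lt' : 2 * (m * (M + N + 1)) < S.card + N * (N + 1)

theorem HookNodes.isHighest {S : Finset Kˣ} {w M N : ℕ} (hS : HookNodes S w m M N)
    {ρ : Representation K (SpecialLinearGroup (Fin 2) K) V}
    {b : Module.Basis (Fin (m + 1)) K V} {L U : ℕ → ℕ → ℕ} (h : IsModel ρ b L U) :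
    IsHighest S w (schurRep (hook M N) ρ) (tab b M N id 0)
      (hookEval M N fun i => lin b (kron K i)) :=
  isHighest_hook h hS.le hS.weight hS.card_lt'

section Nodes

variable {p e f : ℕ} {ρ : Representation K (SpecialLinearGroup (Fin 2) K) V}
  {b : Module.Basis (Fin (p ^ e + p ^ f + 1)) K V} {S : Finset Kˣ} {w : ℕ}

theorem coeff_sum_span_tab {M N d : ℕ} {Q : ℕ → ℕ → K[X]} {g : K → SpecialLinearGroup (Fin 2) K}
    {b : Module.Basis (Fin (m + 1)) K V} (hQ : IsCurve b ρ g Q)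
    (hS : m * (M + N + 1) < S.card) :
    (∃ x, ∑ t ∈ S, extract S d t * hookEval M N (fun i => lin b (kron K i))
      (schurRep (hook M N) ρ (g t) x) ≠ 0) ↔
    ∃ c r : ℕ → ℕ, (∀ k, c k ≤ m) ∧ (∀ j, r j ≤ m) ∧ (tabPoly m M N Q (kron K) c r).coeff d ≠ 0 := by
  let L : Schur K (hook M N) V →ₗ[K] K := ∑ t ∈ S, extract S d t •
    (hookEval M N (fun i => lin b (kron K i)) ∘ₗ schurRep (hook M N) ρ (g t))
  have hL : ∀ x, ∑ t ∈ S, extract S d t * hookEval M N (fun i => lin b (kron K i))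
      (schurRep (hook M N) ρ (g t) x) = L x := by
    intro x
    simp [L, LinearMap.sum_apply]
  have key : ∀ c r : ℕ → ℕ, (∀ k, c k ≤ m) → (∀ j, r j ≤ m) →
      L (tab b M N c r) = (tabPoly m M N Q (kron K) c r).coeff d := by
    intro c r hc hr
    rw [← hL, ← sum_extract_hookEval_curve hQ hS d (kron K) (fun k _ => hc k) (fun j _ => hr j)]
    rfl
  simp only [hL]
  constructor
  · rintro ⟨x, hx⟩
    by_contra hcon
    push Not at hcon
    have : L = 0 := by
      refine LinearMap.ext_on (span_tab b M N) ?_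
      rintro _ ⟨c, r, hc, hr, rfl⟩
      rw [key c r hc hr, hcon c r hc hr, LinearMap.zero_apply]
    exact hx (by rw [this, LinearMap.zero_apply])
  · rintro ⟨c, r, hc, hr, h⟩
    exact ⟨tab b M N c r, by rwa [key c r hc hr]⟩

theorem IsUpperModel.movesHighest_iff (h : IsUpperModel ρ b) (g : ℕ)
    (hS : HookNodes S w (p ^ e + p ^ f) (p ^ g) (p ^ f)) (d : ℕ) :
    MovesHighest S w d (schurRep (hook (p ^ g) (p ^ f)) ρ) ↔
      ∃ a : ℕ → ℕ → MvPolynomial (ℕ × Fin (p ^ e + p ^ f + 1)) K,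
        (tabPoly (p ^ e + p ^ f) (p ^ g) (p ^ f) (lowerCoeff K (p ^ e + p ^ f)) a id 0).coeff d ≠ 0 := by
  have key : ∀ a : ℕ → ℕ → MvPolynomial (ℕ × Fin (p ^ e + p ^ f + 1)) K,
      hookEval (p ^ g) (p ^ f) (fun i => lin b (a i))
        (unipOp S d (schurRep (hook (p ^ g) (p ^ f)) ρ) (tab b (p ^ g) (p ^ f) id 0)) =
      (tabPoly (p ^ e + p ^ f) (p ^ g) (p ^ f) (lowerCoeff K (p ^ e + p ^ f)) a id 0).coeff d :=
    fun a => hookEval_unipOp h hS.card_lt d a (fun k hk => hk.trans hS.le) (fun _ _ => Nat.zero_le _)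
  rw [(hS.isHighest h).movesHighest_iff d]
  constructor
  · intro h0
    by_contra hcon
    push Not at hcon
    exact h0 (hookEval_lin_ext b fun a => by rw [key, hcon, map_zero])
  · rintro ⟨a, ha⟩ h0
    rw [← key, h0, map_zero] at ha
    exact ha rfl

theorem IsLowerModel.movesHighest_dual_iff (h : IsLowerModel ρ b) (g : ℕ)
    (hS : HookNodes S w (p ^ e + p ^ f) (p ^ g) (p ^ f)) (d : ℕ) :
    MovesHighest S w d (schurRep (hook (p ^ g) (p ^ f)) ρ).dual ↔
      ∃ c r : ℕ → ℕ, (∀ k, c k ≤ p ^ e + p ^ f) ∧ (∀ j, r j ≤ p ^ e + p ^ f) ∧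
        (tabPoly (p ^ e + p ^ f) (p ^ g) (p ^ f) (fun i j => lowerCoeff K (p ^ e + p ^ f) j i)
          (kron K) c r).coeff d ≠ 0 := by
  rw [(hS.isHighest h).movesHighest_dual_iff d]
  exact coeff_sum_span_tab h.upperCurve hS.card_lt

end Nodes

section Characteristic

variable {p e f : ℕ} [Fact p.Prime] [CharP K p]
  {ρ : Representation K (SpecialLinearGroup (Fin 2) K) V}
  {b : Module.Basis (Fin (p ^ e + p ^ f + 1)) K V} {S : Finset Kˣ} {w : ℕ}

theorem IsUpperModel.not_movesHighest (h : IsUpperModel ρ b) (g : ℕ) (hf : f < e)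
    (hS : HookNodes S w (p ^ e + p ^ f) (p ^ g) (p ^ f)) {d : ℕ}
    (h0 : 0 < d) (hd : d < p ^ e) (hd' : d < p ^ f * p ^ g) :
    ¬ MovesHighest S w d (schurRep (hook (p ^ g) (p ^ f)) ρ) := by
  rw [h.movesHighest_iff g hS]
  rintro ⟨a, ha⟩
  exact ha (coeff_tabPoly_lowerCoeff_eq_zero p e f g hf a h0 hd hd')

/-- The upper unitriangular matrices act on a lower model by the transposed coefficients. -/
theorem tabPoly_flip_lowerCoeff {M N : ℕ} (hN : N < p ^ e) {c r : ℕ → ℕ}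
    (hc : ∀ k, c k ≤ p ^ e + N) (hr : ∀ j, r j ≤ p ^ e + N) :
    tabPoly (p ^ e + N) M N (fun i j => lowerCoeff K (p ^ e + N) j i) (kron K) c r =
      expand K (p ^ e) (foldDet N (p ^ e) fun k => kron K (c k)) *
        ∏ j ∈ Finset.range M, rowPoly (p ^ e + N) (lowerCoeff K (p ^ e + N)) (kron K (r j)) 0 := by
  rw [tabPoly, ← det_rowPoly_lowerCoeff (K := K) p e hN]
  congr 1
  · rw [← Matrix.det_transpose]
    congr 1
    ext1 k i
    rw [Matrix.transpose_apply, Matrix.of_apply, Matrix.of_apply,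
      rowPoly_kron_self _ (i.2.le.trans (by omega)), rowPoly_kron_self _ (hc _)]
  · refine Finset.prod_congr rfl fun j _ => ?_
    rw [rowPoly_kron_self _ (Nat.zero_le _), rowPoly_kron_self _ (hr _)]

/-- The coefficients are those of an upper model, transposed. The determinant is a polynomial in
t^(p^e) and each arm factor has exponents among 0, p^f, p^e, p^e + p^f, so everything is a
polynomial in t^(p^f). -/
theorem IsLowerModel.dvd_of_movesHighest_dual (h : IsLowerModel ρ b) (g : ℕ) (hf : f < e)
    (hS : HookNodes S w (p ^ e + p ^ f) (p ^ g) (p ^ f)) {d : ℕ}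
    (hd : MovesHighest S w d (schurRep (hook (p ^ g) (p ^ f)) ρ).dual) : p ^ f ∣ d := by
  obtain ⟨c, r, hc, hr, h0⟩ := (h.movesHighest_dual_iff g hS d).1 hd
  have hp := (Fact.out : p.Prime)
  rw [tabPoly_flip_lowerCoeff (Nat.pow_lt_pow_right hp.one_lt hf) hc hr] at h0
  have hq : p ^ e = p ^ f * p ^ (e - f) := by rw [← pow_add]; congr 1; omega
  have hmem : ∀ a : ℕ → K, rowPoly (p ^ e + p ^ f) (lowerCoeff K (p ^ e + p ^ f)) a 0 ∈
      (expand K (p ^ f)).range := by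
    intro a
    refine ⟨C (a 0) + C (a (p ^ f)) * X + C (a (p ^ e)) * X ^ p ^ (e - f) +
      C (a (p ^ e + p ^ f)) * X ^ (p ^ (e - f) + 1), ?_⟩
    rw [rowPoly_lowerCoeff_zero p e f hf]
    simp only [AlgHom.toRingHom_eq_coe, RingHom.coe_coe, map_add, map_mul, map_pow, expand_C,
      expand_X, ← pow_mul, ← hq, mul_add, mul_one]
  have hP : expand K (p ^ e) (foldDet (p ^ f) (p ^ e) fun k => kron K (c k)) *
        ∏ j ∈ Finset.range (p ^ g), rowPoly (p ^ e + p ^ f) (lowerCoeff K (p ^ e + p ^ f))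
          (kron K (r j)) 0 ∈ (expand K (p ^ f)).range := by
    refine mul_mem ?_ (prod_mem fun j _ => hmem _)
    refine ⟨expand K (p ^ (e - f)) (foldDet (p ^ f) (p ^ e) fun k => kron K (c k)), ?_⟩
    change expand K (p ^ f) (expand K (p ^ (e - f)) _) = _
    rw [expand_expand, ← hq]
  obtain ⟨P, hP⟩ := hP
  by_contra hnd
  refine h0 ?_
  rw [← hP]
  change (expand K (p ^ f) P).coeff d = 0
  rw [coeff_expand (pow_pos hp.pos f), if_neg hnd]

theorem foldDet_kron {A : Type*} [CommRing A] {N q : ℕ} (hq : N < q) :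
    foldDet N q (kron A) = 1 := by
  have : (Matrix.of fun i l : Fin (N + 1) => C (kron A i l) + X * C (kron A i (l + q))) = 1 := by
    ext1 i l
    have : (i : ℕ) ≠ l + q := by omega
    simp [kron, this, Matrix.one_apply, Fin.ext_iff, apply_ite C]
  rw [foldDet, this, Matrix.det_one]

theorem IsLowerModel.movesHighest_dual (h : IsLowerModel ρ b) (g : ℕ) (hf : f < e)
    (hS : HookNodes S w (p ^ e + p ^ f) (p ^ g) (p ^ f)) :
    MovesHighest S w (p ^ f) (schurRep (hook (p ^ g) (p ^ f)) ρ).dual := by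
  have hp := (Fact.out : p.Prime)
  have hlt := Nat.pow_lt_pow_right hp.one_lt hf
  have h0 : 0 < p ^ f := pow_pos hp.pos f
  have hr : ∀ j : ℕ, (if j = 0 then p ^ f else 0) ≤ p ^ e + p ^ f := fun j => by
    split_ifs <;> omega
  rw [h.movesHighest_dual_iff g hS]
  -- The column is 0, …, N and the determinant 1; the single arm entry p^f contributes t^(p^f). The
  -- `min` only serves to bound the irrelevant values of the column.
  refine ⟨fun k => min k (p ^ e + p ^ f), fun j => if j = 0 then p ^ f else 0,
    fun k => min_le_right _ _, hr, ?_⟩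
  rw [tabPoly_flip_lowerCoeff (p := p) (e := e) hlt (fun k => min_le_right _ _) hr]
  have h1 : foldDet (p ^ f) (p ^ e) (fun k => kron K (min k (p ^ e + p ^ f))) = 1 := by
    rw [← foldDet_kron (A := K) hlt, foldDet, foldDet]
    congr 1
    ext1 i l
    rw [Matrix.of_apply, Matrix.of_apply, min_eq_left (by omega)]
  obtain ⟨n, hn⟩ := Nat.exists_eq_succ_of_ne_zero (pow_pos hp.pos g).ne'
  rw [h1, map_one, one_mul, hn, Finset.prod_range_succ']
  have h2 : rowPoly (p ^ e + p ^ f) (lowerCoeff K (p ^ e + p ^ f)) (kron K 0) 0 = 1 := by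
    simp [rowPoly_kron_self, lowerCoeff]
  have h3 : rowPoly (p ^ e + p ^ f) (lowerCoeff K (p ^ e + p ^ f)) (kron K (p ^ f)) 0 =
      X ^ p ^ f := by
    rw [rowPoly_kron_self _ (Nat.le_add_left _ _), lowerCoeff, Nat.sub_zero, Nat.add_sub_cancel,
      choose_char_pow_add, Nat.choose_eq_zero_of_lt hlt]
    simp
  simp [h2, h3]

end Characteristic

variable {ρ : Representation K (SpecialLinearGroup (Fin 2) K) V}
  {b : Module.Basis (Fin (m + 1)) K V} {S : Finset Kˣ} {w M N : ℕ}

/-- The tableau with column 0, …, N and a single 1 in the arm detects degree 1: an upper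
unitriangular matrix fixes the determinant and adds t times basis vector 0 to basis vector 1. -/
theorem IsUpperModel.movesHighest_dual (h : IsUpperModel ρ b) (hS : HookNodes S w m M N)
    (hm : 0 < m) (hM : 0 < M) : MovesHighest S w 1 (schurRep (hook M N) ρ).dual := by
  have hN := hS.le
  rw [(hS.isHighest h).movesHighest_dual_iff 1, coeff_sum_span_tab h.upperCurve hS.card_lt]
  refine ⟨fun k => min k m, fun j => if j = 0 then 1 else 0,
    fun k => min_le_right _ _, fun j => ?_, ?_⟩
  · change (if j = 0 then 1 else 0) ≤ m
    split_ifs <;> omega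
  rw [tabPoly, ← Matrix.det_transpose, det_eq_one_of_unitriangular, one_mul]
  · obtain ⟨n, rfl⟩ := Nat.exists_eq_succ_of_ne_zero hM.ne'
    rw [Finset.prod_range_succ']
    simp [rowPoly_kron_self]
  · intro k i hki
    have : (k : ℕ) < i := hki
    rw [Matrix.transpose_apply, Matrix.of_apply, rowPoly_kron_self _ (by omega),
      Nat.choose_eq_zero_of_lt (by omega)]
    simp
  · intro i
    rw [Matrix.transpose_apply, Matrix.of_apply, rowPoly_kron_self _ (by omega),
      min_eq_left (by omega)]
    simp

/-- Reading coordinate N + 1 in place of N picks up the single entry (N + 1)t, and this is t because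
N vanishes in K. -/
theorem IsLowerModel.movesHighest (h : IsLowerModel ρ b) (hS : HookNodes S w m M N)
    (h0 : 0 < N) (hN : N < m) (hN' : (N : K) = 0) :
    MovesHighest S w 1 (schurRep (hook M N) ρ) := by
  rw [(hS.isHighest h).movesHighest_iff 1]
  intro hzero
  have := hookEval_unipOp h hS.card_lt 1 (fun i => kron K (if i = N then N + 1 else i)) (c := id)
    (r := 0) (fun k hk => hk.trans hN.le) (fun _ _ => Nat.zero_le _)
  rw [hzero, map_zero, tabPoly, Matrix.det_of_isLowerTriangular, Fin.prod_univ_castSucc] at this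
  · rw [Finset.prod_eq_one, one_mul, Finset.prod_eq_one, mul_one, Matrix.of_apply, Fin.val_last,
      if_pos rfl, rowPoly_kron_self _ hN] at this
    · simp [hN'] at this
    · intro j _
      rw [if_neg h0.ne, rowPoly_kron_self _ (Nat.zero_le _)]
      simp
    · intro i _
      rw [Matrix.of_apply, Fin.val_castSucc, if_neg i.2.ne, rowPoly_kron_self _ (by omega)]
      simp
  · intro i k hik
    have : (i : ℕ) < k := hik
    rw [Matrix.of_apply, if_neg (by omega), rowPoly_kron_self _ (by omega), id,
      Nat.choose_eq_zero_of_lt (by omega)]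
    simp



end Moves

/-! ### Odd characteristic: separating the two modules ∇ Sym^ -/

section OddCharacteristic

open Matrix (SpecialLinearGroup)
open Polynomial

variable {K : Type u} [Field K] {V : Type u} [AddCommGroup V] [Module K V] {p e f : ℕ}
  [Fact p.Prime] [CharP K p] {ρ : Representation K (SpecialLinearGroup (Fin 2) K) V}
  {b : Module.Basis (Fin (p ^ e + p ^ f + 1)) K V} {S : Finset Kˣ} {w : ℕ}

theorem foldDet_kron_shift {A : Type*} [CommRing A] {N q : ℕ} (h0 : 0 < N) (hq : N < q) :
    foldDet N q (fun i => kron A (if i = 0 ∨ i = N then i else i + q)) = X ^ (N - 1) := by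
  have hdiag : (Matrix.of fun i l : Fin (N + 1) =>
      C (kron A (if (i : ℕ) = 0 ∨ (i : ℕ) = N then (i : ℕ) else i + q) l) +
        X * C (kron A (if (i : ℕ) = 0 ∨ (i : ℕ) = N then (i : ℕ) else i + q) (l + q))) =
      Matrix.diagonal fun i : Fin (N + 1) =>
        if (i : ℕ) = 0 ∨ (i : ℕ) = N then (1 : A[X]) else X := by
    ext1 i l
    rw [Matrix.of_apply, Matrix.diagonal_apply]
    have hi := i.2
    have hl := l.2
    by_cases h1 : (i : ℕ) = 0 ∨ (i : ℕ) = N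
    · rw [if_pos h1, if_pos h1, kron, kron, if_neg (show (i : ℕ) ≠ l + q by omega), C_0, mul_zero,
        add_zero]
      simp [Fin.ext_iff, apply_ite C]
    · rw [if_neg h1, if_neg h1, kron, kron, if_neg (show (i : ℕ) + q ≠ l by omega), C_0, zero_add]
      simp [Fin.ext_iff, apply_ite C]
  rw [foldDet, hdiag, Matrix.det_diagonal]
  obtain ⟨n, rfl⟩ := Nat.exists_eq_succ_of_ne_zero h0.ne'
  rw [Fin.prod_univ_eq_prod_range
    (fun i => if i = 0 ∨ i = n.succ then (1 : A[X]) else X) (n.succ + 1),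
    Finset.prod_range_succ, Finset.prod_range_succ', if_pos (Or.inr rfl), if_pos (Or.inl rfl),
    Finset.prod_congr rfl fun i hi => if_neg (by have := Finset.mem_range.1 hi; omega)]
  simp

/-- Rows 0 and N read their own coordinates and the other N - 1 rows read coordinates shifted by
p^e. The folded matrix becomes diagonal, and the arm is 1 because row 0 is unshifted. -/
theorem IsUpperModel.movesHighest_mul_sub_one (h : IsUpperModel ρ b) (g : ℕ) (hf : f < e)
    (hS : HookNodes S w (p ^ e + p ^ f) (p ^ g) (p ^ f)) :
    MovesHighest S w (p ^ e * (p ^ f - 1)) (schurRep (hook (p ^ g) (p ^ f)) ρ) := by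
  have hp := (Fact.out : p.Prime)
  have hlt := Nat.pow_lt_pow_right hp.one_lt hf
  have h0 : 0 < p ^ f := pow_pos hp.pos f
  set A := MvPolynomial (ℕ × Fin (p ^ e + p ^ f + 1)) K
  rw [h.movesHighest_iff g hS]
  refine ⟨fun i => kron A (if i = 0 ∨ i = p ^ f then i else i + p ^ e), ?_⟩
  rw [tabPoly_lowerCoeff_id p e hlt, Finset.prod_eq_one, mul_one, coeff_expand_mul' (by omega),
    foldDet_kron_shift h0 hlt]
  · simp
  · intro j _
    rw [if_pos (Or.inl rfl), rowPoly_kron _ (Nat.zero_le _)]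
    simp [lowerCoeff]

/-- For p ≥ 3 one has p^g ≥ 3p^f, which places p^e (p^g - 1) in the gap between the terms of the
arm. For p = 2 the gap can miss this degree, for instance when f = 1 and g = 2. -/
theorem IsUpperModel.not_movesHighest_mul_sub_one (h : IsUpperModel ρ b) {g : ℕ} (hf : f < e)
    (hf0 : 0 < f) (hfg : f < g) (hge : g < e) (hp2 : p ≠ 2)
    (hS : HookNodes S w (p ^ e + p ^ f) (p ^ g) (p ^ f)) :
    ¬ MovesHighest S w (p ^ e * (p ^ g - 1)) (schurRep (hook (p ^ g) (p ^ f)) ρ) := by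
  have hp := (Fact.out : p.Prime)
  have hp3 : 3 ≤ p := by have := hp.two_le; omega
  rw [h.movesHighest_iff g hS]
  rintro ⟨a, ha⟩
  refine ha (coeff_tabPoly_lowerCoeff_eq_zero_of_lt p e f g hf a ?_ ?_)
  · have h3 : p ≤ p ^ f := Nat.le_self_pow hf0.ne' p
    have hg : 3 * p ^ f ≤ p ^ g := by
      calc 3 * p ^ f ≤ p * p ^ f := Nat.mul_le_mul_right _ hp3
        _ = p ^ (f + 1) := by ring
        _ ≤ p ^ g := Nat.pow_le_pow_right hp.pos hfg
    have hlt := Nat.pow_lt_pow_right hp.one_lt hge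
    calc p ^ e * (p ^ f + 1) + p ^ f * p ^ g < p ^ e * (p ^ f + 1) + p ^ f * p ^ e :=
          Nat.add_lt_add_left (Nat.mul_lt_mul_of_pos_left hlt (by omega)) _
      _ = p ^ e * (2 * p ^ f + 1) := by ring
      _ ≤ p ^ e * (p ^ g - 1) := Nat.mul_le_mul_left _ (by omega)
  · exact Nat.mul_lt_mul_of_pos_left (by have := pow_pos hp.pos g; omega) (pow_pos hp.pos e)

end OddCharacteristic

/-! ### Row polynomials as binomially weighted polynomials -/

section BinomPoly

open Polynomial

variable {A : Type*} [CommRing A]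

/-- The polynomial with coefficients `a`, weighted by binomial coefficients. -/
def binomPoly (n : ℕ) (a : ℕ → A) : A[X] :=
  ∑ i ∈ Finset.range (n + 1), C (a i * (n.choose i : ℕ)) * X ^ i

theorem coeff_binomPoly (n : ℕ) (a : ℕ → A) (i : ℕ) :
    (binomPoly n a).coeff i = a i * (n.choose i : ℕ) := by
  simp only [binomPoly, finsetSum_coeff, coeff_C_mul_X_pow]
  rw [Finset.sum_ite_eq]
  split_ifs with h
  · rfl
  · rw [Nat.choose_eq_zero_of_lt (by simpa using h)]
    simp

theorem natDegree_binomPoly_le (n : ℕ) (a : ℕ → A) : (binomPoly n a).natDegree ≤ n := by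
  refine natDegree_le_iff_coeff_eq_zero.2 fun i hi => ?_
  rw [coeff_binomPoly, Nat.choose_eq_zero_of_lt hi]
  simp

theorem rowPoly_lowerCoeff_eq_binomPoly {K : Type u} [Field K] [Algebra K A] (p e : ℕ)
    [Fact p.Prime] [CharP K p] {N : ℕ} (hN : N < p ^ e) (a : ℕ → A) {k : ℕ} (hk : k ≤ N) :
    rowPoly (p ^ e + N) (lowerCoeff K (p ^ e + N)) a k =
      binomPoly (N - k) (fun i => a (i + k)) +
        X ^ p ^ e * binomPoly (N - k) (fun i => a (i + k + p ^ e)) := by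
  rw [rowPoly_lowerCoeff_pow_add p e hN a hk, show N + 1 = k + (N - k + 1) by omega,
    Finset.sum_range_add, Finset.sum_eq_zero, zero_add, binomPoly, binomPoly, Finset.mul_sum,
    ← Finset.sum_add_distrib]
  · refine Finset.sum_congr rfl fun i hi => ?_
    have := Finset.mem_range.1 hi
    rw [show N - (k + i) = N - k - i by omega, Nat.choose_symm (by omega), Nat.add_sub_cancel_left,
      add_comm k i]
    simp only [C_mul]
    ring
  · intro l hl
    have := Finset.mem_range.1 hl
    rw [Nat.choose_eq_zero_of_lt (by omega)]
    simp

end BinomPoly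

/-! ### Characteristic 2: an invariant vector of weight w - 4 -/

section EvenCharacteristic

open Matrix (SpecialLinearGroup)
open Polynomial

variable {K : Type u} [Field K]

/-- There is an invariant of the upper unitriangular matrices in the second weight space that is
killed by the operators of degrees `1` and `d`. -/
def HasInvariant {V : Type*} [AddCommGroup V] [Module K V] (S : Finset Kˣ) (w d : ℕ)
    (ρ : Representation K (SpecialLinearGroup (Fin 2) K) V) : Prop :=
  ∃ z, z ≠ 0 ∧ weightOp S w 2 ρ z = z ∧ (∀ t, ρ (upperUni t) z = z) ∧ unipOp S 1 ρ z = 0 ∧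
    unipOp S d ρ z = 0

theorem IsoRep.hasInvariant {V V' : Type*} [AddCommGroup V] [Module K V] [AddCommGroup V']
    [Module K V'] {ρ : Representation K (SpecialLinearGroup (Fin 2) K) V}
    {ρ' : Representation K (SpecialLinearGroup (Fin 2) K) V'} (h : IsoRep ρ ρ')
    {S : Finset Kˣ} {w d : ℕ} (hz : HasInvariant S w d ρ) : HasInvariant S w d ρ' := by
  obtain ⟨φ, hφ⟩ := h
  obtain ⟨z, h0, h1, h2, h3, h4⟩ := hz
  refine ⟨φ z, ?_, ?_, ?_, ?_, ?_⟩
  · rwa [Ne, LinearEquiv.map_eq_zero_iff]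
  · rw [← map_weightOp hφ, h1]
  · intro t
    rw [← hφ, h2]
  · rw [← map_unipOp hφ, h3, map_zero]
  · rw [← map_unipOp hφ, h4, map_zero]

theorem IsUpperModel.hookEval_unipOp {V : Type u} [AddCommGroup V] [Module K V] {A : Type w}
    [CommRing A] [Algebra K A] {m M N : ℕ} {ρ : Representation K (SpecialLinearGroup (Fin 2) K) V}
    {b : Module.Basis (Fin (m + 1)) K V} (h : IsUpperModel ρ b) {S : Finset Kˣ} {w : ℕ}
    (hS : HookNodes S w m M N) (d : ℕ) (a : ℕ → ℕ → A) {c r : ℕ → ℕ} (hc : ∀ k ≤ N, c k ≤ m)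
    (hr : ∀ j < M, r j ≤ m) :
    hookEval M N (fun i => lin b (a i)) (unipOp S d (schurRep (hook M N) ρ) (tab b M N c r)) =
      (tabPoly m M N (lowerCoeff K m) a c r).coeff d :=
  Plethysm.hookEval_unipOp h hS.card_lt d a hc hr

/-- The coefficients of the upper unitriangular matrices on an upper model. -/
def upperCoeff (K : Type u) [Field K] (i j : ℕ) : K[X] := C ((i.choose j : ℕ) : K) * X ^ (i - j)

theorem IsUpperModel.hookEval_upperUni {V : Type u} [AddCommGroup V] [Module K V] {A : Type w}
    [CommRing A] [Algebra K A] {m M N : ℕ} {ρ : Representation K (SpecialLinearGroup (Fin 2) K) V}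
    {b : Module.Basis (Fin (m + 1)) K V} (h : IsUpperModel ρ b) (a : ℕ → ℕ → A) {c r : ℕ → ℕ}
    (hc : ∀ k ≤ N, c k ≤ m) (hr : ∀ j < M, r j ≤ m) (t : K) :
    hookEval M N (fun i => lin b (a i)) (schurRep (hook M N) ρ (upperUni t) (tab b M N c r)) =
      (tabPoly m M N (upperCoeff K) a c r).eval (algebraMap K A t) :=
  hookEval_curve h.upperCurve a hc hr t

theorem prod_range_ite_lt_two {R : Type*} [CommRing R] (F : ℕ → R) (n : ℕ) :
    ∏ j ∈ Finset.range (n + 2), F (if j < 2 then 1 else 0) = F 0 ^ n * F 1 ^ 2 := by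
  rw [Finset.prod_range_succ', Finset.prod_range_succ']
  simp [pow_two, mul_assoc]

theorem prod_range_ite_eq_zero {R : Type*} [CommRing R] (F : ℕ → R) (n c : ℕ) :
    ∏ j ∈ Finset.range (n + 1), F (if j = 0 then c else 0) = F 0 ^ n * F c := by
  rw [Finset.prod_range_succ']
  simp

theorem tabPoly_min {A : Type w} [CommRing A] [Algebra K A] {m M N : ℕ} (hN : N ≤ m) (Q : ℕ → ℕ → K[X]) (a : ℕ → ℕ → A) (r : ℕ → ℕ) :
    tabPoly m M N Q a (fun k => min k m) r = tabPoly m M N Q a id r := by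
  rw [tabPoly, tabPoly]
  congr 2
  ext1 i k
  rw [Matrix.of_apply, Matrix.of_apply, min_eq_left (by omega), id]

section Char2

variable [CharP K 2] {A : Type w} [CommRing A] [Algebra K A]

/-- Upper unitriangular matrices preserve the span of the basis vectors 0, …, N and act on it with
determinant 1. -/
theorem det_rowPoly_upperCoeff {K : Type u} [Field K] {A : Type w} [CommRing A] [Algebra K A]
    {m N : ℕ} (hN : N ≤ m) (a : ℕ → ℕ → A) :
    (Matrix.of fun i k : Fin (N + 1) => rowPoly m (upperCoeff K) (a i) (k : ℕ)).det =
      C (Matrix.of fun i k : Fin (N + 1) => a i k).det := by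
  have h : (Matrix.of fun i k : Fin (N + 1) => rowPoly m (upperCoeff K) (a i) (k : ℕ)) =
      (C : A →+* A[X]).mapMatrix (Matrix.of fun i k : Fin (N + 1) => a i k) *
      (Matrix.of fun j k : Fin (N + 1) => (upperCoeff K k j).map (algebraMap K A)) := by
    ext1 i k
    rw [Matrix.mul_apply, Matrix.of_apply, rowPoly, show m + 1 = N + 1 + (m - N) by omega,
      Finset.sum_range_add, Finset.sum_eq_zero (s := Finset.range (m - N)), add_zero,
      ← Fin.sum_univ_eq_sum_range fun j => C (a i j) * (upperCoeff K k j).map (algebraMap K A)]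
    · rfl
    · intro j _
      rw [upperCoeff, Nat.choose_eq_zero_of_lt (by omega)]
      simp
  have hB : (Matrix.of fun j k : Fin (N + 1) =>
      (upperCoeff K k j).map (algebraMap K A)).det = 1 := by
    rw [← Matrix.det_transpose]
    refine det_eq_one_of_unitriangular _ (fun k j hkj => ?_) fun k => ?_
    · have : (k : ℕ) < j := hkj
      rw [Matrix.transpose_apply, Matrix.of_apply, upperCoeff, Nat.choose_eq_zero_of_lt this]
      simp
    · simp [upperCoeff]
  rw [h, Matrix.det_mul, ← RingHom.map_det, hB, mul_one]

/-- In characteristic 2, x_1 goes to x_1 + t x_0 and x_2 to x_2 + t^2 x_0; the two terms t^2 x_0^2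
cancel. -/
theorem rowPoly_upperCoeff_invariant {m : ℕ} (hm : 2 ≤ m) (a : ℕ → A) :
    rowPoly m (upperCoeff K) a 1 ^ 2 + rowPoly m (upperCoeff K) a 0 * rowPoly m (upperCoeff K) a 2 =
      C (a 1 ^ 2 + a 0 * a 2) := by
  nontriviality A
  have : CharP A 2 := charP_of_injective_algebraMap (algebraMap K A).injective 2
  have h : ∀ k ≤ 2, rowPoly m (upperCoeff K) a k =
      ∑ j ∈ Finset.range 3, C (a j) * (upperCoeff K k j).map (algebraMap K A) := by
    intro k hk
    rw [rowPoly, show m + 1 = 3 + (m - 2) by omega, Finset.sum_range_add,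
      Finset.sum_eq_zero (s := Finset.range (m - 2)), add_zero]
    intro j _
    rw [upperCoeff, Nat.choose_eq_zero_of_lt (by omega)]
    simp
  rw [h 0 (by norm_num), h 1 (by norm_num), h 2 le_rfl]
  simp only [Finset.sum_range_succ, Finset.sum_range_zero, upperCoeff, Nat.choose_self,
    Nat.choose_zero_right, Nat.choose_one_right, Nat.cast_one, map_one, one_mul, Nat.sub_zero,
    Polynomial.map_pow, map_X, Nat.choose_eq_zero_of_lt (show 0 < 1 by norm_num),
    Nat.choose_eq_zero_of_lt (show 0 < 2 by norm_num),
    Nat.choose_eq_zero_of_lt (show 1 < 2 by norm_num), Nat.cast_zero, map_zero, zero_mul,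
    Polynomial.map_zero, mul_zero, add_zero, zero_add, pow_zero, Polynomial.map_one, mul_one,
    Nat.cast_ofNat, CharTwo.two_eq_zero, Nat.sub_self]
  rw [CharTwo.add_sq]
  simp only [C_add, C_mul, C_pow]
  have h2 : (2 : A[X]) = 0 := CharTwo.two_eq_zero
  linear_combination (C (a 0) ^ 2 * X ^ 2) * h2

theorem tabPoly_upperCoeff_invariant {m : ℕ} (hm : 2 ≤ m) {N : ℕ} (hN : N ≤ m) (n : ℕ)
    (a : ℕ → ℕ → A) :
    tabPoly m (n + 2) N (upperCoeff K) a id (fun j => if j < 2 then 1 else 0) +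
      tabPoly m (n + 2) N (upperCoeff K) a id (fun j => if j = 0 then 2 else 0) =
    C ((Matrix.of fun i k : Fin (N + 1) => a i k).det * (a 0 0 ^ n *
        (a 0 1 ^ 2 + a 0 0 * a 0 2))) := by
  rw [tabPoly, tabPoly, ← mul_add, prod_range_ite_lt_two (rowPoly m (upperCoeff K) (a 0)),
    prod_range_ite_eq_zero (rowPoly m (upperCoeff K) (a 0)) (n + 1),
    pow_succ (rowPoly m (upperCoeff K) (a 0) 0) n, mul_assoc, ← mul_add,
    rowPoly_upperCoeff_invariant hm, C_mul, C_mul, C_pow]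
  congr 1
  · exact det_rowPoly_upperCoeff hN a
  · congr 2
    rw [rowPoly, Finset.sum_range_succ', Finset.sum_eq_zero, zero_add]
    · simp [upperCoeff]
    · intro j _
      simp [upperCoeff]

theorem tabPoly_lowerCoeff_invariant {e N : ℕ} (hN : N < 2 ^ e) (n : ℕ) (a : ℕ → ℕ → A) :
    tabPoly (2 ^ e + N) (n + 2) N (lowerCoeff K (2 ^ e + N)) a id
        (fun j => if j < 2 then 1 else 0) +
      tabPoly (2 ^ e + N) (n + 2) N (lowerCoeff K (2 ^ e + N)) a id
        (fun j => if j = 0 then 2 else 0) =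
    expand A (2 ^ e) (foldDet N (2 ^ e) a) *
      (rowPoly (2 ^ e + N) (lowerCoeff K (2 ^ e + N)) (a 0) 0 ^ n *
        (rowPoly (2 ^ e + N) (lowerCoeff K (2 ^ e + N)) (a 0) 1 ^ 2 +
        rowPoly (2 ^ e + N) (lowerCoeff K (2 ^ e + N)) (a 0) 0 *
        rowPoly (2 ^ e + N) (lowerCoeff K (2 ^ e + N)) (a 0) 2)) := by
  rw [tabPoly_lowerCoeff_id 2 e hN, tabPoly_lowerCoeff_id 2 e hN,
    prod_range_ite_lt_two (rowPoly (2 ^ e + N) (lowerCoeff K (2 ^ e + N)) (a 0)),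
    prod_range_ite_eq_zero (rowPoly (2 ^ e + N) (lowerCoeff K (2 ^ e + N)) (a 0)) (n + 1)]
  ring

/-- Both degrees lie below 2N for N = 2^f. Modulo t^(2N) the determinant and the even power of row 0
are constants, so only the quadratic form in rows 0, 1, 2 matters, and there each row becomes a
binomial polynomial of degree at most N - k. -/
theorem coeff_lowerCoeff_invariant (e f n d : ℕ) (hf : f < e) (hf0 : 0 < f) (hn : Even n)
    (hd : d = 1 ∨ d = 2 * 2 ^ f - 2) (D : A[X]) (a : ℕ → A) :
    (expand A (2 ^ e) D * (rowPoly (2 ^ e + 2 ^ f) (lowerCoeff K (2 ^ e + 2 ^ f)) a 0 ^ n *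
      (rowPoly (2 ^ e + 2 ^ f) (lowerCoeff K (2 ^ e + 2 ^ f)) a 1 ^ 2 +
      rowPoly (2 ^ e + 2 ^ f) (lowerCoeff K (2 ^ e + 2 ^ f)) a 0 *
      rowPoly (2 ^ e + 2 ^ f) (lowerCoeff K (2 ^ e + 2 ^ f)) a 2))).coeff d = 0 := by
  nontriviality A
  have : CharP A 2 := charP_of_injective_algebraMap (algebraMap K A).injective 2
  have hlt : 2 ^ f < 2 ^ e := Nat.pow_lt_pow_right one_lt_two hf
  have h2f : 2 * 2 ^ f ≤ 2 ^ e := by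
    calc 2 * 2 ^ f = 2 ^ (f + 1) := by ring
      _ ≤ 2 ^ e := Nat.pow_le_pow_right (by norm_num) hf
  have h2 : 2 ≤ 2 ^ f := Nat.le_self_pow hf0.ne' 2
  have hN : ((2 ^ f : ℕ) : A) = 0 := by
    rw [CharP.cast_eq_zero_iff A 2]
    exact dvd_pow_self 2 hf0.ne'
  set N := 2 ^ f with hNdef
  set q := 2 ^ e with hq
  let π := Ideal.Quotient.mk (Ideal.span {(X : A[X]) ^ (2 * N)})
  have hπ : ∀ j, 2 * N ≤ j → π (X ^ j) = 0 := by
    intro j hj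
    rw [Ideal.Quotient.eq_zero_iff_mem, Ideal.mem_span_singleton]
    exact pow_dvd_pow X hj
  have hcoeff : ∀ P Q : A[X], π P = π Q → ∀ d, d < 2 * N → P.coeff d = Q.coeff d := by
    intro P Q hPQ d hd
    rw [Ideal.Quotient.eq, Ideal.mem_span_singleton, X_pow_dvd_iff] at hPQ
    rw [← sub_eq_zero, ← coeff_sub, hPQ d hd]
  have hrow : ∀ k ≤ N, π (rowPoly (q + N) (lowerCoeff K (q + N)) a k) =
      π (binomPoly (N - k) fun i => a (i + k)) := by
    intro k hk
    rw [rowPoly_lowerCoeff_eq_binomPoly 2 e hlt a hk, map_add, map_mul, hπ _ h2f, zero_mul,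
      add_zero]
  have hD : π (expand A q D) = π (C (D.coeff 0)) := by
    rw [← divX_mul_X_add D, map_add, map_mul, expand_X, expand_C, map_add, map_mul, hπ _ h2f,
      mul_zero, zero_add]
    simp
  -- Squaring row 0 doubles its exponents N, q, q + N, so all but the constant term disappear modulo
  -- t^(2N).
  have hR : π (rowPoly (q + N) (lowerCoeff K (q + N)) a 0 ^ n) = π (C (a 0 ^ n)) := by
    obtain ⟨j, rfl⟩ := hn
    rw [← two_mul, pow_mul (rowPoly (q + N) (lowerCoeff K (q + N)) a 0), rowPoly_lowerCoeff_zero 2 e f hf, map_pow]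
    rw [CharTwo.add_sq, CharTwo.add_sq, CharTwo.add_sq]
    simp only [mul_pow, ← pow_mul, map_add, map_mul]
    rw [hπ _ (by omega), hπ _ (by omega), hπ _ (by omega)]
    simp [pow_mul]
  have hmain : π (expand A q D * (rowPoly (q + N) (lowerCoeff K (q + N)) a 0 ^ n *
      (rowPoly (q + N) (lowerCoeff K (q + N)) a 1 ^ 2 +
      rowPoly (q + N) (lowerCoeff K (q + N)) a 0 * rowPoly (q + N) (lowerCoeff K (q + N)) a 2))) =
      π (C (D.coeff 0 * a 0 ^ n) * ((binomPoly (N - 1) fun i => a (i + 1)) ^ 2 +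
        (binomPoly (N - 0) fun i => a (i + 0)) * binomPoly (N - 2) fun i => a (i + 2))) := by
    simp only [map_mul, map_add, map_pow] at hD hR ⊢
    rw [hD, hR, hrow 0 (Nat.zero_le _), hrow 1 (by omega), hrow 2 h2, mul_assoc]
  rw [hcoeff _ _ hmain d (by omega), coeff_C_mul]
  refine mul_eq_zero_of_right _ ?_
  rw [coeff_add]
  rcases hd with rfl | rfl
  -- In degree 1 the square has coefficient twice something, and the product involves only the even
  -- numbers N and N - 2.
  · rw [pow_two, mul_coeff_one, mul_coeff_one]
    simp only [coeff_binomPoly]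
    have e1 : (((N - 2).choose 1 : ℕ) : A) = 0 := by
      rw [Nat.choose_one_right, Nat.cast_sub h2, hN]
      simp [CharTwo.two_eq_zero]
    rw [e1, Nat.sub_zero, Nat.choose_one_right N, hN, mul_comm (a (1 + 1) * _), CharTwo.add_self_eq_zero]
    simp
  -- Degree 2N - 2 is the top degree of both summands, and all leading coefficients are a_N; the two
  -- copies of a_N^2 cancel.
  · rw [pow_two, show 2 * N - 2 = (N - 1) + (N - 1) by omega,
      coeff_mul_add_eq_of_natDegree_le (natDegree_binomPoly_le _ _) (natDegree_binomPoly_le _ _),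
      show N - 1 + (N - 1) = (N - 0) + (N - 2) by omega,
      coeff_mul_add_eq_of_natDegree_le (natDegree_binomPoly_le _ _) (natDegree_binomPoly_le _ _)]
    simp only [coeff_binomPoly, Nat.choose_self, Nat.cast_one, mul_one]
    rw [show N - 1 + 1 = N by omega, show N - 0 + 0 = N by omega, show N - 2 + 2 = N by omega,
      CharTwo.add_self_eq_zero]

variable {V : Type u} [AddCommGroup V] [Module K V] {e f : ℕ}
  {ρ : Representation K (SpecialLinearGroup (Fin 2) K) V}
  {b : Module.Basis (Fin (2 ^ e + 2 ^ f + 1)) K V} {S : Finset Kˣ} {w : ℕ}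

/-- The vector is the sum of the tableaux with column 0, …, N and arms (1, 1, 0, …) and (2, 0, …).
It evaluates to the determinant times a_0^n (a_1^2 + a_0 a_2), with a the linear form of row 0. -/
theorem IsUpperModel.hasInvariant_of_coeff {m n N : ℕ} {b : Module.Basis (Fin (m + 1)) K V}
    (h : IsUpperModel ρ b) (hm : 2 ≤ m) (hS : HookNodes S w m (n + 2) N) {d' : ℕ}
    (hcoeff : ∀ d, d = 1 ∨ d = d' → ∀ a : ℕ → ℕ → MvPolynomial (ℕ × Fin (m + 1)) K,
      (tabPoly m (n + 2) N (lowerCoeff K m) a id (fun j => if j < 2 then 1 else 0) +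
        tabPoly m (n + 2) N (lowerCoeff K m) a id (fun j => if j = 0 then 2 else 0)).coeff d = 0) :
    HasInvariant S w d' (schurRep (hook (n + 2) N) ρ) := by
  have hc : ∀ k, min k m ≤ m := fun k => min_le_right _ _
  have hr1 : ∀ j, (if j < 2 then 1 else 0) ≤ m := fun j => by split_ifs <;> omega
  have hr2 : ∀ j, (if j = 0 then 2 else 0) ≤ m := fun j => by split_ifs <;> omega
  obtain ⟨z1, hz1⟩ : ∃ z, z = tab b (n + 2) N (fun k => min k m) fun j => if j < 2 then 1 else 0 :=
    ⟨_, rfl⟩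
  obtain ⟨z2, hz2⟩ : ∃ z, z = tab b (n + 2) N (fun k => min k m) fun j => if j = 0 then 2 else 0 :=
    ⟨_, rfl⟩
  have hunip : ∀ d, d = 1 ∨ d = d' → unipOp S d (schurRep (hook (n + 2) N) ρ) (z1 + z2) = 0 := by
    intro d hd
    refine hookEval_lin_ext b fun a => ?_
    rw [map_add, map_add, map_zero, hz1, h.hookEval_unipOp hS d a (fun k _ => hc k) fun j _ => hr1 j, hz2,
      h.hookEval_unipOp hS d a (fun k _ => hc k) fun j _ => hr2 j, tabPoly_min hS.le, tabPoly_min hS.le, ← coeff_add,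
      hcoeff d hd a]
  have hupper : ∀ t, schurRep (hook (n + 2) N) ρ (upperUni t) (z1 + z2) = z1 + z2 := by
    have hconst : ∀ (a : ℕ → ℕ → MvPolynomial (ℕ × Fin (m + 1)) K), ∃ c, ∀ t,
        hookEval (n + 2) N (fun i => lin b (a i))
          (schurRep (hook (n + 2) N) ρ (upperUni t) (z1 + z2)) = c := by
      intro a
      refine ⟨(Matrix.of fun i k : Fin (N + 1) => a i k).det * (a 0 0 ^ n *
        (a 0 1 ^ 2 + a 0 0 * a 0 2)), fun t => ?_⟩
      rw [map_add, map_add, hz1, h.hookEval_upperUni a (fun k _ => hc k) fun j _ => hr1 j, hz2, h.hookEval_upperUni a (fun k _ => hc k) fun j _ => hr2 j,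
        tabPoly_min hS.le, tabPoly_min hS.le, ← eval_add, tabPoly_upperCoeff_invariant hm hS.le,
        eval_C]
    intro t
    refine hookEval_lin_ext b fun a => ?_
    obtain ⟨c, hc⟩ := hconst a
    have h1 : upperUni (0 : K) = 1 := Subtype.ext (by
      change !![1, 0; 0, 1] = (1 : Matrix (Fin 2) (Fin 2) K)
      simp [Matrix.one_fin_two])
    have := hc 0
    rw [h1, map_one, Module.End.one_apply] at this
    rw [hc, this]
  have hinj : Set.InjOn (fun k => min k m) (Finset.range (N + 1)) := by
    intro k hk k' hk' hkk
    have h1 := Finset.mem_range.1 (Finset.mem_coe.1 hk)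
    have h2 := Finset.mem_range.1 (Finset.mem_coe.1 hk')
    have := hS.le
    simp only at hkk
    omega
  have hsum : 2 * ∑ k ∈ Finset.range (N + 1), min k m = N * (N + 1) := by
    rw [Finset.sum_congr rfl fun k hk => min_eq_left (by
      have := Finset.mem_range.1 hk; have := hS.le; omega), mul_comm, Finset.sum_range_id_mul_two,
      Nat.add_sub_cancel, mul_comm]
  refine ⟨z1 + z2, ?_, ?_, hupper, hunip _ (Or.inl rfl), hunip _ (Or.inr rfl)⟩
  · intro h0
    -- Row 0 reads coordinates 0 and 1 together, which gives determinant 1 and quadratic form 1 + 0.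
    let a : ℕ → ℕ → K := fun i j => kron K i j + if i = 0 ∧ j = 1 then 1 else 0
    have := congrArg (hookEval (n + 2) N fun i => lin b (a i)) h0
    rw [map_add, hz1, hookEval_tab b a (fun k _ => hc k) (fun j _ => hr1 j), hz2,
      hookEval_tab b a (fun k _ => hc k) (fun j _ => hr2 j),
      ← mul_add, prod_range_ite_lt_two (a 0), prod_range_ite_eq_zero (a 0) (n + 1), map_zero,
      ← Matrix.det_transpose, det_eq_one_of_unitriangular] at this
    · simp [a, kron] at this
    · intro k i hki
      have : (k : ℕ) < i := hki
      have h' : (i : ℕ) ≠ k := by omega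
      have h'' : (i : ℕ) ≠ 0 := by omega
      have hk : min (k : ℕ) m = k := min_eq_left (by have := hS.le; omega)
      rw [Matrix.transpose_apply, Matrix.of_apply]
      simp only [a, kron, hk, h', h'', false_and, if_false, add_zero]
    · intro i
      have hi : min (i : ℕ) m = i := min_eq_left (by have := hS.le; omega)
      rw [Matrix.transpose_apply, Matrix.of_apply]
      simp only [a, kron, hi, if_true]
      rw [if_neg (by omega), add_zero]
  · have hsum1 : ∑ j ∈ Finset.range (n + 2), (if j < 2 then 1 else 0) = 2 := by
      rw [Finset.sum_range_succ', Finset.sum_range_succ']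
      simp
    have hsum2 : ∑ j ∈ Finset.range (n + 2), (if j = 0 then 2 else 0) = 2 := by simp
    rw [map_add, hz1, weightOp_tab h hS.weight hS.card_lt' 2 hc hr1 hinj, hz2,
      weightOp_tab h hS.weight hS.card_lt' 2 hc hr2 hinj, hsum1, hsum2, if_pos (by omega),
      if_pos (by omega)]

theorem IsUpperModel.hasInvariant (h : IsUpperModel ρ b) {g : ℕ} (hf : f < e) (hf0 : 0 < f)
    (hg : 0 < g) (hS : HookNodes S w (2 ^ e + 2 ^ f) (2 ^ g) (2 ^ f)) :
    HasInvariant S w (2 * 2 ^ f - 2) (schurRep (hook (2 ^ g) (2 ^ f)) ρ) := by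
  have hlt : 2 ^ f < 2 ^ e := Nat.pow_lt_pow_right one_lt_two hf
  have h2 : 2 ≤ 2 ^ f := Nat.le_self_pow hf0.ne' 2
  obtain ⟨n, hn⟩ : ∃ n, 2 ^ g = n + 2 :=
    ⟨2 ^ g - 2, by have : 2 ≤ 2 ^ g := Nat.le_self_pow hg.ne' 2; omega⟩
  have hneven : Even n := by
    have : Even (n + 2) := hn ▸ (even_two.pow_of_ne_zero hg.ne')
    rw [Nat.even_add] at this
    simpa using this
  rw [hn] at hS ⊢
  refine h.hasInvariant_of_coeff (by omega) hS fun d hd a => ?_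
  rw [tabPoly_lowerCoeff_invariant hlt]
  exact coeff_lowerCoeff_invariant e f n d hf hf0 hneven hd _ _

end Char2

end EvenCharacteristic

/-! ### The weight space w - 4: five spanning tableaux -/

section SecondWeightSpace

open Matrix (SpecialLinearGroup)

theorem prod_of_sum_eq_one {ι R : Type*} [CommRing R] (s : Finset ι) {r : ι → ℕ}
    (h : ∑ j ∈ s, r j = 1) (F : ℕ → R) : ∏ j ∈ s, F (r j) = F 0 ^ (s.card - 1) * F 1 := by
  classical
  obtain ⟨j, hj, hj0⟩ := Finset.exists_ne_zero_of_sum_ne_zero (by omega : ∑ j ∈ s, r j ≠ 0)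
  rw [← Finset.add_sum_erase s r hj] at h
  have h0 : ∀ i ∈ s.erase j, r i = 0 := Finset.sum_eq_zero_iff.1 (by omega)
  rw [← Finset.mul_prod_erase s (fun j => F (r j)) hj,
    Finset.prod_congr rfl fun i hi => by rw [h0 i hi], Finset.prod_const, Finset.card_erase_of_mem hj,
    show r j = 1 by omega, mul_comm]

theorem prod_of_sum_eq_two {ι : Type*} (R : Type*) [CommRing R] (s : Finset ι) {r : ι → ℕ}
    (h : ∑ j ∈ s, r j = 2) :
    (∀ F : ℕ → R, ∏ j ∈ s, F (r j) = F 0 ^ (s.card - 1) * F 2) ∨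
      ∀ F : ℕ → R, ∏ j ∈ s, F (r j) = F 0 ^ (s.card - 2) * F 1 ^ 2 := by
  classical
  obtain ⟨j, hj, hj0⟩ := Finset.exists_ne_zero_of_sum_ne_zero (by omega : ∑ j ∈ s, r j ≠ 0)
  have h' := h
  rw [← Finset.add_sum_erase s r hj] at h'
  by_cases h2 : r j = 2
  · left
    intro F
    have h0 : ∀ i ∈ s.erase j, r i = 0 := Finset.sum_eq_zero_iff.1 (by omega)
    rw [← Finset.mul_prod_erase s (fun j => F (r j)) hj,
      Finset.prod_congr rfl fun i hi => by rw [h0 i hi], Finset.prod_const,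
      Finset.card_erase_of_mem hj, h2, mul_comm]
  · right
    intro F
    rw [← Finset.mul_prod_erase s (fun j => F (r j)) hj,
      prod_of_sum_eq_one (s.erase j) (by omega) F, Finset.card_erase_of_mem hj,
      show r j = 1 by omega, Nat.sub_sub]
    ring

theorem add_sub_le_of_strictMono {N : ℕ} {c : ℕ → ℕ} (hc : ∀ i j, i < j → j ≤ N → c i < c j) :
    ∀ i j, i ≤ j → j ≤ N → c i + (j - i) ≤ c j := by
  intro i j hij hj
  induction j, hij using Nat.le_induction with
  | base => simp
  | succ j hij ih =>
    have := ih (by omega)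
    have := hc j (j + 1) (by omega) hj
    omega

/-- Raising entry n of a strictly increasing column would raise the two entries after it as well,
for an excess of at least 3. With excess at most 2 only the last two entries can move. -/
theorem strictMono_cases {n e : ℕ} {c : ℕ → ℕ} (hc : ∀ i j, i < j → j ≤ n + 2 → c i < c j)
    (he : e ≤ 2) (hsum : 2 * ∑ k ∈ Finset.range (n + 3), c k = (n + 2) * (n + 3) + 2 * e) :
    (∀ k ≤ n, c k = k) ∧ c (n + 1) + c (n + 2) = 2 * n + 3 + e ∧ n < c (n + 1) ∧
      c (n + 1) < c (n + 2) := by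
  have h1 := add_sub_le_of_strictMono hc
  have hge : ∀ k ≤ n + 2, k ≤ c k := fun k hk => by
    have := h1 0 k (Nat.zero_le _) hk
    omega
  have hG := Finset.sum_range_id_mul_two (n + 3)
  rw [show n + 3 - 1 = n + 2 by omega, Finset.sum_range_succ, Finset.sum_range_succ,
    Finset.sum_range_succ] at hG
  rw [Finset.sum_range_succ, Finset.sum_range_succ, Finset.sum_range_succ] at hsum
  have hle : ∑ k ∈ Finset.range n, k ≤ ∑ k ∈ Finset.range n, c k :=
    Finset.sum_le_sum fun k hk => hge k (by have := Finset.mem_range.1 hk; omega)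
  have hmul : (n + 2) * (n + 3) = (n + 3) * (n + 2) := mul_comm _ _
  have a0 := hge n (by omega)
  have a1 := hc n (n + 1) (by omega) (by omega)
  have a2 := hc (n + 1) (n + 2) (by omega) (by omega)
  have hn : c n = n := by omega
  have hk : ∀ k ≤ n, c k = k := fun k hk => by
    have b1 := hge k (by omega)
    have b2 := h1 k n hk (by omega)
    omega
  have heq : ∑ k ∈ Finset.range n, c k = ∑ k ∈ Finset.range n, k :=
    Finset.sum_congr rfl fun k hk' => hk k (Finset.mem_range.1 hk').le
  exact ⟨hk, by omega, by omega, a2⟩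

/-- The first columns of the tableaux spanning the second weight space. -/
def secondCol (N : ℕ) : Fin 5 → ℕ → ℕ :=
  ![id, id, fun k => if k = N then N + 1 else k, fun k => if k = N then N + 2 else k,
    fun k => if k + 1 < N then k else k + 1]

/-- The arms of the tableaux spanning the second weight space. -/
def secondArm : Fin 5 → ℕ → ℕ :=
  ![fun j => if j = 0 then 2 else 0, fun j => if j < 2 then 1 else 0,
    fun j => if j = 0 then 1 else 0, fun _ => 0, fun _ => 0]

theorem secondCol_le {N m : ℕ} (hm : N + 2 ≤ m) (i : Fin 5) : ∀ k ≤ N, secondCol N i k ≤ m := by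
  intro k hk
  fin_cases i <;> simp [secondCol] <;> (try split_ifs) <;> omega

theorem secondArm_le {m : ℕ} (hm : 2 ≤ m) (i : Fin 5) : ∀ j, secondArm i j ≤ m := by
  intro k
  fin_cases i <;> simp [secondArm] <;> (try split_ifs) <;> omega

variable {K : Type u} [Field K] {V : Type u} [AddCommGroup V] [Module K V] {m : ℕ}
  {b : Module.Basis (Fin (m + 1)) K V} {ρ : Representation K (SpecialLinearGroup (Fin 2) K) V}

theorem tab_eq_of_prod (b : Module.Basis (Fin (m + 1)) K V) {M N : ℕ} {c c' r r' : ℕ → ℕ}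
    (hc : ∀ k ≤ N, c k = c' k) (hcm : ∀ k ≤ N, c k ≤ m) (hr : ∀ j < M, r j ≤ m)
    (hr' : ∀ j < M, r' j ≤ m)
    (hF : ∀ F : ℕ → MvPolynomial (ℕ × Fin (m + 1)) K,
      ∏ j ∈ Finset.range M, F (r j) = ∏ j ∈ Finset.range M, F (r' j)) :
    tab b M N c r = tab b M N c' r' := by
  refine hookEval_lin_ext b fun a => ?_
  rw [hookEval_tab b a hcm hr, hookEval_tab b a (fun k hk => hc k hk ▸ hcm k hk) hr', hF (a 0)]
  congr 2
  ext1 i k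
  rw [Matrix.of_apply, Matrix.of_apply, hc k (by omega)]

theorem exists_strictMono_tab (b : Module.Basis (Fin (m + 1)) K V) (M : ℕ) {N : ℕ} {c : ℕ → ℕ}
    (r : ℕ → ℕ) (hc : ∀ k, c k ≤ m) (hinj : Set.InjOn c (Finset.range (N + 1))) :
    ∃ c' : ℕ → ℕ, (∀ k, c' k ≤ m) ∧ (∀ i j, i < j → j ≤ N → c' i < c' j) ∧
      ∑ k ∈ Finset.range (N + 1), c' k = ∑ k ∈ Finset.range (N + 1), c k ∧
      ∃ s : K, tab b M N c r = s • tab b M N c' r := by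
  let F : Fin (N + 1) → ℕ := fun k => c k
  have hF : Function.Injective F := fun k k' hk => Fin.ext
    (hinj (Finset.mem_coe.2 (Finset.mem_range.2 k.2)) (Finset.mem_coe.2 (Finset.mem_range.2 k'.2)) hk)
  let σ := Tuple.sort F
  have hmono : StrictMono (F ∘ σ) :=
    (Tuple.monotone_sort F).strictMono_of_injective (hF.comp σ.injective)
  let c' : ℕ → ℕ := fun k => if h : k < N + 1 then F (σ ⟨k, h⟩) else 0
  have hc' : ∀ k : Fin (N + 1), c' k = F (σ k) := fun k => dif_pos k.2
  refine ⟨c', fun k => ?_, fun i j hij hj => ?_, ?_, ((Equiv.Perm.sign σ⁻¹ : ℤ) : K), ?_⟩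
  · simp only [c']
    split_ifs
    · exact hc _
    · exact Nat.zero_le _
  · have := hmono (a := ⟨i, by omega⟩) (b := ⟨j, by omega⟩) hij
    rwa [Function.comp_apply, Function.comp_apply, ← hc', ← hc'] at this
  · rw [← Fin.sum_univ_eq_sum_range, ← Fin.sum_univ_eq_sum_range]
    simp only [hc']
    exact Equiv.sum_comp σ F
  · refine hookElt_perm b σ⁻¹ fun k => ?_
    rw [hc']
    simp [F]

/-- The entries exceed the minimal total by 2, shared between arm and column: an arm with sum 2 has
two shapes, sum 1 leaves one column, and sum 0 leaves two. -/
theorem tab_mem_span_second (b : Module.Basis (Fin (m + 1)) K V) {l n : ℕ} (hm : n + 4 ≤ m)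
    {c r : ℕ → ℕ} (hc : ∀ k, c k ≤ m) (hr : ∀ j, r j ≤ m)
    (hinj : Set.InjOn c (Finset.range (n + 3)))
    (hsum : 2 * (∑ k ∈ Finset.range (n + 3), c k + ∑ j ∈ Finset.range (l + 2), r j) =
      (n + 2) * (n + 3) + 4) :
    tab b (l + 2) (n + 2) c r ∈
      Submodule.span K (Set.range fun i => tab b (l + 2) (n + 2) (secondCol (n + 2) i)
        (secondArm i)) := by
  obtain ⟨c', hc', hmono, hsum', s, hs⟩ := exists_strictMono_tab b (l + 2) r hc hinj
  rw [hs]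
  refine Submodule.smul_mem _ _ ?_
  have hmin : (n + 2) * (n + 3) ≤ 2 * ∑ k ∈ Finset.range (n + 3), c k :=
    (entries_le_of_sum_le (N := n + 2) hinj).1
  replace hsum' : ∑ k ∈ Finset.range (n + 3), c' k = ∑ k ∈ Finset.range (n + 3), c k := hsum'
  rw [← hsum'] at hsum hmin
  set R := ∑ j ∈ Finset.range (l + 2), r j with hR
  obtain ⟨h1, h2, h3, h4⟩ := strictMono_cases (e := 2 - R) hmono (by omega) (by omega)
  have hcol : ∀ i : Fin 5, (∀ k ≤ n + 2, c' k = secondCol (n + 2) i k) →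
      (∀ F : ℕ → MvPolynomial (ℕ × Fin (m + 1)) K, ∏ j ∈ Finset.range (l + 2), F (r j) =
        ∏ j ∈ Finset.range (l + 2), F (secondArm i j)) →
      tab b (l + 2) (n + 2) c' r ∈ Submodule.span K (Set.range fun i =>
        tab b (l + 2) (n + 2) (secondCol (n + 2) i) (secondArm i)) := by
    intro i hi hF
    refine Submodule.subset_span ⟨i, ?_⟩
    exact (tab_eq_of_prod b hi (fun k _ => hc' k) (fun j _ => hr j)
      (fun j _ => secondArm_le (by omega) i j) hF).symm
  have hk : ∀ k ≤ n + 2, k ≤ n ∨ k = n + 1 ∨ k = n + 2 := fun k hk => by omega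
  have hR2 : R ≤ 2 := by omega
  have hprod0 : R = 0 → ∀ F : ℕ → MvPolynomial (ℕ × Fin (m + 1)) K,
      ∏ j ∈ Finset.range (l + 2), F (r j) = ∏ j ∈ Finset.range (l + 2), F 0 := by
    intro h0 F
    have := Finset.sum_eq_zero_iff.1 (hR ▸ h0)
    exact Finset.prod_congr rfl fun j hj => by rw [this j hj]
  interval_cases hRv : R
  · by_cases hlast : c' (n + 1) = n + 1
    · refine hcol 3 (fun k hk' => ?_) (hprod0 rfl)
      rcases hk k hk' with h | rfl | rfl
      · simp [secondCol, h1 k h]; omega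
      · simp [secondCol]; omega
      · simp [secondCol]; omega
    · refine hcol 4 (fun k hk' => ?_) (hprod0 rfl)
      rcases hk k hk' with h | rfl | rfl
      · simp [secondCol, h1 k h]; omega
      · simp [secondCol]; omega
      · simp [secondCol]; omega
  · refine hcol 2 (fun k hk' => ?_) fun F => ?_
    · rcases hk k hk' with h | rfl | rfl
      · simp [secondCol, h1 k h]; omega
      · simp [secondCol]; omega
      · simp [secondCol]; omega
    · rw [prod_of_sum_eq_one _ hR.symm, Finset.card_range]
      exact (prod_range_ite_eq_zero F (l + 1) 1).symm
  · have hid : ∀ k ≤ n + 2, c' k = k := fun k hk' => by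
      rcases hk k hk' with h | rfl | rfl
      · exact h1 k h
      · omega
      · omega
    rcases prod_of_sum_eq_two (MvPolynomial (ℕ × Fin (m + 1)) K) _ hR.symm with hF | hF
    · refine hcol 0 hid fun F => ?_
      rw [hF, Finset.card_range]
      exact (prod_range_ite_eq_zero F (l + 1) 2).symm
    · refine hcol 1 hid fun F => ?_
      rw [hF, Finset.card_range]
      exact (prod_range_ite_lt_two F l).symm

theorem exists_sum_eq_weightOp_two {l n : ℕ} (hm : n + 4 ≤ m) {L U : ℕ → ℕ → ℕ}
    (h : IsModel ρ b L U) {S : Finset Kˣ} {w : ℕ} (hS : HookNodes S w m (l + 2) (n + 2))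
    (x : Schur K (hook (l + 2) (n + 2)) V) : ∃ γ : Fin 5 → K,
      weightOp S w 2 (schurRep (hook (l + 2) (n + 2)) ρ) x =
        ∑ i, γ i • tab b (l + 2) (n + 2) (secondCol (n + 2) i) (secondArm i) := by
  have hle : (⊤ : Submodule K (Schur K (hook (l + 2) (n + 2)) V)) ≤
      (Submodule.span K (Set.range fun i => tab b (l + 2) (n + 2) (secondCol (n + 2) i)
        (secondArm i))).comap (weightOp S w 2 (schurRep (hook (l + 2) (n + 2)) ρ)) := by
    rw [← span_tab b, Submodule.span_le]
    rintro _ ⟨c, r, hc, hr, rfl⟩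
    rw [SetLike.mem_coe, Submodule.mem_comap]
    by_cases hinj : Set.InjOn c (Finset.range (n + 2 + 1))
    · rw [weightOp_tab h hS.weight hS.card_lt' 2 hc hr hinj]
      split_ifs with hs
      · exact tab_mem_span_second b hm hc hr hinj hs
      · exact Submodule.zero_mem _
    · rw [tab_eq_zero b hinj, map_zero]
      exact Submodule.zero_mem _
  obtain ⟨γ, hγ⟩ := (Submodule.mem_span_range_iff_exists_fun K).1 (hle (Submodule.mem_top (x := x)))
  exact ⟨γ, hγ.symm⟩

end SecondWeightSpace

/-! ### Tableaux read by coordinate functionals -/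

section KroneckerRows

open Matrix (SpecialLinearGroup)
open Polynomial

variable {K : Type u} [Field K] {m M N : ℕ} {Q : ℕ → ℕ → K[X]} {z c r : ℕ → ℕ}

theorem tabPoly_kron (hz : ∀ i ≤ N, z i ≤ m) :
    tabPoly m M N Q (fun i => kron K (z i)) c r =
      (Matrix.of fun i k : Fin (N + 1) => Q (c k) (z i)).det *
        ∏ j ∈ Finset.range M, Q (r j) (z 0) := by
  rw [tabPoly]
  congr 1
  · congr 1
    ext1 i k
    rw [Matrix.of_apply, Matrix.of_apply, rowPoly_kron_self _ (hz i (by omega))]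
  · exact Finset.prod_congr rfl fun j _ => by rw [rowPoly_kron_self _ (hz 0 (Nat.zero_le _))]

theorem tabPoly_kron_of_row (hz : ∀ i ≤ N, z i ≤ m) {i : ℕ} (hi : i ≤ N)
    (h : ∀ k ≤ N, Q (c k) (z i) = 0) : tabPoly m M N Q (fun i => kron K (z i)) c r = 0 := by
  rw [tabPoly_kron hz, Matrix.det_eq_zero_of_row_eq_zero ⟨i, Nat.lt_succ_of_le hi⟩, zero_mul]
  intro k
  exact h k (by omega)

theorem tabPoly_kron_of_arm (hz : ∀ i ≤ N, z i ≤ m) {j : ℕ} (hj : j < M)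
    (h : Q (r j) (z 0) = 0) : tabPoly m M N Q (fun i => kron K (z i)) c r = 0 := by
  rw [tabPoly_kron hz, Finset.prod_eq_zero (Finset.mem_range.2 hj) h, mul_zero]

theorem tabPoly_kron_of_lower (hz : ∀ i ≤ N, z i ≤ m)
    (h : ∀ i k, i < k → k ≤ N → Q (c k) (z i) = 0) :
    tabPoly m M N Q (fun i => kron K (z i)) c r =
      (∏ i ∈ Finset.range (N + 1), Q (c i) (z i)) * ∏ j ∈ Finset.range M, Q (r j) (z 0) := by
  rw [tabPoly_kron hz, Matrix.det_of_isLowerTriangular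
    (M := Matrix.of fun i k : Fin (N + 1) => Q (c k) (z i)),
    ← Fin.prod_univ_eq_prod_range fun i => Q (c i) (z i)]
  · rfl
  · intro i k hik
    exact h i k hik (by omega)

theorem tabPoly_kron_of_upper (hz : ∀ i ≤ N, z i ≤ m)
    (h : ∀ i k, k < i → i ≤ N → Q (c k) (z i) = 0) :
    tabPoly m M N Q (fun i => kron K (z i)) c r =
      (∏ i ∈ Finset.range (N + 1), Q (c i) (z i)) * ∏ j ∈ Finset.range M, Q (r j) (z 0) := by
  rw [tabPoly_kron hz, ← Matrix.det_transpose, Matrix.det_of_isLowerTriangular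
    (M := (Matrix.of fun i k : Fin (N + 1) => Q (c k) (z i)).transpose),
    ← Fin.prod_univ_eq_prod_range fun i => Q (c i) (z i)]
  · rfl
  · intro i k hik
    exact h k i hik (by omega)

theorem upperCoeff_self (i : ℕ) : upperCoeff K i i = 1 := by simp [upperCoeff]

theorem upperCoeff_eq_zero {i j : ℕ} (h : i < j) : upperCoeff K i j = 0 := by
  rw [upperCoeff, Nat.choose_eq_zero_of_lt h]
  simp

theorem upperCoeff_eq_zero_of_cast {i j : ℕ} (h : ((i.choose j : ℕ) : K) = 0) :
    upperCoeff K i j = 0 := by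
  rw [upperCoeff, h]
  simp

theorem upperCoeff_zero_right (i : ℕ) : upperCoeff K i 0 = X ^ i := by simp [upperCoeff]

theorem lowerCoeff_self (i : ℕ) : lowerCoeff K m i i = 1 := by simp [lowerCoeff]

theorem lowerCoeff_eq_zero {i j : ℕ} (hi : i ≤ m) (h : j < i) : lowerCoeff K m i j = 0 := by
  rw [lowerCoeff, Nat.choose_eq_zero_of_lt (by omega)]
  simp

theorem lowerCoeff_succ {i : ℕ} (hi : i < m) : lowerCoeff K m i (i + 1) = C ((m - i : ℕ) : K) * X := by
  obtain ⟨j, rfl⟩ := Nat.exists_eq_add_of_lt hi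
  rw [lowerCoeff, show i + j + 1 - i = j + 1 by omega, show i + j + 1 - (i + 1) = j by omega,
    Nat.choose_succ_self_right]
  simp

end KroneckerRows

/-! ### Relations from upper unitriangular invariance and from degree 1 -/

section SecondColumn

open Polynomial

variable {K : Type u} [Field K] {m l n : ℕ}

theorem prod_range_add_three {R : Type*} [CommRing R] (F : ℕ → R) (h : ∀ i ≤ n, F i = 1) :
    ∏ i ∈ Finset.range (n + 3), F i = F (n + 1) * F (n + 2) := by
  rw [Finset.prod_range_succ, Finset.prod_range_succ, Finset.prod_range_succ,
    Finset.prod_eq_one fun i hi => h i (Finset.mem_range.1 hi).le, h n le_rfl]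
  ring

/-- With N = n + 2, coordinate N + 1 is read in place of N. Tableaux 0 and 1 have no entry large
enough, 3 and 4 vanish by parity, and the arm entry 1 of tableau 2 gives t. Invariance will force γ
2 = 0. -/
theorem tabPoly_upperCoeff_shift (hm : n + 4 ≤ m) (hN : ((n + 2 : ℕ) : K) = 0)
    (h2 : ((2 : ℕ) : K) = 0) (hc : (((n + 3).choose (n + 1) : ℕ) : K) = 0) (γ : Fin 5 → K) :
    ∑ i, C (γ i) * tabPoly m (l + 2) (n + 2) (upperCoeff K)
      (fun i => kron K (if i = n + 2 then n + 3 else i)) (secondCol (n + 2) i) (secondArm i) =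
      C (γ 2) * X := by
  have hz : ∀ i ≤ n + 2, (if i = n + 2 then n + 3 else i) ≤ m := fun i hi => by
    split_ifs <;> omega
  rw [Fin.sum_univ_five, tabPoly_kron_of_row hz le_rfl, tabPoly_kron_of_row hz le_rfl,
    tabPoly_kron_of_upper hz, tabPoly_kron_of_row hz le_rfl,
    tabPoly_kron_of_row hz (show n + 1 ≤ n + 2 by omega)]
  · rw [prod_range_add_three, if_neg (by omega : 0 ≠ n + 2),
      show secondArm 2 = fun j => if j = 0 then 1 else 0 from rfl,
      prod_range_ite_eq_zero (fun j => upperCoeff K j 0) (l + 1) 1]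
    · simp [secondCol, upperCoeff_self, upperCoeff_zero_right]
    · intro i hi
      simp [secondCol, show i ≠ n + 2 by omega, upperCoeff_self]
  · intro k hk
    rw [if_neg (by omega)]
    simp only [secondCol, Matrix.cons_val]
    split_ifs with h
    · exact upperCoeff_eq_zero (by omega)
    · obtain rfl | rfl : k = n + 1 ∨ k = n + 2 := by omega
      · refine upperCoeff_eq_zero_of_cast ?_
        rw [Nat.choose_succ_self_right, ← hN]
      · exact upperCoeff_eq_zero_of_cast hc
  · intro k hk
    rw [if_pos rfl]
    simp only [secondCol, Matrix.cons_val]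
    split_ifs with h
    · refine upperCoeff_eq_zero_of_cast ?_
      rw [Nat.choose_succ_self_right, show n + 2 + 1 + 1 = n + 2 + 2 from rfl, Nat.cast_add (n + 2),
        hN, h2, add_zero]
    · exact upperCoeff_eq_zero (by omega)
  · intro i k hki hi
    simp only [secondCol, Matrix.cons_val]
    split_ifs <;> exact upperCoeff_eq_zero (by omega)
  · intro k hk
    rw [if_pos rfl]
    exact upperCoeff_eq_zero (show k < n + 3 by omega)
  · intro k hk
    rw [if_pos rfl]
    exact upperCoeff_eq_zero (show k < n + 3 by omega)

/-- Reading 0, …, N, tableaux 0 and 1 contribute t^2 through the arm and tableau 3 through its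
column entry N + 2; tableau 4 vanishes by parity. -/
theorem tabPoly_upperCoeff_id (hm : n + 4 ≤ m) (hN : ((n + 2 : ℕ) : K) = 0)
    (hc : (((n + 3).choose (n + 1) : ℕ) : K) = 0) (hc' : (((n + 4).choose (n + 2) : ℕ) : K) = 1)
    {γ : Fin 5 → K} (h2 : γ 2 = 0) :
    ∑ i, C (γ i) * tabPoly m (l + 2) (n + 2) (upperCoeff K)
      (fun i => kron K i) (secondCol (n + 2) i) (secondArm i) =
      C (γ 0 + γ 1 + γ 3) * X ^ 2 := by
  have hz : ∀ i ≤ n + 2, i ≤ m := fun i hi => by omega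
  rw [Fin.sum_univ_five, h2, C_0, zero_mul, tabPoly_kron_of_upper (z := fun i => i) hz,
    tabPoly_kron_of_upper (z := fun i => i) hz, tabPoly_kron_of_upper (z := fun i => i) hz,
    tabPoly_kron_of_row (z := fun i => i) hz (show n + 1 ≤ n + 2 by omega)]
  · rw [prod_range_add_three, prod_range_add_three, prod_range_add_three]
    · rw [show secondArm 0 = fun j => if j = 0 then 2 else 0 from rfl,
        show secondArm 1 = fun j => if j < 2 then 1 else 0 from rfl,
        show secondArm 3 = fun _ => 0 from rfl,
        prod_range_ite_eq_zero (fun j => upperCoeff K j 0) (l + 1) 2,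
        prod_range_ite_lt_two (fun j => upperCoeff K j 0) l]
      simp only [secondCol, Matrix.cons_val, id, upperCoeff_self, upperCoeff_zero_right]
      rw [if_neg (by omega), if_true, upperCoeff_self, show n + 2 + 2 = n + 4 from rfl, upperCoeff, hc']
      simp
      ring
    · intro i hi
      simp [secondCol, show i ≠ n + 2 by omega, upperCoeff_self]
    · intro i hi
      simp [secondCol, upperCoeff_self]
    · intro i hi
      simp [secondCol, upperCoeff_self]
  · intro k hk
    simp only [secondCol, Matrix.cons_val]
    split_ifs with h
    · exact upperCoeff_eq_zero (by omega)
    · obtain rfl | rfl : k = n + 1 ∨ k = n + 2 := by omega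
      · refine upperCoeff_eq_zero_of_cast ?_
        rw [Nat.choose_succ_self_right, ← hN]
      · exact upperCoeff_eq_zero_of_cast hc
  · intro i k hki hi
    simp only [secondCol, Matrix.cons_val]
    rw [if_neg (by omega)]
    exact upperCoeff_eq_zero hki
  · intro i k hki hi
    exact upperCoeff_eq_zero hki
  · intro i k hki hi
    exact upperCoeff_eq_zero hki

/-- The last two rows read the coordinates N and N + 2, a single step above the columns of tableaux
3 and 4. A nonzero arm entry cannot be lowered to 0, which removes the other three. -/
theorem tabPoly_lowerCoeff_shift (hm : n + 4 ≤ m) (hc : ((m - (n + 1) : ℕ) : K) = 1)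
    (hc' : ((m - (n + 3) : ℕ) : K) = 1) (γ : Fin 5 → K) :
    ∑ i, C (γ i) * tabPoly m (l + 2) (n + 2) (lowerCoeff K m)
      (fun i => kron K (if i = n + 2 then n + 4 else if i = n + 1 then n + 2 else i))
      (secondCol (n + 2) i) (secondArm i) = C (γ 3 + γ 4) * X := by
  have hz : ∀ i ≤ n + 2, (if i = n + 2 then n + 4 else if i = n + 1 then n + 2 else i) ≤ m :=
    fun i hi => by split_ifs <;> omega
  have h0 : (if 0 = n + 2 then n + 4 else if 0 = n + 1 then n + 2 else 0) = 0 := by simp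
  rw [Fin.sum_univ_five, tabPoly_kron_of_arm hz (show 0 < l + 2 by omega),
    tabPoly_kron_of_arm hz (show 0 < l + 2 by omega),
    tabPoly_kron_of_arm hz (show 0 < l + 2 by omega), tabPoly_kron_of_lower hz,
    tabPoly_kron_of_lower hz]
  · rw [prod_range_add_three, prod_range_add_three]
    · rw [h0]
      simp only [secondCol, secondArm, Matrix.cons_val, lowerCoeff_self, Finset.prod_const_one]
      rw [if_neg (show n + 1 ≠ n + 2 by omega), if_neg (show n + 1 ≠ n + 2 by omega)]
      simp only [if_true]
      rw [if_neg (by omega), if_neg (by omega)]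
      rw [lowerCoeff_succ (by omega), hc, lowerCoeff_succ (by omega), hc',
        show n + 1 + 1 = n + 2 from rfl, lowerCoeff_self, lowerCoeff_self]
      simp
      ring
    · intro i hi
      simp [secondCol, show i ≠ n + 2 by omega, show i ≠ n + 1 by omega, hi,
        lowerCoeff_self]
    · intro i hi
      simp [secondCol, show i ≠ n + 2 by omega, show i ≠ n + 1 by omega, lowerCoeff_self]
  · intro i k hik hk
    simp only [secondCol, Matrix.cons_val]
    refine lowerCoeff_eq_zero ?_ ?_ <;> split_ifs <;> omega
  · intro i k hik hk
    simp only [secondCol, Matrix.cons_val]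
    refine lowerCoeff_eq_zero ?_ ?_ <;> split_ifs <;> omega
  all_goals
    rw [h0]
    exact lowerCoeff_eq_zero (by simp only [secondArm, Matrix.cons_val]; simp; try omega)
      (by simp [secondArm])

end SecondColumn

/-! ### Relations from degree 2M - 2, with a perturbed row 0 -/

section PerturbedRows

open Matrix (SpecialLinearGroup)
open Polynomial

/-- The coordinate functionals, with the functional of index `z` added to the first of them. -/
def perturbedKron (K : Type*) [CommRing K] (z i j : ℕ) : K :=
  kron K i j + if i = 0 ∧ j = z then 1 else 0

variable {K : Type u} [Field K] {N z : ℕ}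

theorem perturbedKron_eq_zero (hz : z ≤ N) {i j : ℕ} (hi : i ≤ N) (hj : N < j) :
    perturbedKron K z i j = 0 := by
  rw [perturbedKron, kron, if_neg (by omega), if_neg (by omega), add_zero]

theorem foldDet_perturbedKron {q : ℕ} (hq : N < q) (h0 : 0 < z) (hz : z ≤ N) :
    foldDet N q (perturbedKron K z) = 1 := by
  rw [foldDet, ← Matrix.det_transpose]
  refine det_eq_one_of_unitriangular _ (fun l i hli => ?_) fun i => ?_
  · have : (l : ℕ) < i := hli
    rw [Matrix.transpose_apply, Matrix.of_apply,
      perturbedKron_eq_zero hz (j := l + q) (by omega) (by omega), perturbedKron, kron, if_neg (by omega), if_neg (by omega)]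
    simp
  · rw [Matrix.transpose_apply, Matrix.of_apply,
      perturbedKron_eq_zero hz (j := i + q) (by omega) (by omega), perturbedKron, kron, if_pos rfl, if_neg (by omega)]
    simp

theorem tabPoly_perturbedKron_eq_zero {m M : ℕ} (hz : z ≤ N) {c r : ℕ → ℕ} (hc : N < c N)
    (hcm : c N ≤ m) : tabPoly m M N (lowerCoeff K m) (perturbedKron K z) c r = 0 := by
  rw [tabPoly, Matrix.det_eq_zero_of_column_eq_zero (Fin.last N), zero_mul]
  intro i
  rw [Matrix.of_apply, Fin.val_last]
  refine Finset.sum_eq_zero fun j _ => ?_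
  by_cases hj : j < c N
  · rw [lowerCoeff_eq_zero hcm hj, Polynomial.map_zero, mul_zero]
  · rw [perturbedKron_eq_zero hz (by omega) (by omega), C_0, zero_mul]

variable [CharP K 2] {e : ℕ}

theorem coeff_rowPoly_perturbedKron (hN : N < 2 ^ e) (hz : z ≤ N) {k : ℕ} (hk : k ≤ N) (i : ℕ) :
    (rowPoly (2 ^ e + N) (lowerCoeff K (2 ^ e + N)) (perturbedKron K z 0) k).coeff i =
      perturbedKron K z 0 (i + k) * ((N - k).choose i : ℕ) := by
  have h : binomPoly (N - k) (fun i => perturbedKron K z 0 (i + k + 2 ^ e)) = 0 := by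
    ext j
    rw [coeff_binomPoly, perturbedKron_eq_zero hz (Nat.zero_le _) (by omega), zero_mul, coeff_zero]
  rw [rowPoly_lowerCoeff_eq_binomPoly 2 e hN _ hk, h, mul_zero, add_zero, coeff_binomPoly]

theorem rowPoly_perturbedKron_pos (hN : N < 2 ^ e) (hz : z ≤ N) {k : ℕ} (hk : k ≤ z) (h0 : 0 < k) :
    rowPoly (2 ^ e + N) (lowerCoeff K (2 ^ e + N)) (perturbedKron K z 0) k =
      C (((N - k).choose (z - k) : ℕ) : K) * X ^ (z - k) := by
  ext i
  rw [coeff_rowPoly_perturbedKron hN hz (hk.trans hz), coeff_C_mul_X_pow, perturbedKron, kron,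
    if_neg (by omega)]
  by_cases h : i = z - k
  · rw [if_pos h, if_pos (by omega), h]
    ring
  · rw [if_neg h, if_neg (by omega)]
    ring

variable {l : ℕ}

/-- Row 0 reads coordinates 0 and M = l + 2. The two arm entries 1 of tableau 1 give (t^(M-1))^2,
while the entry 2 of tableau 0 gives only degree M - 2. Tableaux 3 and 4 vanish since their last
column entry exceeds N and cannot be lowered. -/
theorem coeff_tabPoly_perturbedKron (hN : N < 2 ^ e) (hMN : 2 * (l + 2) ≤ N)
    (hb0 : ((N.choose (l + 2) : ℕ) : K) = 0) (hb1 : (((N - 1).choose (l + 1) : ℕ) : K) = 1)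
    {γ : Fin 5 → K} (h2 : γ 2 = 0) :
    ∑ i, γ i * (tabPoly (2 ^ e + N) (l + 2) N (lowerCoeff K (2 ^ e + N))
      (perturbedKron K (l + 2)) (secondCol N i) (secondArm i)).coeff (2 * (l + 2) - 2) = γ 1 := by
  have h0 : rowPoly (2 ^ e + N) (lowerCoeff K (2 ^ e + N)) (perturbedKron K (l + 2) 0) 0 = 1 := by
    ext i
    rw [coeff_rowPoly_perturbedKron hN (by omega) (Nat.zero_le _), coeff_one, perturbedKron, kron]
    by_cases hi0 : i = 0
    · simp [hi0]
    · rw [if_neg (by omega), if_neg hi0]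
      by_cases hi : i = l + 2
      · rw [hi, Nat.sub_zero, hb0, mul_zero]
      · rw [if_neg (by omega), add_zero, zero_mul]
  rw [Fin.sum_univ_five, h2, tabPoly_perturbedKron_eq_zero (c := secondCol N 3) (by omega)
    (by simp [secondCol]) (secondCol_le (by omega) 3 N le_rfl),
    tabPoly_perturbedKron_eq_zero (c := secondCol N 4) (by omega)
    (by simp [secondCol]) (secondCol_le (by omega) 4 N le_rfl)]
  have e0 : tabPoly (2 ^ e + N) (l + 2) N (lowerCoeff K (2 ^ e + N)) (perturbedKron K (l + 2))
      (secondCol N 0) (secondArm 0) =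
      C (((N - 2).choose (l + 2 - 2) : ℕ) : K) * X ^ (l + 2 - 2) := by
    refine (tabPoly_lowerCoeff_id 2 e hN (l + 2) _ _).trans ?_
    rw [foldDet_perturbedKron hN (by omega) (by omega), map_one, one_mul]
    refine (prod_range_ite_eq_zero (rowPoly (2 ^ e + N) (lowerCoeff K (2 ^ e + N))
      (perturbedKron K (l + 2) 0)) (l + 1) 2).trans ?_
    rw [h0, one_pow, one_mul, rowPoly_perturbedKron_pos hN (by omega) (by omega) (by omega)]
  have e1 : tabPoly (2 ^ e + N) (l + 2) N (lowerCoeff K (2 ^ e + N)) (perturbedKron K (l + 2))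
      (secondCol N 1) (secondArm 1) = X ^ (2 * (l + 2) - 2) := by
    refine (tabPoly_lowerCoeff_id 2 e hN (l + 2) _ _).trans ?_
    rw [foldDet_perturbedKron hN (by omega) (by omega), map_one, one_mul]
    refine (prod_range_ite_lt_two (rowPoly (2 ^ e + N) (lowerCoeff K (2 ^ e + N))
      (perturbedKron K (l + 2) 0)) l).trans ?_
    rw [h0, one_pow, one_mul, rowPoly_perturbedKron_pos hN (by omega) (by omega) (by omega),
      show l + 2 - 1 = l + 1 by omega, hb1, C_1, one_mul, ← pow_mul]
    congr 1
    omega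
  rw [e0, e1, coeff_C_mul_X_pow, if_neg (by omega), coeff_X_pow, if_pos rfl]
  simp

/-- Reading coordinate 2M instead, which needs 2M ≤ N, the arm entry 2 of tableau 0 gives t^(2M-2),
and the remaining arm factors contribute their constant term 1. -/
theorem coeff_tabPoly_perturbedKron_two_mul (hN : N < 2 ^ e) (hMN : 2 * (l + 2) ≤ N)
    (hb2 : (((N - 2).choose (2 * (l + 2) - 2) : ℕ) : K) = 1)
    {γ : Fin 5 → K} (h1 : γ 1 = 0) (h2 : γ 2 = 0) :
    ∑ i, γ i * (tabPoly (2 ^ e + N) (l + 2) N (lowerCoeff K (2 ^ e + N))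
      (perturbedKron K (2 * (l + 2))) (secondCol N i) (secondArm i)).coeff (2 * (l + 2) - 2) =
      γ 0 := by
  rw [Fin.sum_univ_five, h1, h2, tabPoly_perturbedKron_eq_zero (c := secondCol N 3) (by omega)
    (by simp [secondCol]) (secondCol_le (by omega) 3 N le_rfl),
    tabPoly_perturbedKron_eq_zero (c := secondCol N 4) (by omega)
    (by simp [secondCol]) (secondCol_le (by omega) 4 N le_rfl)]
  have e0 : tabPoly (2 ^ e + N) (l + 2) N (lowerCoeff K (2 ^ e + N))
      (perturbedKron K (2 * (l + 2))) (secondCol N 0) (secondArm 0) =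
      rowPoly (2 ^ e + N) (lowerCoeff K (2 ^ e + N)) (perturbedKron K (2 * (l + 2)) 0) 0 ^ (l + 1) *
        X ^ (2 * (l + 2) - 2) := by
    refine (tabPoly_lowerCoeff_id 2 e hN (l + 2) _ _).trans ?_
    rw [foldDet_perturbedKron hN (by omega) (by omega), map_one, one_mul]
    refine (prod_range_ite_eq_zero (rowPoly (2 ^ e + N) (lowerCoeff K (2 ^ e + N))
      (perturbedKron K (2 * (l + 2)) 0)) (l + 1) 2).trans ?_
    rw [rowPoly_perturbedKron_pos hN (by omega) (show 2 ≤ 2 * (l + 2) by omega) (by omega), hb2,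
      C_1, one_mul]
  rw [e0, coeff_mul_X_pow', if_pos le_rfl, Nat.sub_self, coeff_zero_eq_eval_zero, eval_pow,
    ← coeff_zero_eq_eval_zero, coeff_rowPoly_perturbedKron hN hMN (Nat.zero_le _)]
  simp [perturbedKron, kron]

end PerturbedRows

/-! ### Characteristic 2: no such invariant for the swapped hook -/

section NoInvariant

open Matrix (SpecialLinearGroup)
open Polynomial

variable {K : Type u} [Field K] [CharP K 2] {V : Type u} [AddCommGroup V] [Module K V]
  {ρ : Representation K (SpecialLinearGroup (Fin 2) K) V} {S : Finset Kˣ} {w e : ℕ}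

theorem IsUpperModel.not_hasInvariant_of_choose {M N : ℕ}
    {b : Module.Basis (Fin (2 ^ e + N + 1)) K V} (h : IsUpperModel ρ b) (hM : 2 ≤ M)
    (hMN : 2 * M ≤ N) (hNe : N < 2 ^ e) (hS : HookNodes S w (2 ^ e + N) M N)
    (hN0 : (N : K) = 0) (hc : (((N + 1).choose 2 : ℕ) : K) = 0)
    (hc' : (((N + 2).choose 2 : ℕ) : K) = 1) (hb0 : ((N.choose M : ℕ) : K) = 0)
    (hb1 : (((N - 1).choose (M - 1) : ℕ) : K) = 1)
    (hb2 : (((N - 2).choose (2 * M - 2) : ℕ) : K) = 1) :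
    ¬ HasInvariant S w (2 * M - 2) (schurRep (hook M N) ρ) := by
  obtain ⟨l, rfl⟩ := Nat.exists_eq_add_of_le' hM
  obtain ⟨n, rfl⟩ := Nat.exists_eq_add_of_le' (show 2 ≤ N by omega)
  have he : e ≠ 0 := by
    rintro rfl
    omega
  have hm : n + 4 ≤ 2 ^ e + (n + 2) := by omega
  have hq : ((2 ^ e : ℕ) : K) = 0 := by
    rw [CharP.cast_eq_zero_iff K 2]
    exact dvd_pow_self 2 he
  rintro ⟨x, hx0, hw, hup, hd1, hd⟩
  obtain ⟨γ, hγ⟩ := exists_sum_eq_weightOp_two hm h hS x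
  rw [hw] at hγ
  have heval : ∀ (a : ℕ → ℕ → K) (t : K),
      hookEval (l + 2) (n + 2) (fun i => lin b (a i))
        (schurRep (hook (l + 2) (n + 2)) ρ (upperUni t) x) =
      (∑ i, C (γ i) * tabPoly (2 ^ e + (n + 2)) (l + 2) (n + 2) (upperCoeff K) a
        (secondCol (n + 2) i) (secondArm i)).eval t := by
    intro a t
    rw [hγ, map_sum, map_sum, eval_finsetSum]
    refine Finset.sum_congr rfl fun i _ => ?_
    rw [map_smul, map_smul, h.hookEval_upperUni a (secondCol_le hm i)
      (fun j _ => secondArm_le (by omega) i j), eval_mul, eval_C, smul_eq_mul,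
      Algebra.algebraMap_self, RingHom.id_apply]
  -- Invariance makes each evaluation independent of t. Comparing t = 1 with t = 0 is enough,
  -- because the polynomials used below are monomials of positive degree.
  have hfix : ∀ (a : ℕ → ℕ → K) (t : K),
      (∑ i, C (γ i) * tabPoly (2 ^ e + (n + 2)) (l + 2) (n + 2) (upperCoeff K) a
        (secondCol (n + 2) i) (secondArm i)).eval t =
      (∑ i, C (γ i) * tabPoly (2 ^ e + (n + 2)) (l + 2) (n + 2) (upperCoeff K) a
        (secondCol (n + 2) i) (secondArm i)).eval 0 := by
    intro a t
    rw [← heval, ← heval, hup, hup]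
  have hcoeff : ∀ d, unipOp S d (schurRep (hook (l + 2) (n + 2)) ρ) x = 0 → ∀ a : ℕ → ℕ → K,
      ∑ i, γ i * (tabPoly (2 ^ e + (n + 2)) (l + 2) (n + 2) (lowerCoeff K (2 ^ e + (n + 2))) a
        (secondCol (n + 2) i) (secondArm i)).coeff d = 0 := by
    intro d h0 a
    have := congrArg (hookEval (l + 2) (n + 2) fun i => lin b (a i)) h0
    rw [hγ, map_sum, map_sum, map_zero] at this
    rw [← this]
    refine Finset.sum_congr rfl fun i _ => ?_
    rw [map_smul, map_smul, h.hookEval_unipOp hS d a (secondCol_le hm i)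
      (fun j _ => secondArm_le (by omega) i j), smul_eq_mul]
  have hc1 : (((n + 3).choose (n + 1) : ℕ) : K) = 0 := by
    rwa [Nat.choose_symm_of_eq_add (show n + 3 = n + 1 + 2 by omega)]
  have hc2 : (((n + 4).choose (n + 2) : ℕ) : K) = 1 := by
    rwa [Nat.choose_symm_of_eq_add (show n + 4 = n + 2 + 2 by omega)]
  have g2 : γ 2 = 0 := by
    have := hfix (fun i => kron K (if i = n + 2 then n + 3 else i)) 1
    rw [tabPoly_upperCoeff_shift hm hN0 (by exact_mod_cast CharTwo.two_eq_zero) hc1] at this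
    simpa using this
  have g013 : γ 0 + γ 1 + γ 3 = 0 := by
    have := hfix (fun i => kron K i) 1
    rw [tabPoly_upperCoeff_id hm hN0 hc1 hc2 g2] at this
    simpa using this
  have g34 : γ 3 + γ 4 = 0 := by
    have := hcoeff 1 hd1 fun i => kron K (if i = n + 2 then n + 4 else if i = n + 1 then n + 2 else i)
    simp only [← coeff_C_mul, ← finsetSum_coeff] at this
    rw [tabPoly_lowerCoeff_shift hm] at this
    · simpa using this
    · rw [show 2 ^ e + (n + 2) - (n + 1) = 2 ^ e + 1 by omega, Nat.cast_add, hq, zero_add,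
        Nat.cast_one]
    · rw [show 2 ^ e + (n + 2) - (n + 3) = 2 ^ e - 1 by omega, Nat.cast_sub Nat.one_le_two_pow, hq,
        Nat.cast_one, zero_sub, CharTwo.neg_eq]
  have g1 : γ 1 = 0 := by
    rw [← coeff_tabPoly_perturbedKron hNe hMN hb0 hb1 g2]
    exact hcoeff _ hd _
  have g0 : γ 0 = 0 := by
    rw [← coeff_tabPoly_perturbedKron_two_mul hNe hMN hb2 g1 g2]
    exact hcoeff _ hd _
  have g3 : γ 3 = 0 := by simpa [g0, g1] using g013
  have g4 : γ 4 = 0 := by simpa [g3] using g34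
  refine hx0 ?_
  rw [hγ, Fin.sum_univ_five, g0, g1, g2, g3, g4]
  simp

/-- The inner entries of row 2^f of Pascal's triangle are even, so neighbouring entries of the row
before it agree modulo 2. -/
theorem choose_two_pow_sub_one (f : ℕ) {k : ℕ} (hk : k < 2 ^ f) :
    (((2 ^ f - 1).choose k : ℕ) : K) = 1 := by
  induction k with
  | zero => simp
  | succ k ih =>
    have h1 : (((2 ^ f).choose (k + 1) : ℕ) : K) = 0 := by
      rw [CharP.cast_eq_zero_iff K 2]
      exact Nat.prime_two.dvd_choose_pow (by omega) (by omega)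
    rw [show 2 ^ f = 2 ^ f - 1 + 1 by omega, Nat.choose_succ_succ, Nat.cast_add, ih (by omega)] at h1
    rw [← sub_eq_zero, CharTwo.sub_eq_add, add_comm, h1]

/-- Neighbouring entries of row 2^f - 2 add up to an odd entry of the next row, so the row
alternates 1, 0, 1, … modulo 2. -/
theorem choose_two_pow_sub_two (f : ℕ) {k : ℕ} (hk : 2 * k + 2 ≤ 2 ^ f) :
    (((2 ^ f - 2).choose (2 * k) : ℕ) : K) = 1 := by
  have h1 : ∀ j, j + 1 < 2 ^ f → (((2 ^ f - 2).choose (j + 1) : ℕ) : K) =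
      1 + ((2 ^ f - 2).choose j : ℕ) := by
    intro j hj
    have := choose_two_pow_sub_one (K := K) f hj
    rw [show 2 ^ f - 1 = 2 ^ f - 2 + 1 by omega, Nat.choose_succ_succ, Nat.cast_add] at this
    rw [← this, add_right_comm, CharTwo.add_self_eq_zero, zero_add]
  induction k with
  | zero => simp
  | succ k ih =>
    rw [show 2 * (k + 1) = 2 * k + 1 + 1 by ring, h1 _ (by omega), h1 _ (by omega),
      ih (by omega), CharTwo.add_self_eq_zero, add_zero]

theorem IsUpperModel.not_hasInvariant {f g : ℕ} {b : Module.Basis (Fin (2 ^ e + 2 ^ f + 1)) K V}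
    (h : IsUpperModel ρ b) (hg : 0 < g) (hgf : g < f) (hfe : f < e)
    (hS : HookNodes S w (2 ^ e + 2 ^ f) (2 ^ g) (2 ^ f)) :
    ¬ HasInvariant S w (2 * 2 ^ g - 2) (schurRep (hook (2 ^ g) (2 ^ f)) ρ) := by
  have hg2 : 2 ≤ 2 ^ g := Nat.le_self_pow hg.ne' 2
  have hgf2 : 2 * 2 ^ g ≤ 2 ^ f := by
    calc 2 * 2 ^ g = 2 ^ (g + 1) := by ring
      _ ≤ 2 ^ f := Nat.pow_le_pow_right (by norm_num) hgf
  refine h.not_hasInvariant_of_choose hg2 hgf2 (Nat.pow_lt_pow_right one_lt_two hfe) hS ?_ ?_ ?_ ?_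
    (choose_two_pow_sub_one f (by omega)) ?_
  · rw [CharP.cast_eq_zero_iff K 2]
    exact dvd_pow_self 2 (by omega)
  · rw [choose_char_pow_add K 2 f, if_neg (by omega)]
    simp
  · rw [choose_char_pow_add K 2 f, if_neg (by omega)]
    simp
  · rw [CharP.cast_eq_zero_iff K 2]
    exact Nat.prime_two.dvd_choose_pow (by omega) (Nat.pow_lt_pow_right one_lt_two hgf).ne
  · rw [show 2 * 2 ^ g - 2 = 2 * (2 ^ g - 1) by omega]
    exact choose_two_pow_sub_two f (by omega)

end NoInvariant

/-! ### Non-isomorphism of pairs -/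

section Separation

open Matrix (SpecialLinearGroup)

variable {K : Type u} [Field K] {p : ℕ} [Fact p.Prime] [CharP K p]
  {V : Type u} [AddCommGroup V] [Module K V] {V' : Type u} [AddCommGroup V'] [Module K V']
  {ρ : Representation K (SpecialLinearGroup (Fin 2) K) V}
  {ρ' : Representation K (SpecialLinearGroup (Fin 2) K) V'} {S : Finset Kˣ} {w e f g f' g' : ℕ}
  {b : Module.Basis (Fin (p ^ e + p ^ f + 1)) K V} {b' : Module.Basis (Fin (p ^ e + p ^ f' + 1)) K V'}

theorem IsUpperModel.not_isoRep_dual (h : IsUpperModel ρ b) (h' : IsLowerModel ρ' b')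
    (hS : HookNodes S w (p ^ e + p ^ f) (p ^ g) (p ^ f))
    (hS' : HookNodes S w (p ^ e + p ^ f') (p ^ g') (p ^ f')) (hf : f < e) (hf' : f' < e)
    (hfg : f' < f + g) :
    ¬ IsoRep (schurRep (hook (p ^ g) (p ^ f)) ρ) (schurRep (hook (p ^ g') (p ^ f')) ρ').dual := by
  intro hiso
  have hp := (Fact.out : p.Prime)
  refine h.not_movesHighest g hf hS (d := p ^ f') (pow_pos hp.pos _)
    (Nat.pow_lt_pow_right hp.one_lt hf') ?_
    ((hiso.movesHighest_iff S w _).2 (h'.movesHighest_dual g' hf' hS'))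
  rw [← pow_add]
  exact Nat.pow_lt_pow_right hp.one_lt hfg

theorem IsLowerModel.not_isoRep_dual (h : IsLowerModel ρ b) (h' : IsLowerModel ρ' b')
    (hS : HookNodes S w (p ^ e + p ^ f) (p ^ g) (p ^ f))
    (hS' : HookNodes S w (p ^ e + p ^ f') (p ^ g') (p ^ f')) (hf : f < e) (hff' : f' < f) :
    ¬ IsoRep (schurRep (hook (p ^ g) (p ^ f)) ρ).dual
      (schurRep (hook (p ^ g') (p ^ f')) ρ').dual := by
  intro hiso
  have hp := (Fact.out : p.Prime)
  have := h.dvd_of_movesHighest_dual g hf hS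
    ((hiso.movesHighest_iff S w _).2 (h'.movesHighest_dual g' (hff'.trans hf) hS'))
  exact absurd (Nat.le_of_dvd (pow_pos hp.pos _) this)
    (not_le.2 (Nat.pow_lt_pow_right hp.one_lt hff'))

theorem IsUpperModel.not_isoRep (h : IsUpperModel ρ b) (h' : IsUpperModel ρ' b')
    (hS : HookNodes S w (p ^ e + p ^ f) (p ^ f') (p ^ f))
    (hS' : HookNodes S w (p ^ e + p ^ f') (p ^ f) (p ^ f')) (hf : f < e) (hff' : f' < f)
    (hf0 : 0 < f') :
    ¬ IsoRep (schurRep (hook (p ^ f') (p ^ f)) ρ) (schurRep (hook (p ^ f) (p ^ f')) ρ') := by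
  intro hiso
  obtain rfl | hp2 := eq_or_ne p 2
  · exact h.not_hasInvariant hf0 hff' hf hS
      (hiso.symm.hasInvariant (h'.hasInvariant (hff'.trans hf) hf0 (hf0.trans hff') hS'))
  · exact h'.not_movesHighest_mul_sub_one (hff'.trans hf) hf0 hff' hf hp2 hS'
      ((hiso.movesHighest_iff S w _).1 (h.movesHighest_mul_sub_one f' hf hS))

end Separation

/-! ### Enough interpolation nodes in K -/

section Nodes

variable {K : Type u} [Field K]

theorem exists_finset_units_card {n : ℕ} (h : ((n + 1 : ℕ) : ℕ∞) ≤ ENat.card K) :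
    ∃ S : Finset Kˣ, S.card = n := by
  have h1 : ENat.card Kˣ + 1 = ENat.card K := by
    have hinj : Function.Injective (Units.val : Kˣ → K) := Units.val_injective
    have hr : Set.range (Units.val : Kˣ → K) = Set.univ \ {0} := by
      ext x
      simp only [Set.mem_range, Set.mem_sdiff, Set.mem_univ, Set.mem_singleton_iff, true_and]
      exact ⟨fun ⟨y, hy⟩ => hy ▸ y.ne_zero, fun hx => ⟨Units.mk0 x hx, rfl⟩⟩
    rw [← Set.encard_univ K, ← Set.encard_univ Kˣ, ← hinj.encard_image, Set.image_univ, hr,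
      Set.encard_sdiff_singleton_add_one (Set.mem_univ _)]
  rw [← h1, Nat.cast_add, Nat.cast_one, ENat.add_le_add_iff_right ENat.one_ne_top] at h
  rw [← Set.encard_univ Kˣ] at h
  obtain ⟨t, -, ht⟩ := Set.exists_subset_encard_eq h
  have hfin : t.Finite := Set.finite_of_encard_eq_coe ht
  refine ⟨hfin.toFinset, ?_⟩
  rw [hfin.encard_eq_coe_toFinset_card] at ht
  exact_mod_cast ht

theorem exists_hookNodes {p α β ε : ℕ} (hp : 1 < p) (hαβ : α < β) (hβε : β < ε)
    (hK : ((1 + 2 * (p ^ ε + p ^ β) * (p ^ α + p ^ β + 1) : ℕ) : ℕ∞) <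
      ENat.card K + ((p ^ α * (p ^ α + 1) : ℕ) : ℕ∞)) :
    ∃ (S : Finset Kˣ) (w : ℕ), HookNodes S w (p ^ ε + p ^ β) (p ^ α) (p ^ β) ∧
      HookNodes S w (p ^ ε + p ^ α) (p ^ β) (p ^ α) := by
  have hαlt := Nat.pow_lt_pow_right hp hαβ
  have hβlt := Nat.pow_lt_pow_right hp hβε
  set a := p ^ α
  set c := p ^ β
  set q := p ^ ε
  have hac : a * (a + 1) ≤ c * (c + 1) := Nat.mul_le_mul hαlt.le (by omega)
  have hC : a * (a + 1) ≤ (q + c) * (a + c + 1) := Nat.mul_le_mul (by omega) (by omega)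
  have hC' : (q + a) * (c + a + 1) ≤ (q + c) * (a + c + 1) :=
    Nat.mul_le_mul (by omega) (by omega)
  have h2 : 2 * (q + c) * (a + c + 1) = 2 * ((q + c) * (a + c + 1)) := by ring
  -- n units are needed, one more than the largest exponent to be separated; the zero of K accounts
  -- for one further element. The bound serves both hooks because m grows with N and a(a+1) is the
  -- smaller correction.
  obtain ⟨n, hn⟩ : ∃ n, n + a * (a + 1) = 1 + 2 * ((q + c) * (a + c + 1)) :=
    ⟨1 + 2 * ((q + c) * (a + c + 1)) - a * (a + 1), by omega⟩
  have hcard : ((n + 1 : ℕ) : ℕ∞) ≤ ENat.card K := by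
    rw [h2, ← hn, Nat.cast_add] at hK
    have := lt_of_add_lt_add_right hK
    rw [Nat.cast_add, Nat.cast_one]
    exact Order.add_one_le_of_lt this
  obtain ⟨S, hS⟩ := exists_finset_units_card hcard
  -- The highest weight m(M+N+1) - N(N+1) in a form visibly symmetric in a and c, hence common to
  -- both hooks.
  refine ⟨S, q * (a + c + 1) + a * c, ⟨by omega, by ring, by omega, by omega⟩,
    ⟨by omega, by ring, by omega, by omega⟩⟩

end Nodes

/-! ### The eight modules -/

section EightModules

variable {K : Type u} [Field K]

theorem isoRep_of_iso {A B : Rep.{u} K (Matrix.SpecialLinearGroup (Fin 2) K)} (i : A ≅ B) :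
    IsoRep A.ρ B.ρ :=
  ⟨(Representation.equivOfIso i).toLinearEquiv, fun g x => Rep.hom_comm_apply i.hom g x⟩

variable {p : ℕ} [Fact p.Prime] [CharP K p] {α β ε : ℕ} {S : Finset Kˣ} {w : ℕ}

open SchurKind SymKind

theorem not_isoRep_eightModules (hα : 0 < α) (hαβ : α < β) (hβε : β < ε)
    (hS : HookNodes S w (p ^ ε + p ^ β) (p ^ α) (p ^ β))
    (hS' : HookNodes S w (p ^ ε + p ^ α) (p ^ β) (p ^ α)) (c d : SchurKind × SymKind × Bool)
    (hcd : c ≠ d) : ¬ IsoRep (eightModules K p α β ε c).ρ (eightModules K p α β ε d).ρ := by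
  have hp := (Fact.out : p.Prime)
  obtain ⟨b1, h1⟩ := exists_isUpperModel_symUpper K (p ^ ε + p ^ β)
  obtain ⟨b2, h2⟩ := exists_isUpperModel_symUpper K (p ^ ε + p ^ α)
  obtain ⟨b3, h3⟩ := exists_isLowerModel_symLower K (p ^ ε + p ^ β)
  obtain ⟨b4, h4⟩ := exists_isLowerModel_symLower K (p ^ ε + p ^ α)
  obtain ⟨b5, h5⟩ := h1.dual
  obtain ⟨b6, h6⟩ := h2.dual
  obtain ⟨b7, h7⟩ := h3.dual
  obtain ⟨b8, h8⟩ := h4.dual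
  have hαε := hαβ.trans hβε
  have hcast : ∀ f, 0 < f → ((p ^ f : ℕ) : K) = 0 := fun f hf => by
    rw [CharP.cast_eq_zero_iff K p]
    exact dvd_pow_self p hf.ne'
  have hpos : ∀ f, 0 < p ^ f := fun f => pow_pos hp.pos f
  have hone : ∀ f g, 0 < f → 0 < g → 1 < p ^ f * p ^ g := fun f g hf hg => by
    rw [← pow_add]
    exact Nat.one_lt_pow (by omega) hp.one_lt
  have hndvd : ∀ f, 0 < f → ¬ p ^ f ∣ 1 := fun f hf h =>
    absurd (Nat.le_of_dvd one_pos h) (not_le.2 (Nat.one_lt_pow hf.ne' hp.one_lt))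
  have hεone : 1 < p ^ ε := Nat.one_lt_pow (by omega) hp.one_lt
  have hβ := hα.trans hαβ
  -- Degree 1 tells Sym_ from Sym^; the modules of each kind then remain to be told apart.
  have P1 : ∀ F s, MovesHighest S w 1 (eightModules K p α β ε (F, lower, s)).ρ := by
    rintro (_ | _) (_ | _)
    · exact h3.movesHighest hS (hpos β) (by have := hpos ε; omega) (hcast β hβ)
    · exact h4.movesHighest hS' (hpos α) (by have := hpos ε; omega) (hcast α hα)
    · exact h7.movesHighest_dual hS (by have := hpos ε; omega) (hpos α)
    · exact h8.movesHighest_dual hS' (by have := hpos ε; omega) (hpos β)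
  have P2 : ∀ F s, ¬ MovesHighest S w 1 (eightModules K p α β ε (F, upper, s)).ρ := by
    rintro (_ | _) (_ | _)
    · exact h1.not_movesHighest α hβε hS one_pos hεone (hone _ _ hβ hα)
    · exact h2.not_movesHighest β hαε hS' one_pos hεone (hone _ _ hα hβ)
    · exact fun h => hndvd β hβ (h5.dvd_of_movesHighest_dual α hβε hS h)
    · exact fun h => hndvd α hα (h6.dvd_of_movesHighest_dual β hαε hS' h)
  have hS1 : ∀ F F' s s', ¬ IsoRep (eightModules K p α β ε (F, upper, s)).ρ
      (eightModules K p α β ε (F', lower, s')).ρ := fun F F' s s' h =>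
    P2 F s ((h.movesHighest_iff S w 1).2 (P1 F' s'))
  have hU1 : ∀ s s', ¬ IsoRep (eightModules K p α β ε (nabla, upper, s)).ρ
      (eightModules K p α β ε (delta, upper, s')).ρ := by
    rintro (_ | _) (_ | _)
    · exact h1.not_isoRep_dual h5 hS hS hβε hβε (by omega)
    · exact h1.not_isoRep_dual h6 hS hS' hβε hαε (by omega)
    · exact h2.not_isoRep_dual h5 hS' hS hαε hβε (by omega)
    · exact h2.not_isoRep_dual h6 hS' hS' hαε hαε (by omega)
  have hU2 : ¬ IsoRep (eightModules K p α β ε (delta, upper, false)).ρ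
      (eightModules K p α β ε (delta, upper, true)).ρ :=
    h5.not_isoRep_dual h6 hS hS' hβε hαβ
  have hU3 : ¬ IsoRep (eightModules K p α β ε (nabla, upper, false)).ρ
      (eightModules K p α β ε (nabla, upper, true)).ρ :=
    h1.not_isoRep h2 hS hS' hβε hαβ hα
  have : FiniteDimensional K (Module.Dual K (SymLower K (Fin (p ^ ε + p ^ β)) (Fin 2 → K))) :=
    Module.Finite.of_basis b7
  have : FiniteDimensional K (Module.Dual K (SymLower K (Fin (p ^ ε + p ^ α)) (Fin 2 → K))) :=
    Module.Finite.of_basis b8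
  have hfin := finite_schur (K := K) (hook (p ^ α) (p ^ β))
    (V := Module.Dual K (SymLower K (Fin (p ^ ε + p ^ β)) (Fin 2 → K)))
  have hfin' := finite_schur (K := K) (hook (p ^ β) (p ^ α))
    (V := Module.Dual K (SymLower K (Fin (p ^ ε + p ^ α)) (Fin 2 → K)))
  -- The dual of Δ Sym_ is ∇ of an upper model, by double duality in finite dimension. Dualizing
  -- thus brings the Sym_ pairs to the comparisons already made for Sym^.
  have D1 : IsoRep (schurRep (hook (p ^ α) (p ^ β)) (symLowerRep (Fin (p ^ ε + p ^ β))
      (naturalRep K)).dual) (eightModules K p α β ε (delta, lower, false)).ρ.dual :=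
    isoRep_dual_dual _
  have D2 : IsoRep (schurRep (hook (p ^ β) (p ^ α)) (symLowerRep (Fin (p ^ ε + p ^ α))
      (naturalRep K)).dual) (eightModules K p α β ε (delta, lower, true)).ρ.dual :=
    isoRep_dual_dual _
  have hL1 : ∀ s s', ¬ IsoRep (eightModules K p α β ε (nabla, lower, s)).ρ
      (eightModules K p α β ε (delta, lower, s')).ρ := by
    rintro (_ | _) (_ | _) h
    · exact h7.not_isoRep_dual h3 hS hS hβε hβε (by omega) (D1.trans h.dual.symm)
    · exact h8.not_isoRep_dual h3 hS' hS hαε hβε (by omega) (D2.trans h.dual.symm)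
    · exact h7.not_isoRep_dual h4 hS hS' hβε hαε (by omega) (D1.trans h.dual.symm)
    · exact h8.not_isoRep_dual h4 hS' hS' hαε hαε (by omega) (D2.trans h.dual.symm)
  have hL2 : ¬ IsoRep (eightModules K p α β ε (nabla, lower, false)).ρ
      (eightModules K p α β ε (nabla, lower, true)).ρ := fun h =>
    h3.not_isoRep_dual h4 hS hS' hβε hαβ h.dual
  have hL3 : ¬ IsoRep (eightModules K p α β ε (delta, lower, false)).ρ
      (eightModules K p α β ε (delta, lower, true)).ρ := fun h =>
    h7.not_isoRep h8 hS hS' hβε hαβ hα ((D1.trans h.dual).trans D2.symm)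
  obtain ⟨F, s, x⟩ := c
  obtain ⟨F', s', x'⟩ := d
  intro h
  cases s <;> cases s'
  · cases F <;> cases F'
    · cases x <;> cases x'
      · exact hcd rfl
      · exact hU3 h
      · exact hU3 h.symm
      · exact hcd rfl
    · exact hU1 _ _ h
    · exact hU1 _ _ h.symm
    · cases x <;> cases x'
      · exact hcd rfl
      · exact hU2 h
      · exact hU2 h.symm
      · exact hcd rfl
  · exact hS1 _ _ _ _ h
  · exact hS1 _ _ _ _ h.symm
  · cases F <;> cases F'
    · cases x <;> cases x'
      · exact hcd rfl
      · exact hL2 h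
      · exact hL2 h.symm
      · exact hcd rfl
    · exact hL1 _ _ h
    · exact hL1 _ _ h.symm
    · cases x <;> cases x'
      · exact hcd rfl
      · exact hL3 h
      · exact hL3 h.symm
      · exact hcd rfl

end EightModules

end Plethysm

end

theorem theorem1p5 {K : Type*} [Field K] (p : ℕ) [Fact p.Prime] [CharP K p]
    (α β ε : ℕ) (hα : 0 < α) (hαβ : α < β) (hβε : β < ε)
    (hK : ((1 + 2 * (p ^ ε + p ^ β) * (p ^ α + p ^ β + 1) : ℕ) : ℕ∞) <
      ENat.card K + ((p ^ α * (p ^ α + 1) : ℕ) : ℕ∞)) :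
    ∀ c d : Plethysm.SchurKind × Plethysm.SymKind × Bool, c ≠ d →
      IsEmpty (CategoryTheory.Iso (Plethysm.eightModules K p α β ε c)
        (Plethysm.eightModules K p α β ε d)) := by
  intro c d hcd
  obtain ⟨S, w, hS, hS'⟩ :=
    Plethysm.exists_hookNodes (Fact.out : p.Prime).one_lt hαβ hβε hK
  exact ⟨fun i => Plethysm.not_isoRep_eightModules hα hαβ hβε hS hS' c d hcd
    (Plethysm.isoRep_of_iso i)⟩
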